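/- Let $\mathcal{C}$ be a small preadditive category with set of objects $\mathcal{C}_0$, and write $\mathcal{C}(A,B)=\mathrm{Hom}_{\mathcal{C}}(A,B)$. **Conventions.** Rings are associative, not necessarily unital. An object of a category with zero morphisms is *semisimple* if it is a coproduct of simple objects (the zero object being the empty coproduct). $\mathrm{Fun}(\mathcal{C}^{op},\mathcal{A}b)$ and $\mathrm{Fun}(\mathcal{C},\mathcal{A}b)$ are the categories of contravariant and covariant additive functors from $\mathcal{C}$ to abelian groups. $\mathcal{C}$ is a *semisimple category* if $\mathcal{C}(-,A)$ is a semisimple object of $\mathrm{Fun}(\mathcal{C}^{op},\mathcal{A}b)$ for every $A\in\mathcal{C}_0$. Let $\mathcal{G}=\mathcal{C}_0\times\mathcal{C}_0$ be the groupoid in which $(B,A)$ is the unique arrow from $A$ to $B$, so that $(Z,Y)(Y,X)=(Z,X)$ and no other products are defined. The *ring of the category* is $R[\mathcal{C}]=\bigoplus_{A,B\in\mathcal{C}_0}\mathcal{C}(A,B)$, where the product $fg$ of two morphisms is $f\circ g$ if the composite exists and $0$ otherwise; it is $\mathcal{G}$-graded by $R[\mathcal{C}]_{(A,B)}=\mathcal{C}(B,A)$.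 A $\mathcal{G}$-graded ring is *right* (resp. *left*) *gr-semisimple* if, as a right (resp. left) module over itself, it is a sum of graded submodules that are gr-simple, i.e. nonzero and without graded submodules other than $0$ and themselves. $\mathrm{Fun}_{gr}(\mathcal{C}^{op},\mathcal{G}\varepsilon)$ is the category of contravariant additive functors $F$ from $\mathcal{C}$ to $\mathcal{G}$-graded abelian groups (equivalently, unital graded left $\mathbb{Z}^{(\mathcal{C}_0)}$-modules) such that each $F(X)$ is concentrated in the degrees $(A,X)$, $A\in\mathcal{C}_0$, and, for $f\in\mathcal{C}(X,Y)$, $F(f)$ maps $F(Y)_{(A,Y)}$ into $F(X)_{(A,X)}$ for every $A$. Dually, $\mathrm{Fun}_{gr}(\mathcal{C},\varepsilon\mathcal{G})$ is the category of covariant additive functors $F$ from $\mathcal{C}$ to $\mathcal{G}$-graded abelian groups such that each $F(X)$ is concentrated in the degrees $(X,A)$ and, for $f\in\mathcal{C}(X,Y)$, $F(f)$ maps $F(X)_{(X,A)}$ into $F(Y)_{(Y,A)}$ for every $A$. In both cases the morphisms are the natural transformations whose components preserve degrees. For a ring $R$, $\mathrm{fgmod}\text{-}R$ is the category of finitely generated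 right $R$-modules $M$ with $MR=M$. For a family of rings $D_j$, $\bigoplus_j D_j$ has componentwise operations, and $\prod^f_j \mathrm{fgmod}\text{-}D_j$ is the full subcategory of $\prod_j\mathrm{fgmod}\text{-}D_j$ on the families $(M_j)_j$ with $M_j=0$ for all but finitely many $j$. **Theorem.** The following assertions are equivalent: 1. $\mathcal{C}$ is a semisimple category. 2. $R[\mathcal{C}]$ is a gr-semisimple ring (equivalently on the right or on the left: right gr-semisimplicity and left gr-semisimplicity are each equivalent to the other assertions). 3. Every object of $\mathrm{Fun}_{gr}(\mathcal{C}^{op},\mathcal{G}\varepsilon)$ is semisimple. 4. Every object of $\mathrm{Fun}(\mathcal{C}^{op},\mathcal{A}b)$ is semisimple. 5. Every object of $\mathrm{Fun}_{gr}(\mathcal{C},\varepsilon\mathcal{G})$ is semisimple. 6. Every object of $\mathrm{Fun}(\mathcal{C},\mathcal{A}b)$ is semisimple. 7. For all $A\in\mathcal{C}_0$, $\mathcal{C}(A,-)$ is a semisimple object of $\mathrm{Fun}(\mathcal{C},\mathcal{A}b)$. 8. There exist a family $\{D_j : j\in J\}$ of division rings and a function $n:J\times\mathcal{C}_0\to\mathbb{Z}_{\ge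 0}$ such that $\sum_{j\in J}n(j,A)<\infty$ for each $A\in\mathcal{C}_0$, and isomorphisms of additive groups $$\varphi_{(A,B)}:\mathcal{C}(A,B)\longrightarrow\prod_{j\in J}\mathbb{M}_{n(j,B)\times n(j,A)}(D_j)\qquad(A,B\in\mathcal{C}_0)$$ with $\varphi_{(A,B)}(fg)=\varphi_{(X,B)}(f)\cdot\varphi_{(A,X)}(g)$ for all $f\in\mathcal{C}(X,B)$, $g\in\mathcal{C}(A,X)$. 9. There exists a family $\{D_j : j\in J\}$ of division rings such that $\mathcal{C}$ is isomorphic (as a preadditive category) to a small full subcategory of $\mathrm{fgmod}\text{-}\bigoplus_{j\in J}D_j$. 10. There exists a family $\{D_j : j\in J\}$ of division rings such that $\mathcal{C}$ is isomorphic (as a preadditive category) to a small full subcategory of $\prod^f_{j\in J}\mathrm{fgmod}\text{-}D_j$. -/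

import Mathlib

open CategoryTheory CategoryTheory.Limits Opposite
open scoped DirectSum

universe u

noncomputable section

namespace GrCat

/-! ### Semisimple objects -/

/-- An object is semisimple if it is a coproduct of simple objects (the zero object is the empty
coproduct). `Simple` is Mathlib's notion: nonzero and without proper nonzero subobjects. -/
def IsSemisimpleObject {𝒜 : Type*} [Category* 𝒜] [HasZeroMorphisms 𝒜] (X : 𝒜) : Prop :=
  ∃ (ι : Type u) (S : ι → 𝒜) (π : ∀ i, S i ⟶ X),
    (∀ i, Simple (S i)) ∧ Nonempty (IsColimit (Cofan.mk X π))

section Representables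

variable (C : Type u) [SmallCategory C] [Preadditive C]

/-- The additive contravariant functor `C(-, A)`. -/
def homInto (A : C) : Cᵒᵖ ⥤+ AddCommGrpCat.{u} :=
  AdditiveFunctor.of (preadditiveYoneda.obj A)

/-- The additive covariant functor `C(A, -)`. -/
def homFrom (A : C) : C ⥤+ AddCommGrpCat.{u} :=
  AdditiveFunctor.of (preadditiveCoyoneda.obj (op A))

/-- A (right) semisimple category: every `C(-, A)` is a semisimple object of `Fun(Cᵒᵖ, Ab)`. -/
def IsSemisimpleCategory : Prop :=
  ∀ A : C, IsSemisimpleObject.{u} (homInto C A)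

end Representables

/-! ### Graded one-sided ideals and gr-semisimple rings -/

section GradedIdeals

variable {R : Type*} [NonUnitalRing R] {Γ : Type*} (𝒜 : Γ → AddSubgroup R)

/-- `N` is a graded submodule of `R_R`, where `R` is graded by the components `𝒜 γ`. -/
structure IsGradedRightIdeal (N : AddSubgroup R) : Prop where
  mul_mem : ∀ x ∈ N, ∀ r : R, x * r ∈ N
  homogeneous : N = ⨆ γ, N ⊓ 𝒜 γ

/-- `N` is a graded submodule of the left module `R`. -/
structure IsGradedLeftIdeal (N : AddSubgroup R) : Prop where
  mul_mem : ∀ x ∈ N, ∀ r : R, r * x ∈ N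
  homogeneous : N = ⨆ γ, N ⊓ 𝒜 γ

/-- `N` is a gr-simple graded submodule of `R_R`. -/
structure IsGrSimpleRightIdeal (N : AddSubgroup R) : Prop where
  graded : IsGradedRightIdeal 𝒜 N
  ne_bot : N ≠ ⊥
  eq_bot_or_eq : ∀ N' : AddSubgroup R, IsGradedRightIdeal 𝒜 N' → N' ≤ N → N' = ⊥ ∨ N' = N

/-- `N` is a gr-simple graded submodule of the left module `R`. -/
structure IsGrSimpleLeftIdeal (N : AddSubgroup R) : Prop where
  graded : IsGradedLeftIdeal 𝒜 N
  ne_bot : N ≠ ⊥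
  eq_bot_or_eq : ∀ N' : AddSubgroup R, IsGradedLeftIdeal 𝒜 N' → N' ≤ N → N' = ⊥ ∨ N' = N

/-- `R` is right gr-semisimple: `R_R` is a sum of gr-simple graded submodules. -/
def IsRightGrSemisimple : Prop :=
  ∃ 𝒮 : Set (AddSubgroup R), (∀ S ∈ 𝒮, IsGrSimpleRightIdeal 𝒜 S) ∧ sSup 𝒮 = ⊤

/-- `R` is left gr-semisimple: the left module `R` is a sum of gr-simple graded submodules. -/
def IsLeftGrSemisimple : Prop :=
  ∃ 𝒮 : Set (AddSubgroup R), (∀ S ∈ 𝒮, IsGrSimpleLeftIdeal 𝒜 S) ∧ sSup 𝒮 = ⊤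

end GradedIdeals

/-! ### The ring of a category -/

section CatRing

variable (C : Type u) [SmallCategory C] [Preadditive C]

open scoped Classical in
/-- The additive group `⨁ Hom(B, A)`, the summand of index `(A, B)` being `Hom(B, A)`. -/
def CatRing : Type u := ⨁ p : C × C, (p.2 ⟶ p.1)

open scoped Classical in
instance : AddCommGroup (CatRing C) :=
  inferInstanceAs (AddCommGroup (⨁ p : C × C, (p.2 ⟶ p.1)))

namespace CatRing

variable {C}

open scoped Classical in
/-- A morphism `f : B ⟶ A` as a homogeneous element of degree `(A, B)`. -/
def of (A B : C) : (B ⟶ A) →+ CatRing C :=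
  DirectSum.of (fun p : C × C => (p.2 ⟶ p.1)) (A, B)

open scoped Classical in
/-- The product of two homogeneous elements: the composite `f ∘ g` if it makes sense, else `0`. -/
def mulHomog (p q : C × C) : (p.2 ⟶ p.1) →+ (q.2 ⟶ q.1) →+ CatRing C :=
  if h : q.1 = p.2 then
    AddMonoidHom.mk'
      (fun f => AddMonoidHom.mk' (fun g => of p.1 q.2 (g ≫ eqToHom h ≫ f))
        (by intro g g'; rw [Preadditive.add_comp, map_add]))
      (by
        intro f f'
        ext g
        simp only [AddMonoidHom.mk'_apply, AddMonoidHom.add_apply, Preadditive.comp_add, map_add])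
  else 0

open scoped Classical in
/-- The multiplication of the ring of the category, biadditively extended from `mulHomog`. -/
def mulHom : CatRing C →+ CatRing C →+ CatRing C :=
  DirectSum.toAddMonoid fun p =>
    (DirectSum.toAddMonoid fun q => (mulHomog p q).flip).flip

instance : Mul (CatRing C) := ⟨fun x y => mulHom x y⟩

theorem mul_def (x y : CatRing C) : x * y = mulHom x y := rfl

theorem of_mul_of (A B B' D : C) (f : B ⟶ A) (g : D ⟶ B') :
    of A B f * of B' D g = mulHomog (A, B) (B', D) f g := by
  classical
  have h1 : mulHom (of A B f) = (DirectSum.toAddMonoid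
      fun q => (mulHomog (C := C) (A, B) q).flip).flip f :=
    DirectSum.toAddMonoid_of (β := fun p : C × C => (p.2 ⟶ p.1)) _ (A, B) f
  have h2 : (DirectSum.toAddMonoid fun q => (mulHomog (C := C) (A, B) q).flip)
      (DirectSum.of (fun p : C × C => (p.2 ⟶ p.1)) (B', D) g) = (mulHomog (A, B) (B', D)).flip g :=
    DirectSum.toAddMonoid_of (β := fun p : C × C => (p.2 ⟶ p.1)) _ (B', D) g
  rw [mul_def, h1]
  exact DFunLike.congr_fun h2 f

theorem of_mul_of_same (A B D : C) (f : B ⟶ A) (g : D ⟶ B) :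
    of A B f * of B D g = of A D (g ≫ f) := by
  rw [of_mul_of]
  simp [mulHomog]

theorem of_mul_of_ne (A B B' D : C) (f : B ⟶ A) (g : D ⟶ B') (h : B' ≠ B) :
    of A B f * of B' D g = 0 := by
  rw [of_mul_of]
  simp [mulHomog, h]

theorem induction_on {P : CatRing C → Prop} (x : CatRing C) (h0 : P 0)
    (h1 : ∀ A B (f : B ⟶ A), P (of A B f)) (h2 : ∀ x y, P x → P y → P (x + y)) : P x := by
  classical
  exact DirectSum.induction_on x h0 (fun p f => h1 p.1 p.2 f) h2

instance : NonUnitalRing (CatRing C) where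
  left_distrib x y z := by simp only [mul_def, map_add]
  right_distrib x y z := by simp only [mul_def, map_add, AddMonoidHom.add_apply]
  zero_mul x := by simp only [mul_def, map_zero, AddMonoidHom.zero_apply]
  mul_zero x := by simp only [mul_def, map_zero]
  mul_assoc x y z := by
    have ladd : ∀ a b c : CatRing C, (a + b) * c = a * c + b * c := fun a b c => by
      simp only [mul_def, map_add, AddMonoidHom.add_apply]
    have radd : ∀ a b c : CatRing C, a * (b + c) = a * b + a * c := fun a b c => by
      simp only [mul_def, map_add]
    have lz : ∀ a : CatRing C, 0 * a = 0 := fun a => by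
      simp only [mul_def, map_zero, AddMonoidHom.zero_apply]
    have rz : ∀ a : CatRing C, a * 0 = 0 := fun a => by
      simp only [mul_def, map_zero]
    induction x using induction_on with
    | h0 => simp only [lz]
    | h2 x x' hx hx' => simp only [ladd, hx, hx']
    | h1 A B f =>
      induction y using induction_on with
      | h0 => simp only [lz, rz]
      | h2 y y' hy hy' => simp only [ladd, radd, hy, hy']
      | h1 B' D g =>
        induction z using induction_on with
        | h0 => simp only [rz]
        | h2 z z' hz hz' => simp only [radd, hz, hz']
        | h1 D' E k =>
          by_cases h : B' = B
          · subst h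
            by_cases h' : D' = D
            · subst h'
              simp only [of_mul_of_same, Category.assoc]
            · rw [of_mul_of_same, of_mul_of_ne _ _ _ _ _ _ h', of_mul_of_ne _ _ _ _ _ _ h', rz]
          · rw [of_mul_of_ne _ _ _ _ _ _ h, lz]
            by_cases h' : D' = D
            · subst h'
              rw [of_mul_of_same, of_mul_of_ne _ _ _ _ _ _ h]
            · rw [of_mul_of_ne _ _ _ _ _ _ h', rz]

variable (C) in
/-- The `C × C`-grading of the ring of the category: the component of degree `(A, B)` is
`Hom(B, A)`. -/
def component (p : C × C) : AddSubgroup (CatRing C) := (of p.1 p.2).range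

end CatRing

end CatRing

/-! ### Abelian groups graded by the groupoid `X × X`

The arrow `(y, x)` of the groupoid `X × X` goes from `x` to `y`, and `(z, y)(y, x) = (z, x)`. A
unital graded left (or right) module over the ring `ℤ^(X)` is the same thing as a graded abelian
group, because `(n_e) · x = n_{r(γ)} x` (resp. `x · (n_e) = n_{d(γ)} x`) for `x` of degree `γ`. -/

open scoped Classical in
/-- An `X × X`-graded abelian group. -/
structure GradedAb (X : Type u) where
  carrier : Type u
  [grp : AddCommGroup carrier]
  comp : X × X → AddSubgroup carrier
  isInternal : DirectSum.IsInternal comp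

attribute [instance] GradedAb.grp

namespace GradedAb

variable {X : Type u}

/-- gr-homomorphisms: they preserve degrees. -/
def IsGrHom (M N : GradedAb X) (g : M.carrier →+ N.carrier) : Prop :=
  ∀ σ, ∀ m ∈ M.comp σ, g m ∈ N.comp σ

/-- Homomorphisms of degree `γ` of left modules: degree `σ` goes to degree `σγ` if `σγ` is defined,
and to `0` otherwise. -/
def leftHom (M N : GradedAb X) (γ : X × X) : AddSubgroup (M.carrier →+ N.carrier) where
  carrier := {g | ∀ σ : X × X, ∀ m ∈ M.comp σ,
    (σ.2 = γ.1 → g m ∈ N.comp (σ.1, γ.2)) ∧ (σ.2 ≠ γ.1 → g m = 0)}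
  zero_mem' _ _ _ := ⟨fun _ => zero_mem _, fun _ => rfl⟩
  add_mem' hf hg σ m hm :=
    ⟨fun h => add_mem ((hf σ m hm).1 h) ((hg σ m hm).1 h), fun h => by
      rw [AddMonoidHom.add_apply, (hf σ m hm).2 h, (hg σ m hm).2 h, add_zero]⟩
  neg_mem' hf σ m hm :=
    ⟨fun h => neg_mem ((hf σ m hm).1 h), fun h => by
      rw [AddMonoidHom.neg_apply, (hf σ m hm).2 h, neg_zero]⟩

/-- Homomorphisms of degree `γ` of right modules: degree `σ` goes to degree `γσ` if `γσ` is defined,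
and to `0` otherwise. -/
def rightHom (M N : GradedAb X) (γ : X × X) : AddSubgroup (M.carrier →+ N.carrier) where
  carrier := {g | ∀ σ : X × X, ∀ m ∈ M.comp σ,
    (γ.2 = σ.1 → g m ∈ N.comp (γ.1, σ.2)) ∧ (γ.2 ≠ σ.1 → g m = 0)}
  zero_mem' _ _ _ := ⟨fun _ => zero_mem _, fun _ => rfl⟩
  add_mem' hf hg σ m hm :=
    ⟨fun h => add_mem ((hf σ m hm).1 h) ((hg σ m hm).1 h), fun h => by
      rw [AddMonoidHom.add_apply, (hf σ m hm).2 h, (hg σ m hm).2 h, add_zero]⟩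
  neg_mem' hf σ m hm :=
    ⟨fun h => neg_mem ((hf σ m hm).1 h), fun h => by
      rw [AddMonoidHom.neg_apply, (hf σ m hm).2 h, neg_zero]⟩

/-- The group `HOM(M, N)` of left modules, the sum of its components. -/
def leftHOM (M N : GradedAb X) : AddSubgroup (M.carrier →+ N.carrier) := ⨆ γ, leftHom M N γ

/-- The group `HOM(M, N)` of right modules, the sum of its components. -/
def rightHOM (M N : GradedAb X) : AddSubgroup (M.carrier →+ N.carrier) := ⨆ γ, rightHom M N γ

theorem ext_hom (M : GradedAb X) {A : Type*} [AddCommGroup A] (f g : M.carrier →+ A)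
    (h : ∀ σ, ∀ m ∈ M.comp σ, f m = g m) : f = g := by
  classical
  ext m
  obtain ⟨x, rfl⟩ := M.isInternal.2 m
  induction x using DirectSum.induction_on with
  | zero => simp only [map_zero]
  | of σ y =>
    rw [DirectSum.coeAddMonoidHom_of]
    exact h σ y y.2
  | add x y hx hy => simp only [map_add, hx, hy]

theorem leftHOM_comp {M N P : GradedAb X} {f : M.carrier →+ N.carrier} {g : N.carrier →+ P.carrier}
    (hf : f ∈ leftHOM M N) (hg : g ∈ leftHOM N P) : g.comp f ∈ leftHOM M P := by
  refine AddSubgroup.iSup_induction (C := fun f => g.comp f ∈ leftHOM M P) _ hf ?_ ?_ ?_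
  · intro γ f hf
    refine AddSubgroup.iSup_induction (C := fun g => g.comp f ∈ leftHOM M P) _ hg ?_ ?_ ?_
    · intro δ g hg
      by_cases h : γ.2 = δ.1
      · refine AddSubgroup.mem_iSup_of_mem (γ.1, δ.2) fun σ m hm => ⟨fun hσ => ?_, fun hσ => ?_⟩
        · exact (hg _ _ ((hf σ m hm).1 hσ)).1 h
        · rw [AddMonoidHom.comp_apply, (hf σ m hm).2 hσ, map_zero]
      · have : g.comp f = 0 := by
          refine ext_hom M _ _ fun σ m hm => ?_
          by_cases hσ : σ.2 = γ.1
          · exact (hg _ _ ((hf σ m hm).1 hσ)).2 h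
          · rw [AddMonoidHom.comp_apply, (hf σ m hm).2 hσ, map_zero]; rfl
        rw [this]; exact zero_mem _
    · rw [AddMonoidHom.zero_comp]; exact zero_mem _
    · intro g g' h h'
      rw [AddMonoidHom.add_comp]; exact add_mem h h'
  · rw [AddMonoidHom.comp_zero]; exact zero_mem _
  · intro f f' h h'
    rw [AddMonoidHom.comp_add]; exact add_mem h h'

theorem rightHOM_comp {M N P : GradedAb X} {f : M.carrier →+ N.carrier} {g : N.carrier →+ P.carrier}
    (hf : f ∈ rightHOM M N) (hg : g ∈ rightHOM N P) : g.comp f ∈ rightHOM M P := by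
  refine AddSubgroup.iSup_induction (C := fun f => g.comp f ∈ rightHOM M P) _ hf ?_ ?_ ?_
  · intro γ f hf
    refine AddSubgroup.iSup_induction (C := fun g => g.comp f ∈ rightHOM M P) _ hg ?_ ?_ ?_
    · intro δ g hg
      by_cases h : δ.2 = γ.1
      · refine AddSubgroup.mem_iSup_of_mem (δ.1, γ.2) fun σ m hm => ⟨fun hσ => ?_, fun hσ => ?_⟩
        · exact (hg _ _ ((hf σ m hm).1 hσ)).1 h
        · rw [AddMonoidHom.comp_apply, (hf σ m hm).2 hσ, map_zero]
      · have : g.comp f = 0 := by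
          refine ext_hom M _ _ fun σ m hm => ?_
          by_cases hσ : γ.2 = σ.1
          · exact (hg _ _ ((hf σ m hm).1 hσ)).2 h
          · rw [AddMonoidHom.comp_apply, (hf σ m hm).2 hσ, map_zero]; rfl
        rw [this]; exact zero_mem _
    · rw [AddMonoidHom.zero_comp]; exact zero_mem _
    · intro g g' h h'
      rw [AddMonoidHom.add_comp]; exact add_mem h h'
  · rw [AddMonoidHom.comp_zero]; exact zero_mem _
  · intro f f' h h'
    rw [AddMonoidHom.comp_add]; exact add_mem h h'

end GradedAb

/-- The objects of the category of graded left modules `M` with support in `(X × X)ε` for some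
`ε ∈ X`, with hom-groups `HOM(M, N)`. -/
structure GrLeft (X : Type u) extends GradedAb X where
  supp : ∃ e : X, ∀ σ : X × X, σ.2 ≠ e → comp σ = ⊥

/-- The objects of the category of graded right modules `M` with support in `ε(X × X)` for some
`ε ∈ X`, with hom-groups `HOM(M, N)`. -/
structure GrRight (X : Type u) extends GradedAb X where
  supp : ∃ e : X, ∀ σ : X × X, σ.1 ≠ e → comp σ = ⊥

instance (X : Type u) : Category (GrLeft X) where
  Hom M N := GradedAb.leftHOM M.toGradedAb N.toGradedAb
  id M := ⟨AddMonoidHom.id _, by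
    obtain ⟨e, he⟩ := M.supp
    refine AddSubgroup.mem_iSup_of_mem (e, e) fun σ m hm => ⟨fun h => ?_, fun h => ?_⟩
    · obtain ⟨a, b⟩ := σ
      dsimp only at h
      subst h
      exact hm
    · rw [he σ h] at hm
      exact hm⟩
  comp f g := ⟨g.1.comp f.1, GradedAb.leftHOM_comp f.2 g.2⟩

instance (X : Type u) : Category (GrRight X) where
  Hom M N := GradedAb.rightHOM M.toGradedAb N.toGradedAb
  id M := ⟨AddMonoidHom.id _, by
    obtain ⟨e, he⟩ := M.supp
    refine AddSubgroup.mem_iSup_of_mem (e, e) fun σ m hm => ⟨fun h => ?_, fun h => ?_⟩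
    · obtain ⟨a, b⟩ := σ
      dsimp only at h
      subst h
      exact hm
    · rw [he σ (Ne.symm h)] at hm
      exact hm⟩
  comp f g := ⟨g.1.comp f.1, GradedAb.rightHOM_comp f.2 g.2⟩

/-- The homomorphism of groups underlying a morphism. -/
def GrLeft.toHom {X : Type u} {M N : GrLeft X} (f : M ⟶ N) : M.carrier →+ N.carrier := f.1

/-- The homomorphism of groups underlying a morphism. -/
def GrRight.toHom {X : Type u} {M N : GrRight X} (f : M ⟶ N) : M.carrier →+ N.carrier := f.1

instance (X : Type u) : Preadditive (GrLeft X) where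
  homGroup M N := inferInstanceAs (AddCommGroup (GradedAb.leftHOM M.toGradedAb N.toGradedAb))
  add_comp _ _ _ f f' g := Subtype.ext (AddMonoidHom.comp_add g.1 f.1 f'.1)
  comp_add _ _ _ f g g' := Subtype.ext (AddMonoidHom.add_comp g.1 g'.1 f.1)

instance (X : Type u) : Preadditive (GrRight X) where
  homGroup M N := inferInstanceAs (AddCommGroup (GradedAb.rightHOM M.toGradedAb N.toGradedAb))
  add_comp _ _ _ f f' g := Subtype.ext (AddMonoidHom.comp_add g.1 f.1 f'.1)
  comp_add _ _ _ f g g' := Subtype.ext (AddMonoidHom.add_comp g.1 g'.1 f.1)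

/-! ### Graded functors -/

section GrFun

variable (C : Type u) [SmallCategory C] [Preadditive C]

/-- Additive contravariant functors `F` from `C` to graded left modules, such that `F(f)` has degree
`(Y, X)` for every `f : X ⟶ Y`. -/
structure GrFunOp where
  F : Cᵒᵖ ⥤ GrLeft C
  additive : F.Additive
  degree : ∀ {X Y : C} (f : X ⟶ Y), GrLeft.toHom (F.map f.op) ∈
    GradedAb.leftHom (F.obj (op Y)).toGradedAb (F.obj (op X)).toGradedAb (Y, X)

/-- Additive covariant functors `F` from `C` to graded right modules, such that `F(f)` has degree
`(Y, X)` for every `f : X ⟶ Y`. -/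
structure GrFun where
  F : C ⥤ GrRight C
  additive : F.Additive
  degree : ∀ {X Y : C} (f : X ⟶ Y), GrRight.toHom (F.map f) ∈
    GradedAb.rightHom (F.obj X).toGradedAb (F.obj Y).toGradedAb (Y, X)

variable {C}

/-- Morphisms are the natural transformations whose components are gr-homomorphisms. -/
@[ext]
structure GrFunOp.Hom (F G : GrFunOp C) where
  nat : F.F ⟶ G.F
  gr : ∀ X : Cᵒᵖ, GradedAb.IsGrHom (F.F.obj X).toGradedAb (G.F.obj X).toGradedAb
    (GrLeft.toHom (nat.app X))

/-- Morphisms are the natural transformations whose components are gr-homomorphisms. -/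
@[ext]
structure GrFun.Hom (F G : GrFun C) where
  nat : F.F ⟶ G.F
  gr : ∀ X : C, GradedAb.IsGrHom (F.F.obj X).toGradedAb (G.F.obj X).toGradedAb
    (GrRight.toHom (nat.app X))

instance : Category (GrFunOp C) where
  Hom := GrFunOp.Hom
  id F := ⟨𝟙 F.F, fun _ _ _ hm => hm⟩
  comp f g := ⟨f.nat ≫ g.nat, fun X σ m hm => g.gr X σ _ (f.gr X σ m hm)⟩
  id_comp f := GrFunOp.Hom.ext (Category.id_comp f.nat)
  comp_id f := GrFunOp.Hom.ext (Category.comp_id f.nat)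
  assoc f g h := GrFunOp.Hom.ext (Category.assoc f.nat g.nat h.nat)

instance : Category (GrFun C) where
  Hom := GrFun.Hom
  id F := ⟨𝟙 F.F, fun _ _ _ hm => hm⟩
  comp f g := ⟨f.nat ≫ g.nat, fun X σ m hm => g.gr X σ _ (f.gr X σ m hm)⟩
  id_comp f := GrFun.Hom.ext (Category.id_comp f.nat)
  comp_id f := GrFun.Hom.ext (Category.comp_id f.nat)
  assoc f g h := GrFun.Hom.ext (Category.assoc f.nat g.nat h.nat)

instance : HasZeroMorphisms (GrFunOp C) where
  zero _ _ := ⟨⟨0, fun _ _ _ _ => zero_mem _⟩⟩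
  comp_zero f H := GrFunOp.Hom.ext (comp_zero (f := f.nat) (Z := H.F))
  zero_comp F _ _ f := GrFunOp.Hom.ext (zero_comp (X := F.F) (f := f.nat))

instance : HasZeroMorphisms (GrFun C) where
  zero _ _ := ⟨⟨0, fun _ _ _ _ => zero_mem _⟩⟩
  comp_zero f H := GrFun.Hom.ext (comp_zero (f := f.nat) (Z := H.F))
  zero_comp F _ _ f := GrFun.Hom.ext (zero_comp (X := F.F) (f := f.nat))

end GrFun

/-! ### Finitely generated unital right modules over a possibly nonunital ring -/

/-- A finitely generated unital right module over the possibly nonunital ring `R`, with underlying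
set a subset of `U`. The ambient set `U` makes it possible to speak about distinct but isomorphic
modules: the members of any set of modules have their underlying sets in a common set `U`. -/
structure FGMod (R : Type u) [NonUnitalRing R] (U : Type u) where
  carrier : Set U
  [grp : AddCommGroup carrier]
  /-- the right action `(m, r) ↦ m r` -/
  act : carrier →+ R →+ carrier
  act_mul : ∀ m r s, act m (r * s) = act (act m r) s
  /-- `M R = M` -/
  unital : AddSubgroup.closure {x | ∃ m r, act m r = x} = ⊤
  /-- a finite set is contained in no proper submodule -/
  fg : ∃ s : Finset carrier, ∀ N : AddSubgroup carrier, (∀ m ∈ s, m ∈ N) →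
    (∀ m ∈ N, ∀ r, act m r ∈ N) → N = ⊤

attribute [instance] FGMod.grp

namespace FGMod

variable {R : Type u} [NonUnitalRing R] {U : Type u}

/-- The group of homomorphisms of right modules. -/
def homGroup (M N : FGMod R U) : AddSubgroup (M.carrier →+ N.carrier) where
  carrier := {f | ∀ m r, f (M.act m r) = N.act (f m) r}
  zero_mem' m r := by simp
  add_mem' hf hg m r := by
    rw [AddMonoidHom.add_apply, hf m r, hg m r, AddMonoidHom.add_apply, map_add,
      AddMonoidHom.add_apply]
  neg_mem' hf m r := by
    rw [AddMonoidHom.neg_apply, hf m r, AddMonoidHom.neg_apply, map_neg, AddMonoidHom.neg_apply]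

instance : Category (FGMod R U) where
  Hom M N := homGroup M N
  id M := ⟨AddMonoidHom.id _, fun _ _ => rfl⟩
  comp f g := ⟨g.1.comp f.1, fun m r => (congrArg g.1 (f.2 m r)).trans (g.2 (f.1 m) r)⟩

instance : Preadditive (FGMod R U) where
  homGroup M N := inferInstanceAs (AddCommGroup (homGroup M N))
  add_comp _ _ _ f f' g := Subtype.ext (AddMonoidHom.comp_add g.1 f.1 f'.1)
  comp_add _ _ _ f g g' := Subtype.ext (AddMonoidHom.add_comp g.1 g'.1 f.1)

end FGMod

/-- The (possibly nonunital) ring `⨁ D j`: the families with finite support, with componentwise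
operations. -/
def directSumRing {J : Type u} (D : J → Type u) [∀ j, NonUnitalRing (D j)] :
    NonUnitalSubring (∀ j, D j) where
  carrier := {x | {j | x j ≠ 0}.Finite}
  zero_mem' := by simp
  add_mem' {x y} hx hy := by
    refine (Set.Finite.union hx hy).subset fun j hj => ?_
    by_contra h
    rw [Set.mem_union, not_or] at h
    exact hj (by rw [Pi.add_apply, not_not.mp h.1, not_not.mp h.2, add_zero])
  neg_mem' {x} hx := Set.Finite.subset hx fun j hj h => hj (by rw [Pi.neg_apply, h, neg_zero])
  mul_mem' {x y} hx _ :=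
    Set.Finite.subset hx fun j hj h => hj (by rw [Pi.mul_apply, h, zero_mul])

section Products

variable {J : Type u} (𝒞 : J → Type u) [∀ j, SmallCategory (𝒞 j)] [∀ j, Preadditive (𝒞 j)]

/-- A product of preadditive categories is preadditive, componentwise. -/
instance piPreadditive : Preadditive (∀ j, 𝒞 j) where
  homGroup A B := inferInstanceAs (AddCommGroup (∀ j, A j ⟶ B j))
  add_comp _ _ _ f f' g := funext fun j => Preadditive.add_comp _ _ _ (f j) (f' j) (g j)
  comp_add _ _ _ f g g' := funext fun j => Preadditive.comp_add _ _ _ (f j) (g j) (g' j)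

/-- The families all but finitely many of whose members are zero objects. -/
def finiteSupport : ObjectProperty (∀ j, 𝒞 j) :=
  fun A => {j | ¬ IsZero (A j)}.Finite

/-- The full subcategory of the product on the families with finite support. -/
abbrev FinProd : Type u := (finiteSupport 𝒞).FullSubcategory

end Products

/-- `𝒞` is isomorphic, as a preadditive category, to a full subcategory of `𝒟`: there is an additive
functor from `𝒞` to `𝒟` which is injective on objects and bijective on morphism sets, that is, an
isomorphism of `𝒞` onto the full subcategory of `𝒟` on the image. -/
def IsIsoToFullSubcategory (𝒞 𝒟 : Type*) [Category* 𝒞] [Category* 𝒟] [Preadditive 𝒞]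
    [Preadditive 𝒟] : Prop :=
  ∃ F : 𝒞 ⥤ 𝒟, F.Additive ∧ F.Full ∧ F.Faithful ∧ Function.Injective F.obj

end GrCat

end

/-! The hub of the equivalences is the matrix description `IsMatrixCategory`: the groups `C(A, B)`
are products of matrix groups over division rings, with finitely many nonempty blocks at each
object. It is tied to semisimplicity by the Wedderburn–Artin argument. If the functors `C(A, -)` are
semisimple, they are finite sums of simple functors, being generated by the identity of `A`; the
Yoneda lemma and Schur's lemma then turn morphisms into matrices over opposite endomorphism rings
(`isMatrixCategory_of_homFrom`). Conversely, the diagonal matrix units split `C(A, -)` into pieces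
that are simple because a nonzero entry can be inverted (`homFrom_of_isMatrixCategory`).
Transposition gives the same description of the opposite category (`IsMatrixCategory.op`), whence
the left-right symmetry. Semisimplicity spreads from representable functors to all functors, since
every functor is a sum of images of representable ones.

Every notion of semisimplicity is moved to modules over a unital ring. A functor `F` becomes the sum
of its values, a module over the free ring on the arrows; identities act as projections, so
submodules are subfunctors and linear maps are natural transformations. By `isSemisimpleObject_iff`,
a fully faithful functor to modules along which submodules and quotients lift identifies semisimple
objects, defined through coproducts, with semisimple modules. Graded left ideals of `R[C]` are the
submodules for left multiplications by arrows and right multiplications by identities; the ring is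
the sum of the `C(D, -)`, on which the additional operators act as `0` or `1`. Right ideals are left
ideals for the opposite category. A graded functor is a family of ordinary functors, one for each
free coordinate of the degree, and it is semisimple exactly when every member is.

For the module categories, bases translate matrices into linear maps of finite dimensional right
vector spaces. A finitely generated unital module over a direct sum of division rings is a finite
sum of such spaces, cut out by the idempotents of the ring. An isomorphism with a full subcategory,
rather than an equivalence with one, is obtained by labelling the elements of each module with the
object that it realizes. -/

noncomputable section

namespace GrCat

/-! ### Modules over free rings -/

section FreeMod

variable {S T : Type*} {M N : Type*} [AddCommGroup M] [AddCommGroup N]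

/-- An abelian group with a family of endomorphisms, as a module over a free ring. -/
@[nolint unusedArguments]
def FreeMod (_ : S → AddMonoid.End M) : Type _ := M

namespace FreeMod

variable (ρ : S → AddMonoid.End M) (τ : T → AddMonoid.End N)

instance : AddCommGroup (FreeMod ρ) := inferInstanceAs (AddCommGroup M)

instance : Module (FreeAlgebra ℤ S) (FreeMod ρ) :=
  Module.compHom M (FreeAlgebra.lift ℤ ρ).toRingHom

/-- The identity map, as an additive equivalence. -/
def equiv : M ≃+ FreeMod ρ := AddEquiv.refl M

variable {ρ}

theorem ι_smul (s : S) (m : M) : FreeAlgebra.ι ℤ s • equiv ρ m = equiv ρ (ρ s m) := by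
  change (FreeAlgebra.lift ℤ ρ (FreeAlgebra.ι ℤ s)) m = ρ s m
  rw [FreeAlgebra.lift_ι_apply]

theorem ι_smul' (s : S) (m : FreeMod ρ) :
    FreeAlgebra.ι ℤ s • m = equiv ρ (ρ s ((equiv ρ).symm m)) :=
  ι_smul s ((equiv ρ).symm m)

/-- An additive map which is semilinear on generators is semilinear. -/
def semilinear {Λ P : Type*} [Ring Λ] [AddCommGroup P] [Module Λ P]
    (σ : FreeAlgebra ℤ S →+* Λ) (f : M →+ P)
    (h : ∀ s m, f (ρ s m) = σ (FreeAlgebra.ι ℤ s) • f m) : FreeMod ρ →ₛₗ[σ] P where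
  toFun m := f ((equiv ρ).symm m)
  map_add' x y := by simp
  map_smul' a m := by
    induction a using FreeAlgebra.induction generalizing m with
    | grade0 r =>
      simp only [eq_intCast, map_intCast, Int.cast_smul_eq_zsmul, map_zsmul]
    | grade1 s =>
      rw [ι_smul', AddEquiv.symm_apply_apply, h]
    | mul a b ha hb => rw [mul_smul, ha, hb, map_mul, mul_smul]
    | add a b ha hb => rw [add_smul, map_add, map_add, ha, hb, map_add, add_smul]

/-- An additive map which commutes with the generators is linear. -/
def linear (ρ : S → AddMonoid.End M) (τ : S → AddMonoid.End N) (f : M →+ N)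
    (h : ∀ s m, f (ρ s m) = τ s (f m)) :
    FreeMod ρ →ₗ[FreeAlgebra ℤ S] FreeMod τ :=
  semilinear (RingHom.id _) ((equiv τ).toAddMonoidHom.comp f) fun s m => by
    simp [ι_smul, h]

variable (ρ) in
/-- A subgroup stable under the generators is a submodule. -/
def submodule (A : AddSubgroup M) (h : ∀ s, ∀ m ∈ A, ρ s m ∈ A) :
    Submodule (FreeAlgebra ℤ S) (FreeMod ρ) where
  carrier := {m | (equiv ρ).symm m ∈ A}
  add_mem' hx hy := A.add_mem hx hy
  zero_mem' := A.zero_mem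
  smul_mem' a m hm := by
    induction a using FreeAlgebra.induction generalizing m with
    | grade0 r =>
      simp only [eq_intCast, Int.cast_smul_eq_zsmul, Set.mem_ofPred_eq, map_zsmul]
      exact A.zsmul_mem hm r
    | grade1 s =>
      simp only [ι_smul', Set.mem_ofPred_eq, AddEquiv.symm_apply_apply]
      exact h s _ hm
    | mul a b ha hb => rw [mul_smul]; exact ha _ (hb _ hm)
    | add a b ha hb =>
      rw [add_smul]
      exact A.add_mem (ha _ hm) (hb _ hm)

theorem rho_mem (N : Submodule (FreeAlgebra ℤ S) (FreeMod ρ)) (s : S) {m : M}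
    (hm : equiv ρ m ∈ N) : equiv ρ (ρ s m) ∈ N := by
  rw [← ι_smul]
  exact N.smul_mem _ hm

end FreeMod

end FreeMod

/-! ### Semisimple objects and semisimple modules -/

section Comparison

variable {𝒜 : Type*} [Category* 𝒜] [HasZeroMorphisms 𝒜] {Λ : Type*} [Ring Λ]
  (U : 𝒜 ⥤ ModuleCat.{u} Λ)

/-- Every submodule of `U X` comes from a morphism to `X`. -/
def LiftsSubmodules : Prop :=
  ∀ (X : 𝒜) (N : Submodule Λ (U.obj X)), ∃ (Y : 𝒜) (i : Y ⟶ X),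
    Function.Injective (U.map i).hom ∧ LinearMap.range (U.map i).hom = N

/-- Every submodule of `U X` is the kernel of a morphism from `X`. -/
def LiftsQuotients : Prop :=
  ∀ (X : 𝒜) (N : Submodule Λ (U.obj X)), ∃ (Y : 𝒜) (q : X ⟶ Y),
    LinearMap.ker (U.map q).hom = N

variable {U} [U.Faithful] [U.PreservesZeroMorphisms]

theorem mono_of_injective {𝒜 : Type*} [Category* 𝒜] {Λ : Type*} [Ring Λ]
    {U : 𝒜 ⥤ ModuleCat.{u} Λ} [U.Faithful] {X Y : 𝒜} (i : X ⟶ Y) (hi : Function.Injective (U.map i).hom) :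
    Mono i := by
  have : Mono (U.map i) := (ModuleCat.mono_iff_injective _).2 hi
  exact U.mono_of_mono_map this

/-- For a merely faithful `U` a monomorphism need not be injective on modules. Here the kernel of
`U.map i` lifts to a morphism `k` with `k ≫ i = 0`; cancelling `i` gives `k = 0`, so the kernel
vanishes. -/
theorem injective_of_mono (hU : LiftsSubmodules U) {X Y : 𝒜} (i : X ⟶ Y) [Mono i] :
    Function.Injective (U.map i).hom := by
  obtain ⟨K, k, -, hk⟩ := hU X (LinearMap.ker (U.map i).hom)
  have h0 : k ≫ i = 0 := U.map_injective <| by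
    ext x
    have : (U.map k).hom x ∈ LinearMap.ker (U.map i).hom := hk ▸ LinearMap.mem_range_self _ x
    simpa using this
  have hk0 : k = 0 := (cancel_mono i).1 (by rw [h0, zero_comp])
  rw [← LinearMap.ker_eq_bot, ← hk, hk0]
  ext x
  simp

variable [U.Full]

/-- Lifted inclusions are monomorphisms, monomorphisms are injective, and `U` reflects isomorphisms,
so proper nonzero subobjects and proper nonzero submodules occur together. -/
theorem simple_iff_isSimpleModule (hU : LiftsSubmodules U) (X : 𝒜) :
    Simple X ↔ IsSimpleModule Λ (U.obj X) := by
  constructor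
  · intro h
    have hid : (𝟙 X : X ⟶ X) ≠ 0 := id_nonzero X
    have hnt : Nontrivial (Submodule Λ (U.obj X)) := by
      rw [Submodule.nontrivial_iff]
      by_contra hn
      rw [not_nontrivial_iff_subsingleton] at hn
      exact hid (U.map_injective (by ext x; exact Subsingleton.elim _ _))
    refine (isSimpleModule_iff _ _).2 ⟨fun N => ?_⟩
    obtain ⟨Y, i, hi, rfl⟩ := hU X N
    have := mono_of_injective i hi
    by_cases h0 : i = 0
    · left
      rw [h0]
      ext x
      simp
    · right
      have := (Simple.mono_isIso_iff_nonzero i).2 h0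
      rw [LinearMap.range_eq_top]
      exact ((ConcreteCategory.bijective_of_isIso (U.map i))).2
  · intro h
    refine ⟨fun {Y} f hf => ⟨?_, fun h0 => ?_⟩⟩
    · rintro hiso rfl
      have h1 : 𝟙 X = 0 := by rw [← IsIso.inv_hom_id (0 : Y ⟶ X), comp_zero]
      have := IsSimpleModule.nontrivial Λ (U.obj X)
      obtain ⟨x, hx⟩ := exists_ne (0 : U.obj X)
      apply hx
      have h2 := congrArg (fun g => (U.map g).hom x) h1
      simpa using h2
    · have hinj := injective_of_mono hU f
      have hne : (U.map f).hom ≠ 0 := fun hz => h0 (U.map_injective (by ext x; simp [hz]))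
      have hsurj := LinearMap.surjective_of_ne_zero hne
      have : IsIso (U.map f) := (ConcreteCategory.isIso_iff_bijective (U.map f)).2 ⟨hinj, hsurj⟩
      exact isIso_of_reflects_iso f U

/-- `U` is not assumed to preserve coproducts, so it has to be shown that the images of the simple
summands span. The lifted quotient map by their sum vanishes on every summand, hence is zero by
uniqueness in the colimit; its kernel, the sum, is therefore everything. -/
theorem isSemisimpleModule_of_isSemisimpleObject (hU : LiftsSubmodules U) (hq : LiftsQuotients U)
    {X : 𝒜} (hX : IsSemisimpleObject.{u} X) : IsSemisimpleModule Λ (U.obj X) := by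
  obtain ⟨ι, S, π, hS, ⟨hc⟩⟩ := hX
  refine isSemisimpleModule_of_isSemisimpleModule_submodule'
    (p := fun i => LinearMap.range (U.map (π i)).hom) (fun i => ?_) ?_
  · have := (simple_iff_isSimpleModule hU (S i)).1 (hS i)
    exact IsSemisimpleModule.range _
  · obtain ⟨Y, q, hY⟩ := hq X (⨆ i, LinearMap.range (U.map (π i)).hom)
    have : q = 0 := Cofan.IsColimit.hom_ext hc _ _ fun i => U.map_injective <| by
      ext x
      have : (U.map (π i)).hom x ∈ LinearMap.ker (U.map q).hom :=
        hY ▸ Submodule.mem_iSup_of_mem i (LinearMap.mem_range_self _ x)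
      simpa using this
    rw [← hY, this]
    ext x
    simp

/-- A semisimple module is the internal direct sum of an independent set of simple submodules. Their
lifts form a cofan, and the universal property of the direct sum comes back along the fully faithful
`U`. -/
theorem isSemisimpleObject_of_isSemisimpleModule (hU : LiftsSubmodules U)
    {X : 𝒜} (hX : IsSemisimpleModule Λ (U.obj X)) : IsSemisimpleObject.{u} X := by
  classical
  obtain ⟨s, hind, htop, hs⟩ :=
    IsSemisimpleModule.exists_sSupIndep_sSup_simples_eq_top Λ (U.obj X)
  choose Y i hi hr using fun m : s => hU X m.1
  have hint : DirectSum.IsInternal fun m : s => m.1 := by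
    rw [DirectSum.isInternal_submodule_iff_iSupIndep_and_iSup_eq_top]
    exact ⟨(sSupIndep_iff _).1 hind, by rw [← sSup_eq_iSup', htop]⟩
  let e : (⨁ m : s, m.1) ≃ₗ[Λ] U.obj X := LinearEquiv.ofBijective (DirectSum.coeLinearMap _) hint
  let r : ∀ m : s, U.obj (Y m) ≃ₗ[Λ] m.1 := fun m =>
    (LinearEquiv.ofInjective _ (hi m)).trans (LinearEquiv.ofEq _ _ (hr m))
  have he : ∀ (m : s) (y : U.obj (Y m)),
      e (DirectSum.lof Λ s (fun m => m.1) m (r m y)) = (U.map (i m)).hom y := fun m y => by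
    change DirectSum.coeLinearMap (fun m : s => m.1) (DirectSum.lof Λ s _ m (r m y)) = _
    rw [DirectSum.coeLinearMap_lof]
    rfl
  refine ⟨s, Y, i, fun m => ?_, ⟨Cofan.IsColimit.mk _ (fun t => U.preimage (ModuleCat.ofHom
    (DirectSum.toModule Λ s (U.obj t.pt) (fun m => (U.map (t.inj m)).hom ∘ₗ (r m).symm.toLinearMap)
      ∘ₗ e.symm.toLinearMap))) ?_ ?_⟩⟩
  · have := hs m.1 m.2
    exact (simple_iff_isSimpleModule hU _).2 (IsSimpleModule.congr (r m))
  · intro t m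
    apply U.map_injective
    ext y
    simp [← he]
  · intro t f hf
    apply U.map_injective
    rw [U.map_preimage]
    ext x
    obtain ⟨x, rfl⟩ := e.surjective x
    induction x using DirectSum.induction_on with
    | zero => simp
    | add x y hx hy => simp only [map_add, hx, hy]
    | of m y =>
      obtain ⟨y, rfl⟩ := (r m).surjective y
      have h1 := he m y
      rw [DirectSum.lof_eq_of] at h1
      have h2 := congrArg (fun g => (U.map g).hom y) (hf m)
      simp only [Cofan.mk_pt, Functor.map_comp, ModuleCat.hom_comp, LinearMap.comp_apply] at h2
      rw [h1]
      refine h2.trans ?_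
      rw [← h1]
      simp [← DirectSum.lof_eq_of Λ]

theorem isSemisimpleObject_iff (hU : LiftsSubmodules U) (hq : LiftsQuotients U) (X : 𝒜) :
    IsSemisimpleObject.{u} X ↔ IsSemisimpleModule Λ (U.obj X) :=
  ⟨isSemisimpleModule_of_isSemisimpleObject hU hq, isSemisimpleObject_of_isSemisimpleModule hU⟩

end Comparison

/-! ### Additive functors as modules -/

section Total

variable {D : Type u} [SmallCategory D] [Preadditive D]

variable (D) in
/-- The arrows of a category. -/
abbrev Arrows : Type u := Σ (X Y : D), (X ⟶ Y)

open scoped Classical in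
/-- The action of an arrow on the direct sum of the values of a functor. -/
def arrowAct (F : D ⥤+ AddCommGrpCat.{u}) (s : Arrows D) :
    AddMonoid.End (⨁ X : D, F.obj.obj X) :=
  (DirectSum.of (fun X : D => F.obj.obj X) s.2.1).comp
    ((F.obj.map s.2.2).hom.comp (DFinsupp.evalAddMonoidHom s.1))

open scoped Classical in
theorem arrowAct_apply (F : D ⥤+ AddCommGrpCat.{u}) {X Y : D} (f : X ⟶ Y)
    (m : ⨁ X : D, F.obj.obj X) :
    arrowAct F ⟨X, Y, f⟩ m = DirectSum.of (fun X : D => F.obj.obj X) Y (F.obj.map f (m X)) := rfl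

/-- The coordinate at `X` of an element of the direct sum of the values of `F`. -/
def coord (F : D ⥤+ AddCommGrpCat.{u}) (X : D) : FreeMod (arrowAct F) →+ F.obj.obj X :=
  DFinsupp.evalAddMonoidHom (β := fun X : D => F.obj.obj X) X

open scoped Classical in
/-- The inclusion of the value at `X` into the direct sum of the values of `F`. -/
def incl (F : D ⥤+ AddCommGrpCat.{u}) (X : D) : F.obj.obj X →+ FreeMod (arrowAct F) :=
  DirectSum.of (fun X : D => F.obj.obj X) X

section Coord

variable {F G : D ⥤+ AddCommGrpCat.{u}}

@[simp]
theorem coord_incl (X : D) (x : F.obj.obj X) : coord F X (incl F X x) = x := by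
  classical
  exact DirectSum.of_eq_same (β := fun X : D => F.obj.obj X) X x

theorem coord_ext {x y : FreeMod (arrowAct F)} (h : ∀ X, coord F X x = coord F X y) : x = y :=
  DFinsupp.ext h

theorem arrow_smul {X Y : D} (f : X ⟶ Y) (m : FreeMod (arrowAct F)) :
    (FreeAlgebra.ι ℤ (⟨X, Y, f⟩ : Arrows D)) • m = incl F Y (F.obj.map f (coord F X m)) := by
  classical
  exact FreeMod.ι_smul' _ m

theorem id_smul (X : D) (m : FreeMod (arrowAct F)) :
    (FreeAlgebra.ι ℤ (⟨X, X, 𝟙 X⟩ : Arrows D)) • m = incl F X (coord F X m) := by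
  rw [arrow_smul, F.obj.map_id]
  rfl

/-- Identity arrows act as the projections onto the values of `F`. Hence every submodule is
automatically homogeneous, although no grading is part of the module structure. -/
theorem total_mem_iff (N : Submodule (FreeAlgebra ℤ (Arrows D)) (FreeMod (arrowAct F)))
    (m : FreeMod (arrowAct F)) : m ∈ N ↔ ∀ X, incl F X (coord F X m) ∈ N := by
  classical
  constructor
  · intro h X
    rw [← id_smul]
    exact N.smul_mem _ h
  · intro h
    let m' : ⨁ X : D, F.obj.obj X := m
    have h1 : ∑ X ∈ m'.support, incl F X (coord F X m) = m := DirectSum.sum_support_of m'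
    rw [← h1]
    exact N.sum_mem fun X _ => h X

theorem total_induction {p : FreeMod (arrowAct F) → Prop} (m : FreeMod (arrowAct F)) (h0 : p 0)
    (h1 : ∀ X x, p (incl F X x)) (h2 : ∀ x y, p x → p y → p (x + y)) : p m := by
  classical
  exact DirectSum.induction_on (β := fun X : D => F.obj.obj X) m h0 h1 h2

/-- The direct sum of the components of a natural transformation. -/
def totalMap (α : F ⟶ G) :
    FreeMod (arrowAct F) →ₗ[FreeAlgebra ℤ (Arrows D)] FreeMod (arrowAct G) :=
  FreeMod.linear _ _ (DirectSum.map fun X => (α.hom.app X).hom) <| by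
    classical
    rintro ⟨X, Y, f⟩ m
    rw [arrowAct_apply, arrowAct_apply, DirectSum.map_of, DirectSum.map_apply]
    exact congrArg _ (ConcreteCategory.congr_hom (α.hom.naturality f) (m X))

@[simp]
theorem coord_totalMap (α : F ⟶ G) (m : FreeMod (arrowAct F)) (X : D) :
    coord G X (totalMap α m) = α.hom.app X (coord F X m) :=
  DirectSum.map_apply (α := fun X : D => F.obj.obj X) (β := fun X : D => G.obj.obj X)
    (fun X => (α.hom.app X).hom) X m

@[simp]
theorem totalMap_incl (α : F ⟶ G) (X : D) (x : F.obj.obj X) :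
    totalMap α (incl F X x) = incl G X (α.hom.app X x) := by
  classical
  exact DirectSum.map_of (α := fun X : D => F.obj.obj X) (β := fun X : D => G.obj.obj X)
    (fun X => (α.hom.app X).hom) X x

/-- Commutation with the identity arrow of `X` keeps the image of the summand at `X` inside the
summand at `X`. -/
theorem linear_incl (g : FreeMod (arrowAct F) →ₗ[FreeAlgebra ℤ (Arrows D)] FreeMod (arrowAct G))
    (X : D) (x : F.obj.obj X) : g (incl F X x) = incl G X (coord G X (g (incl F X x))) := by
  rw [← id_smul, ← map_smul, id_smul, coord_incl]

theorem coord_linear (g : FreeMod (arrowAct F) →ₗ[FreeAlgebra ℤ (Arrows D)] FreeMod (arrowAct G))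
    (X : D) (m : FreeMod (arrowAct F)) :
    coord G X (g m) = coord G X (g (incl F X (coord F X m))) := by
  rw [← id_smul, map_smul, id_smul, coord_incl]

end Coord

variable (D) in
/-- The functor which sends an additive functor to the direct sum of its values. -/
def total : (D ⥤+ AddCommGrpCat.{u}) ⥤ ModuleCat.{u} (FreeAlgebra ℤ (Arrows D)) where
  obj F := ModuleCat.of _ (FreeMod (arrowAct F))
  map α := ModuleCat.ofHom (totalMap α)
  map_id F := by
    ext m
    exact coord_ext fun X => coord_totalMap (𝟙 F) m X
  map_comp {F G H} α β := by
    ext m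
    refine coord_ext fun X => ?_
    refine (coord_totalMap (α ≫ β) m X).trans ?_
    refine Eq.trans ?_ (coord_totalMap β _ X).symm
    exact congrArg (β.hom.app X) (coord_totalMap α m X).symm

instance : (total D).PreservesZeroMorphisms where
  map_zero F G := by
    ext m
    exact coord_ext fun X => coord_totalMap (0 : F ⟶ G) m X

instance : (total D).Faithful where
  map_injective {F G} α β h := by
    have h' : totalMap α = totalMap β := congrArg ModuleCat.Hom.hom h
    ext X x
    have h1 := congrArg (coord G X) (LinearMap.congr_fun h' (incl F X x))
    simpa using h1

/-- Identity arrows force a linear map to be diagonal; commutation with the remaining arrows is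
naturality of the diagonal entries. -/
instance : (total D).Full where
  map_surjective {F G} g := by
    let g' : FreeMod (arrowAct F) →ₗ[FreeAlgebra ℤ (Arrows D)] FreeMod (arrowAct G) := g.hom
    let α : F.obj ⟶ G.obj :=
      { app := fun X => AddCommGrpCat.ofHom
          ((coord G X).comp (g'.toAddMonoidHom.comp (incl F X)))
        naturality := fun X Y f => by
          ext x
          change coord G Y (g' (incl F Y (F.obj.map f x))) =
            G.obj.map f (coord G X (g' (incl F X x)))
          have h1 := arrow_smul f (incl F X x)
          rw [coord_incl] at h1
          rw [← h1, map_smul, arrow_smul, coord_incl] }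
    refine ⟨ObjectProperty.homMk α, ?_⟩
    ext m
    refine coord_ext fun X => (coord_totalMap (F := F) (G := G) _ m X).trans ?_
    exact (coord_linear g' X m).symm

/-- The values of the subfunctor that corresponds to a submodule. -/
def sectionGroup {F : D ⥤+ AddCommGrpCat.{u}}
    (N : Submodule (FreeAlgebra ℤ (Arrows D)) (FreeMod (arrowAct F))) (X : D) :
    AddSubgroup (F.obj.obj X) :=
  N.toAddSubgroup.comap (incl F X)

theorem mem_sectionGroup {F : D ⥤+ AddCommGrpCat.{u}}
    {N : Submodule (FreeAlgebra ℤ (Arrows D)) (FreeMod (arrowAct F))} {X : D} {x : F.obj.obj X} :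
    x ∈ sectionGroup N X ↔ incl F X x ∈ N := Iff.rfl

theorem map_mem_sectionGroup {F : D ⥤+ AddCommGrpCat.{u}}
    (N : Submodule (FreeAlgebra ℤ (Arrows D)) (FreeMod (arrowAct F))) {X Y : D} (f : X ⟶ Y)
    {x : F.obj.obj X} (hx : x ∈ sectionGroup N X) : F.obj.map f x ∈ sectionGroup N Y := by
  rw [mem_sectionGroup] at hx ⊢
  have h1 := arrow_smul f (incl F X x)
  rw [coord_incl] at h1
  rw [← h1]
  exact N.smul_mem _ hx

/-- Stability under the arrows says that the traces of a submodule on the values of `F` form a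
subfunctor, and homogeneity recovers the submodule from these traces. -/
theorem total_liftsSubmodules : LiftsSubmodules (total D) := by
  intro F N
  let N' : Submodule (FreeAlgebra ℤ (Arrows D)) (FreeMod (arrowAct F)) := N
  let G : D ⥤ AddCommGrpCat.{u} :=
    { obj := fun X => AddCommGrpCat.of (sectionGroup N' X)
      map := fun {X Y} f => AddCommGrpCat.ofHom
        (((F.obj.map f).hom.comp (sectionGroup N' X).subtype).codRestrict _
          fun x => map_mem_sectionGroup N' f x.2)
      map_id := fun X => by
        ext x
        exact ConcreteCategory.congr_hom (F.obj.map_id X) x.1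
      map_comp := fun f g => by
        ext x
        exact ConcreteCategory.congr_hom (F.obj.map_comp f g) x.1 }
  have : G.Additive := ⟨fun {X Y f g} => by
    ext x
    exact ConcreteCategory.congr_hom (F.obj.map_add (f := f) (g := g)) x.1⟩
  let i : AdditiveFunctor.of G ⟶ F := ObjectProperty.homMk
    { app := fun X => AddCommGrpCat.ofHom (sectionGroup N' X).subtype
      naturality := fun _ _ _ => rfl }
  refine ⟨AdditiveFunctor.of G, i, ?_, ?_⟩
  · intro x y hxy
    refine coord_ext fun X => ?_
    have h1 := coord_totalMap i x X
    have h2 := coord_totalMap i y X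
    exact Subtype.ext (h1.symm.trans ((congrArg (coord F X) hxy).trans h2))
  · apply le_antisymm
    · rintro _ ⟨m, rfl⟩
      refine (total_mem_iff N' _).2 fun X => ?_
      exact (congrArg (fun x => incl F X x ∈ N') (coord_totalMap i m X)).mpr
        (coord (AdditiveFunctor.of G) X m).2
    · intro m hm
      refine (total_mem_iff (LinearMap.range (totalMap i)) m).2 fun X => ?_
      have h3 := (total_mem_iff N' m).1 hm X
      exact ⟨incl (AdditiveFunctor.of G) X ⟨_, h3⟩, totalMap_incl i X ⟨_, h3⟩⟩

/-- The morphism is the projection to the quotient of `F` by the subfunctor of traces; its kernel is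
computed coordinate by coordinate. -/
theorem total_liftsQuotients : LiftsQuotients (total D) := by
  intro F N
  let N' : Submodule (FreeAlgebra ℤ (Arrows D)) (FreeMod (arrowAct F)) := N
  let G : D ⥤ AddCommGrpCat.{u} :=
    { obj := fun X => AddCommGrpCat.of (F.obj.obj X ⧸ sectionGroup N' X)
      map := fun {X Y} f => AddCommGrpCat.ofHom (QuotientAddGroup.map _ _ (F.obj.map f).hom
          fun x hx => map_mem_sectionGroup N' f hx)
      map_id := fun X => by
        ext x
        exact congrArg _ (ConcreteCategory.congr_hom (F.obj.map_id X) x)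
      map_comp := fun f g => by
        ext x
        exact congrArg _ (ConcreteCategory.congr_hom (F.obj.map_comp f g) x) }
  have : G.Additive := ⟨fun {X Y f g} => by
    ext x
    exact congrArg QuotientAddGroup.mk
      (ConcreteCategory.congr_hom (F.obj.map_add (f := f) (g := g)) x)⟩
  let q : F ⟶ AdditiveFunctor.of G := ObjectProperty.homMk
    { app := fun X => AddCommGrpCat.ofHom (QuotientAddGroup.mk' (sectionGroup N' X))
      naturality := fun _ _ _ => rfl }
  refine ⟨AdditiveFunctor.of G, q, ?_⟩
  ext m
  refine Iff.trans ?_ (total_mem_iff N' m).symm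
  constructor
  · intro hm X
    have h1 := coord_totalMap q m X
    have h2 : q.hom.app X (coord F X m) = 0 :=
      h1.symm.trans ((congrArg (coord (AdditiveFunctor.of G) X) hm).trans (map_zero _))
    exact (QuotientAddGroup.eq_zero_iff _).1 h2
  · intro h
    refine coord_ext fun X => ?_
    refine (coord_totalMap q m X).trans ?_
    exact ((QuotientAddGroup.eq_zero_iff _).2 (h X)).trans (map_zero _).symm

theorem isSemisimpleObject_iff_total (F : D ⥤+ AddCommGrpCat.{u}) :
    IsSemisimpleObject.{u} F ↔
      IsSemisimpleModule (FreeAlgebra ℤ (Arrows D)) (FreeMod (arrowAct F)) :=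
  isSemisimpleObject_iff total_liftsSubmodules total_liftsQuotients F

/-- The morphism from a representable functor given by an element. -/
def yonedaHom (F : D ⥤+ AddCommGrpCat.{u}) {A : D} (x : F.obj.obj A) : homFrom D A ⟶ F :=
  ObjectProperty.homMk
    { app := fun X => AddCommGrpCat.ofHom (AddMonoidHom.mk' (fun f : A ⟶ X => F.obj.map f x)
        fun f g => ConcreteCategory.congr_hom (F.obj.map_add (f := f) (g := g)) x)
      naturality := fun X Y f => by
        ext g
        exact ConcreteCategory.congr_hom (F.obj.map_comp g f) x }

/-- By the Yoneda lemma every element of `F(A)` is the image of the identity under a morphism from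
`C(A, -)`, so `F` is a sum of images of semisimple modules. -/
theorem isSemisimpleObject_of_homFrom (h : ∀ A : D, IsSemisimpleObject.{u} (homFrom D A))
    (F : D ⥤+ AddCommGrpCat.{u}) : IsSemisimpleObject.{u} F := by
  simp only [isSemisimpleObject_iff_total] at h ⊢
  refine isSemisimpleModule_of_isSemisimpleModule_submodule' (ι := Σ A : D, F.obj.obj A)
    (p := fun i => LinearMap.range (totalMap (yonedaHom F i.2)))
    (fun i => @IsSemisimpleModule.range _ _ _ _ _ _ _ _ (h i.1) _) ?_
  rw [eq_top_iff]
  rintro m -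
  refine (total_mem_iff _ m).2 fun X => ?_
  refine Submodule.mem_iSup_of_mem (⟨X, coord F X m⟩ : Σ A : D, F.obj.obj A)
    ⟨incl (homFrom D X) X (𝟙 X), ?_⟩
  refine (totalMap_incl _ X _).trans (congrArg (incl F X) ?_)
  exact ConcreteCategory.congr_hom (F.obj.map_id X) (coord F X m)

theorem IsSemisimpleObject.of_iso {𝒜 : Type*} [Category* 𝒜] [HasZeroMorphisms 𝒜] {X Y : 𝒜}
    (e : X ≅ Y) (h : IsSemisimpleObject.{u} X) : IsSemisimpleObject.{u} Y := by
  obtain ⟨ι, S, π, hS, ⟨hc⟩⟩ := h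
  exact ⟨ι, S, fun i => π i ≫ e.hom, hS,
    ⟨IsColimit.ofIsoColimit hc (Cofan.ext e fun _ => rfl)⟩⟩

/-- `C(-, A)` is the functor represented by `A` on the opposite category. -/
def homIntoIso (A : D) : homInto D A ≅ homFrom Dᵒᵖ (op A) :=
  ObjectProperty.isoMk _ <| NatIso.ofComponents
    (fun X => AddEquiv.toAddCommGrpIso (Y := AddCommGrpCat.of (op A ⟶ X))
      { toFun := fun f : X.unop ⟶ A => f.op
        invFun := fun f => f.unop
        left_inv := fun _ => rfl
        right_inv := fun _ => rfl
        map_add' := fun _ _ => rfl })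
    (fun _ => rfl)

theorem isSemisimpleCategory_iff :
    IsSemisimpleCategory D ↔ ∀ A : Dᵒᵖ, IsSemisimpleObject.{u} (homFrom Dᵒᵖ A) :=
  ⟨fun h A => (h A.unop).of_iso (homIntoIso A.unop),
    fun h A => (h (op A)).of_iso (homIntoIso A).symm⟩

end Total

/-! ### Decomposition of finite semisimple modules -/

section Decomposition

/-- A simultaneous decomposition of finite semisimple modules into simple modules from a list of
pairwise non-isomorphic simple modules. -/
structure SimpleDecomposition (Λ : Type u) [Ring Λ] {I : Type u} (P : I → Type u)
    [∀ i, AddCommGroup (P i)] [∀ i, Module Λ (P i)] where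
  J : Type u
  S : J → Type u
  [grp : ∀ j, AddCommGroup (S j)]
  [mod : ∀ j, Module Λ (S j)]
  [simple : ∀ j, IsSimpleModule Λ (S j)]
  hom_eq_zero : ∀ j j', j ≠ j' → ∀ f : S j →ₗ[Λ] S j', f = 0
  n : J → I → ℕ
  finite : ∀ i, {j | n j i ≠ 0}.Finite
  inc : ∀ i j, Fin (n j i) → (S j →ₗ[Λ] P i)
  proj : ∀ i j, Fin (n j i) → (P i →ₗ[Λ] S j)
  proj_inc : ∀ i j k k', proj i j k ∘ₗ inc i j k' = if k = k' then LinearMap.id else 0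
  sum_inc_proj : ∀ i (x : P i),
    ∑ j ∈ (finite i).toFinset, ∑ k, inc i j k (proj i j k x) = x

attribute [instance] SimpleDecomposition.grp SimpleDecomposition.mod SimpleDecomposition.simple

/-- All the `P i` are decomposed against one common list of simple modules, a representative for
each isomorphism class of simple submodules of the `P i`. Schur's lemma gives the vanishing of
homomorphisms between different representatives, and `n j i` counts the summands of `P i` in class
`j`. -/
theorem exists_simpleDecomposition (Λ : Type u) [Ring Λ] {I : Type u} (P : I → Type u)
    [∀ i, AddCommGroup (P i)] [∀ i, Module Λ (P i)] [∀ i, IsSemisimpleModule Λ (P i)]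
    [∀ i, Module.Finite Λ (P i)] : Nonempty (SimpleDecomposition Λ P) := by
  classical
  let T : Type u := Σ i, {N : Submodule Λ (P i) // IsSimpleModule Λ N}
  let st : Setoid T :=
    { r := fun s t => Nonempty (s.2.1 ≃ₗ[Λ] t.2.1)
      iseqv := ⟨fun _ => ⟨LinearEquiv.refl _ _⟩, fun ⟨e⟩ => ⟨e.symm⟩,
        fun ⟨e⟩ ⟨e'⟩ => ⟨e.trans e'⟩⟩ }
  let J : Type u := Quotient st
  let S : J → Type u := fun j => j.out.2.1
  let _ : ∀ j, AddCommGroup (S j) := fun j => inferInstanceAs (AddCommGroup j.out.2.1)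
  let _ : ∀ j, Module Λ (S j) := fun j => inferInstanceAs (Module Λ j.out.2.1)
  have hsimple : ∀ j, IsSimpleModule Λ (S j) := fun j => j.out.2.2
  choose m N e hN using fun i => IsSemisimpleModule.exists_linearEquiv_fin_dfinsupp Λ (P i)
  let c : ∀ i, Fin (m i) → J := fun i a => Quotient.mk st ⟨i, N i a, hN i a⟩
  have r : ∀ i a, Nonempty (N i a ≃ₗ[Λ] S (c i a)) := fun i a =>
    Setoid.symm (Quotient.mk_out (s := st) ⟨i, N i a, hN i a⟩)
  replace r : ∀ i a, N i a ≃ₗ[Λ] S (c i a) := fun i a => (r i a).some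
  -- The class of the summand `a` equals `j` only propositionally; the cast transports along this
  -- equality.
  let inc' : ∀ i j (a : {a // c i a = j}), S j →ₗ[Λ] P i := fun i j a =>
    (e i).symm.toLinearMap ∘ₗ DFinsupp.lsingle a.1 ∘ₗ
      (r i a.1).symm.toLinearMap ∘ₗ (LinearEquiv.cast (R := Λ) (M := S) a.2.symm).toLinearMap
  let proj' : ∀ i j (a : {a // c i a = j}), P i →ₗ[Λ] S j := fun i j a =>
    (LinearEquiv.cast (R := Λ) (M := S) a.2).toLinearMap ∘ₗ (r i a.1).toLinearMap ∘ₗ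
      DFinsupp.lapply a.1 ∘ₗ (e i).toLinearMap
  let n : J → I → ℕ := fun j i => Fintype.card {a // c i a = j}
  let k : ∀ i j, Fin (n j i) ≃ {a // c i a = j} := fun i j => (Fintype.equivFin _).symm
  have hfin : ∀ i, {j | n j i ≠ 0}.Finite := fun i =>
    (Set.finite_range (c i)).subset fun j hj => by
      obtain ⟨a, ha⟩ := Fintype.card_pos_iff.1 (Nat.pos_of_ne_zero hj)
      exact ⟨a, ha⟩
  refine ⟨{ J := J, S := S, hom_eq_zero := ?_, n := n, finite := hfin,
            inc := fun i j b => inc' i j (k i j b), proj := fun i j b => proj' i j (k i j b),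
            proj_inc := ?_, sum_inc_proj := ?_ }⟩
  · intro j j' hjj f
    by_contra hf
    exact hjj (Quotient.out_equiv_out.1
      ⟨LinearEquiv.ofBijective f (LinearMap.bijective_of_ne_zero hf)⟩)
  · intro i j b b'
    have h0 : ∀ a a', proj' i j a ∘ₗ inc' i j a' = if a = a' then LinearMap.id else 0 := by
      rintro ⟨a, rfl⟩ a'
      ext x
      split_ifs with h
      · subst h
        simp [proj', inc']
      · have h1 : a'.1 ≠ a := fun h1 => h (Subtype.ext h1.symm)
        simp [proj', inc', DFinsupp.single_apply, h1]
    simp only [h0, (k i j).apply_eq_iff_eq]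
  · intro i x
    have h1 : ∀ j, ∑ b, inc' i j (k i j b) (proj' i j (k i j b) x) =
        ∑ a : {a // c i a = j}, (e i).symm (DFinsupp.single a.1 (e i x a.1)) := fun j => by
      rw [(k i j).sum_comp fun a => inc' i j a (proj' i j a x)]
      refine Finset.sum_congr rfl ?_
      rintro ⟨a, rfl⟩ -
      simp [proj', inc']
    simp only [h1]
    have h2 : ∀ j, ∑ a : {a // c i a = j}, (e i).symm (DFinsupp.single a.1 (e i x a.1)) =
        ∑ a with c i a = j, (e i).symm (DFinsupp.single a (e i x a)) := fun j =>
      (Finset.sum_subtype (p := fun a => c i a = j) _ (fun a => by simp)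
        (fun a => (e i).symm (DFinsupp.single a (e i x a)))).symm
    simp only [h2]
    -- The fibres of `c i` partition the summands, and every class that occurs lies in the finite
    -- index set, so the double sum runs once through all summands.
    rw [Finset.sum_fiberwise_of_maps_to, ← map_sum]
    · rw [LinearEquiv.symm_apply_eq]
      refine DFinsupp.ext fun a => ?_
      rw [DFinsupp.finsetSum_apply]
      simp [DFinsupp.single_apply]
    · intro a _
      simp only [Set.Finite.mem_toFinset, Set.mem_ofPred_eq]
      have : Nonempty {a' // c i a' = c i a} := ⟨a, rfl⟩
      exact Fintype.card_ne_zero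

/-! ### Matrices of homomorphisms between decomposed modules -/

namespace SimpleDecomposition

variable {Λ : Type u} [Ring Λ] {I : Type u} {P : I → Type u}
  [∀ i, AddCommGroup (P i)] [∀ i, Module Λ (P i)] (d : SimpleDecomposition Λ P)

open scoped Classical in
/-- The opposites of the endomorphism rings of the simple modules. -/
abbrev ring (j : d.J) : Type u := (Module.End Λ (d.S j))ᵐᵒᵖ

open scoped Classical in
instance (j : d.J) : DivisionRing (d.ring j) :=
  inferInstanceAs (DivisionRing (Module.End Λ (d.S j))ᵐᵒᵖ)

/-- The matrices of a homomorphism. -/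
def toMatrix (i i' : I) : (P i →ₗ[Λ] P i') →+
    ∀ j, Matrix (Fin (d.n j i)) (Fin (d.n j i')) (d.ring j) where
  toFun f j := Matrix.of fun k k' => MulOpposite.op (d.proj i' j k' ∘ₗ f ∘ₗ d.inc i j k)
  map_zero' := by
    ext j k k'
    simp
  map_add' f g := by
    funext j
    ext k k'
    simp [LinearMap.comp_add, LinearMap.add_comp]

theorem toMatrix_apply {i i' : I} (f : P i →ₗ[Λ] P i') (j : d.J) (k : Fin (d.n j i))
    (k' : Fin (d.n j i')) (x : d.S j) :
    (d.toMatrix i i' f j k k').unop x = d.proj i' j k' (f (d.inc i j k x)) := rfl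

/-- The identity of `P i'` is inserted between the two maps as the sum of the `inc ∘ proj`; terms
through a different simple module vanish. The entries lie in opposite endomorphism rings, so the
matrix of the map applied first is the left factor. -/
theorem toMatrix_comp {i i' i'' : I} (f : P i →ₗ[Λ] P i') (g : P i' →ₗ[Λ] P i'') (j : d.J) :
    d.toMatrix i i'' (g ∘ₗ f) j = d.toMatrix i i' f j * d.toMatrix i' i'' g j := by
  ext k k'
  apply MulOpposite.unop_injective
  ext x
  rw [toMatrix_apply, Matrix.mul_apply, Finset.unop_sum]
  simp only [MulOpposite.unop_mul, LinearMap.sum_apply, Module.End.mul_apply, toMatrix_apply]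
  conv_lhs => rw [LinearMap.comp_apply, ← d.sum_inc_proj i' (f (d.inc i j k x))]
  simp only [map_sum]
  rw [Finset.sum_eq_single j]
  · intro j' _ hj'
    refine Finset.sum_eq_zero fun l _ => ?_
    exact LinearMap.congr_fun (d.hom_eq_zero j' j hj'
      (d.proj i'' j k' ∘ₗ g ∘ₗ d.inc i' j' l)) _
  · intro hj
    have : d.n j i' = 0 := by simpa using hj
    have : IsEmpty (Fin (d.n j i')) := by rw [this]; infer_instance
    simp

/-- Components between different simple modules are zero, so the diagonal blocks determine a
homomorphism. Conversely arbitrary blocks can be reassembled, because only finitely many `j` have `n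
j i ≠ 0`. -/
theorem toMatrix_bijective (i i' : I) : Function.Bijective (d.toMatrix i i') := by
  constructor
  · rw [injective_iff_map_eq_zero]
    intro f hf
    ext x
    rw [← d.sum_inc_proj i x, ← d.sum_inc_proj i' (f _)]
    simp only [map_sum, LinearMap.zero_apply, Finset.sum_const_zero]
    refine Finset.sum_eq_zero fun j' _ => Finset.sum_eq_zero fun l' _ =>
      Finset.sum_eq_zero fun j _ => Finset.sum_eq_zero fun l _ => ?_
    have : d.proj i' j' l' (f (d.inc i j l (d.proj i j l x))) = 0 := by
      by_cases h : j = j'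
      · subst h
        rw [← toMatrix_apply, hf]
        rfl
      · exact LinearMap.congr_fun (d.hom_eq_zero j j' h
          (d.proj i' j' l' ∘ₗ f ∘ₗ d.inc i j l)) _
    rw [this, map_zero]
  · intro M
    refine ⟨∑ j ∈ (d.finite i).toFinset, ∑ k, ∑ k',
      d.inc i' j k' ∘ₗ (M j k k').unop ∘ₗ d.proj i j k, ?_⟩
    funext j
    ext k k'
    apply MulOpposite.unop_injective
    ext x
    rw [toMatrix_apply]
    simp only [LinearMap.sum_apply, LinearMap.comp_apply, map_sum]
    rw [Finset.sum_eq_single j, Finset.sum_eq_single k, Finset.sum_eq_single k']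
    · have h1 := LinearMap.congr_fun (d.proj_inc i j k k) x
      have h2 := fun y => LinearMap.congr_fun (d.proj_inc i' j k' k') y
      simp only [if_true, LinearMap.comp_apply, LinearMap.id_apply] at h1 h2
      rw [h1, h2]
    · intro l _ hl
      have h2 := fun y => LinearMap.congr_fun (d.proj_inc i' j k' l) y
      simp only [if_neg hl.symm, LinearMap.comp_apply, LinearMap.zero_apply] at h2
      rw [h2]
    · simp
    · intro l _ hl
      have h1 := LinearMap.congr_fun (d.proj_inc i j l k) x
      simp only [if_neg hl, LinearMap.comp_apply, LinearMap.zero_apply] at h1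
      simp [h1]
    · simp
    · intro j' _ hj
      refine Finset.sum_eq_zero fun l _ => Finset.sum_eq_zero fun l' _ => ?_
      exact LinearMap.congr_fun (d.hom_eq_zero j' j hj (d.proj i' j k' ∘ₗ d.inc i' j' l' ∘ₗ
        (M j' l l').unop)) _
    · intro hj
      have h0 : d.n j i = 0 := by simpa using hj
      exact (Fin.cast h0 k).elim0

end SimpleDecomposition

end Decomposition

/-! ### Semisimple categories and matrices -/

section Matrices

/-- The morphism groups of `C` are products of groups of matrices over division rings, the
composition being the multiplication of matrices. -/
def IsMatrixCategory (C : Type u) [SmallCategory C] [Preadditive C] : Prop :=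
  ∃ (J : Type u) (D : J → Type u) (_ : ∀ j, DivisionRing (D j)) (n : J → C → ℕ),
    (∀ A : C, {j | n j A ≠ 0}.Finite) ∧
    ∃ φ : ∀ A B : C, (A ⟶ B) ≃+ (∀ j, Matrix (Fin (n j B)) (Fin (n j A)) (D j)),
      ∀ (A X B : C) (f : X ⟶ B) (g : A ⟶ X) (j : J),
        φ A B (g ≫ f) j = φ X B f j * φ A X g j

variable {C : Type u} [SmallCategory C] [Preadditive C]

/-- `unop` as an additive equivalence. -/
def unopAddEquiv (A B : Cᵒᵖ) : (A ⟶ B) ≃+ (B.unop ⟶ A.unop) where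
  toFun f := f.unop
  invFun f := f.op
  left_inv _ := rfl
  right_inv _ := rfl
  map_add' _ _ := rfl

/-- Transposition reverses products once the entries are regarded in the opposite division rings.
The symmetry between covariant and contravariant conditions rests on this. -/
theorem IsMatrixCategory.op (h : IsMatrixCategory C) : IsMatrixCategory Cᵒᵖ := by
  obtain ⟨J, D, _, n, hn, φ, hφ⟩ := h
  refine ⟨J, fun j => (D j)ᵐᵒᵖ, fun j => inferInstance, fun j A => n j A.unop,
    fun A => hn A.unop, fun A B => ((unopAddEquiv A B).trans (φ B.unop A.unop)).trans
      { toFun := fun M j => (M j).transpose.map MulOpposite.op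
        invFun := fun M j => (M j).transpose.map MulOpposite.unop
        left_inv := fun _ => rfl
        right_inv := fun _ => rfl
        map_add' := fun _ _ => rfl }, fun A X B f g j => ?_⟩
  ext k k'
  apply MulOpposite.unop_injective
  change φ B.unop A.unop (f.unop ≫ g.unop) j k' k = _
  rw [hφ, Matrix.mul_apply, Matrix.mul_apply, Finset.unop_sum]
  rfl

/-- The module of the functor represented by `A`. -/
abbrev RepMod (A : C) : Type u := FreeMod (arrowAct (homFrom C A))

/-- The identity of `A` as an element of the module of the functor represented by `A`. -/
def repGen (A : C) : RepMod A := incl (homFrom C A) A (𝟙 A)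

/-- A morphism as an element of the module of a representable functor. -/
def repIncl (A X : C) : (A ⟶ X) →+ RepMod A := incl (homFrom C A) X

/-- The coordinates in the module of a representable functor. -/
def repCoord (A X : C) : RepMod A →+ (A ⟶ X) := coord (homFrom C A) X

@[simp]
theorem repCoord_repIncl (A X : C) (f : A ⟶ X) : repCoord A X (repIncl A X f) = f :=
  coord_incl (F := homFrom C A) X f

theorem repGen_eq (A : C) : repGen A = repIncl A A (𝟙 A) := rfl

theorem arrow_smul_repIncl {A X Y : C} (f : X ⟶ Y) (g : A ⟶ X) :
    (FreeAlgebra.ι ℤ (⟨X, Y, f⟩ : Arrows C)) • repIncl A X g = repIncl A Y (g ≫ f) := by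
  refine (arrow_smul (F := homFrom C A) f _).trans ?_
  refine congrArg (repIncl A Y) ?_
  exact congrArg (fun g => g ≫ f) (repCoord_repIncl A X g)

theorem arrow_smul_repGen {A Y : C} (f : A ⟶ Y) :
    (FreeAlgebra.ι ℤ (⟨A, Y, f⟩ : Arrows C)) • repGen A = repIncl A Y f := by
  rw [repGen_eq, arrow_smul_repIncl, Category.id_comp]

/-- An arrow out of `A`, applied to the identity of `A`, gives that arrow back; so the identity
generates `C(A, -)`. This makes the module finite and its homomorphisms determined by one value. -/
theorem repMod_eq_top {A : C} {N : Submodule (FreeAlgebra ℤ (Arrows C)) (RepMod A)}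
    (h : repGen A ∈ N) : N = ⊤ := by
  rw [eq_top_iff]
  rintro m -
  refine (total_mem_iff N m).2 fun X => ?_
  have := N.smul_mem (FreeAlgebra.ι ℤ (⟨A, X, repCoord A X m⟩ : Arrows C)) h
  rwa [arrow_smul_repGen] at this

instance (A : C) : Module.Finite (FreeAlgebra ℤ (Arrows C)) (RepMod A) :=
  ⟨⟨{repGen A}, repMod_eq_top (Submodule.subset_span (by simp))⟩⟩

/-- Precomposition with a morphism. -/
def pre {A B : C} (f : A ⟶ B) : RepMod B →ₗ[FreeAlgebra ℤ (Arrows C)] RepMod A :=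
  totalMap (yonedaHom (homFrom C A) f)

theorem pre_repIncl {A B X : C} (f : A ⟶ B) (g : B ⟶ X) :
    pre f (repIncl B X g) = repIncl A X (f ≫ g) :=
  totalMap_incl (yonedaHom (homFrom C A) f) X g

theorem pre_repGen {A B : C} (f : A ⟶ B) : pre f (repGen B) = repIncl A B f := by
  rw [repGen_eq, pre_repIncl, Category.comp_id]

theorem repMod_hom_ext {A : C} {M : Type*} [AddCommGroup M]
    [Module (FreeAlgebra ℤ (Arrows C)) M] {g h : RepMod A →ₗ[FreeAlgebra ℤ (Arrows C)] M}
    (e : g (repGen A) = h (repGen A)) : g = h := by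
  have := repMod_eq_top (N := LinearMap.eqLocus g h) e
  ext x
  exact (this ▸ Submodule.mem_top : x ∈ LinearMap.eqLocus g h)

/-- The Yoneda lemma. -/
def repEquiv (A B : C) : (A ⟶ B) ≃+ (RepMod B →ₗ[FreeAlgebra ℤ (Arrows C)] RepMod A) where
  toFun := pre
  invFun h := repCoord A B (h (repGen B))
  left_inv f := by
    beta_reduce
    rw [pre_repGen, repCoord_repIncl]
  right_inv h := by
    apply repMod_hom_ext
    rw [pre_repGen]
    exact (linear_incl h B (𝟙 B)).symm
  map_add' f g := by
    apply repMod_hom_ext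
    rw [LinearMap.add_apply, pre_repGen, pre_repGen, pre_repGen, map_add]

theorem pre_comp {A B X : C} (f : A ⟶ B) (g : B ⟶ X) : pre (f ≫ g) = pre f ∘ₗ pre g := by
  apply repMod_hom_ext
  rw [LinearMap.comp_apply, pre_repGen, pre_repGen, pre_repIncl]

/-- The Yoneda embedding `A ↦ C(A, -)` reverses composition, and so does `toMatrix` because of the
opposite endomorphism rings; the two reversals cancel and composition becomes the matrix product in
its usual order. -/
theorem isMatrixCategory_of_homFrom (h : ∀ A : C, IsSemisimpleObject.{u} (homFrom C A)) :
    IsMatrixCategory C := by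
  have h' : ∀ A : C, IsSemisimpleModule (FreeAlgebra ℤ (Arrows C)) (RepMod A) := fun A =>
    (isSemisimpleObject_iff_total _).1 (h A)
  obtain ⟨d⟩ := exists_simpleDecomposition (FreeAlgebra ℤ (Arrows C)) (fun A : C => RepMod A)
  refine ⟨d.J, d.ring, fun j => inferInstance, d.n, d.finite, fun A B =>
    (repEquiv A B).trans (AddEquiv.ofBijective (d.toMatrix B A) (d.toMatrix_bijective B A)),
    fun A X B f g j => ?_⟩
  change d.toMatrix B A (pre (g ≫ f)) j = d.toMatrix B X (pre f) j * d.toMatrix X A (pre g) j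
  rw [pre_comp, d.toMatrix_comp]

/-- The identity of `A` is the finite sum of the diagonal matrix units `E j k`, so `C(A, -)` is the
sum of the ranges of precomposition with them. Such a range is simple: the matrix of `E j k ≫ g`
lives in column `k` of block `j`, and one nonzero entry there suffices to recover `E j k` by a
further composition. -/
theorem homFrom_of_isMatrixCategory (h : IsMatrixCategory C) (A : C) :
    IsSemisimpleObject.{u} (homFrom C A) := by
  classical
  obtain ⟨J, D, _, n, hn, φ, hφ⟩ := h
  rw [isSemisimpleObject_iff_total]
  -- Preservation of identities is not among the hypotheses; it follows from multiplicativity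
  -- applied to a preimage of `1`.
  have hid : ∀ j, φ A A (𝟙 A) j = 1 := fun j => by
    have h1 := hφ A A A ((φ A A).symm 1) (𝟙 A) j
    rw [Category.id_comp, AddEquiv.apply_symm_apply, Pi.one_apply, one_mul] at h1
    exact h1.symm
  let E : ∀ j, Fin (n j A) → (A ⟶ A) := fun j k =>
    (φ A A).symm (Pi.single j (Matrix.single k k 1))
  have hE : ∀ j k, φ A A (E j k) = Pi.single j (Matrix.single k k 1) := fun j k =>
    (φ A A).apply_symm_apply _
  refine isSemisimpleModule_of_isSemisimpleModule_submodule' (ι := Σ j, Fin (n j A))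
    (p := fun i => LinearMap.range (pre (E i.1 i.2))) ?_ ?_
  · rintro ⟨j, k⟩
    suffices IsSimpleModule (FreeAlgebra ℤ (Arrows C)) (LinearMap.range (pre (E j k))) by
      dsimp only
      infer_instance
    have hE0 : repIncl A A (E j k) ≠ 0 := fun h0 => by
      have h1 : E j k = 0 := by rw [← repCoord_repIncl A A (E j k), h0, map_zero]
      have h2 := congrFun (congrFun (congrFun ((hE j k).symm.trans
        ((congrArg (φ A A) h1).trans (map_zero _))) j) k) k
      simp at h2
    have hmem : repIncl A A (E j k) ∈ LinearMap.range (pre (E j k)) :=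
      ⟨repGen A, pre_repGen _⟩
    rw [isSimpleModule_iff_isAtom]
    refine ⟨fun h0 => hE0 (by rw [h0] at hmem; exact hmem), fun N hN => ?_⟩
    by_contra hN0
    apply hN.not_ge
    obtain ⟨y, hy, hy0⟩ := N.ne_bot_iff.1 hN0
    -- `E j k` is the image of the generator of `C(A, -)`, so a submodule containing it contains the
    -- whole range.
    suffices hgen : repIncl A A (E j k) ∈ N by
      have := repMod_eq_top (N := N.comap (pre (E j k)))
        (by rw [Submodule.mem_comap, pre_repGen]; exact hgen)
      rw [LinearMap.range_eq_map, ← this]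
      exact Submodule.map_comap_le _ _
    obtain ⟨X, hX⟩ : ∃ X, repCoord A X y ≠ 0 := by
      by_contra! hX
      exact hy0 (coord_ext (F := homFrom C A) fun X => (hX X).trans (map_zero _).symm)
    have hX' : repIncl A X (repCoord A X y) ∈ N := (total_mem_iff N y).1 hy X
    obtain ⟨m, hm⟩ := hN.le hX'
    have hg : ∃ g : A ⟶ X, repCoord A X y = E j k ≫ g := by
      refine ⟨repCoord A X m, ?_⟩
      rw [← repCoord_repIncl A X (repCoord A X y), ← hm]
      exact coord_totalMap (yonedaHom (homFrom C A) (E j k)) m X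
    obtain ⟨g, hg⟩ := hg
    rw [hg] at hX hX'
    have hφg : ∀ j', φ A X (E j k ≫ g) j' =
        φ A X g j' * (Pi.single j (Matrix.single k k 1) :
            ∀ i, Matrix (Fin (n i A)) (Fin (n i A)) (D i)) j' :=
      fun j' => by rw [hφ, hE]
    obtain ⟨l, hl⟩ : ∃ l, φ A X g j l k ≠ 0 := by
      by_contra! h0
      apply hX
      apply (φ A X).injective
      rw [map_zero]
      funext j'
      rw [hφg]
      by_cases hj : j' = j
      · subst hj
        ext a b
        by_cases hb : b = k
        · subst hb
          simp [h0]
        · simp [Matrix.mul_single_apply_of_ne, hb]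
      · rw [Pi.single_eq_of_ne hj, Matrix.mul_zero]
        rfl
    -- Multiplication on the left by the matrix unit at `(k, l)`, scaled by the inverse of the entry
    -- at `(l, k)`, turns column `k` into the unit at `(k, k)`.
    have hcomp : (E j k ≫ g) ≫ (φ X A).symm
        (Pi.single j (Matrix.single k l (φ A X g j l k)⁻¹)) = E j k := by
      apply (φ A A).injective
      funext j'
      rw [hφ, hφg, AddEquiv.apply_symm_apply, hE]
      by_cases hj : j' = j
      · subst hj
        simp only [Pi.single_eq_same]
        ext a b
        rw [← Matrix.mul_assoc]
        by_cases hb : b = k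
        · subst hb
          rw [Matrix.mul_single_apply_same]
          by_cases ha : a = b
          · subst ha
            simp [hl]
          · simp [ha, Ne.symm ha]
        · rw [Matrix.mul_single_apply_of_ne _ _ _ _ _ hb, Matrix.single_apply_of_ne]
          simp [Ne.symm hb]
      · rw [Pi.single_eq_of_ne hj, Pi.single_eq_of_ne hj, Matrix.zero_mul]
    have := N.smul_mem (FreeAlgebra.ι ℤ (⟨X, A, (φ X A).symm
        (Pi.single j (Matrix.single k l (φ A X g j l k)⁻¹))⟩ : Arrows C)) hX'
    rwa [arrow_smul_repIncl, hcomp] at this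
  · apply repMod_eq_top
    have hsum : 𝟙 A = ∑ j ∈ (hn A).toFinset, ∑ k, E j k := by
      apply (φ A A).injective
      simp only [map_sum, hE]
      funext j
      rw [hid, Finset.sum_apply]
      by_cases hj : n j A = 0
      -- Blocks of size zero do not occur in the finite sum, but all matrices of that size are
      -- equal.
      · have : IsEmpty (Fin (n j A)) := by rw [hj]; infer_instance
        exact Subsingleton.elim _ _
      · rw [Finset.sum_eq_single j]
        · rw [Finset.sum_apply]
          simp [Matrix.sum_single_one]
        · intro j' _ hj'
          rw [Finset.sum_apply]
          simp [Pi.single_eq_of_ne hj'.symm]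
        · intro h
          simp [hj] at h
    rw [repGen_eq, hsum, map_sum]
    refine Submodule.sum_mem _ fun j _ => ?_
    rw [map_sum]
    exact Submodule.sum_mem _ fun k _ => Submodule.mem_iSup_of_mem (⟨j, k⟩ : Σ j, Fin (n j A))
      ⟨repGen A, pre_repGen _⟩

theorem homFrom_iff_isMatrixCategory :
    (∀ A : C, IsSemisimpleObject.{u} (homFrom C A)) ↔ IsMatrixCategory C :=
  ⟨isMatrixCategory_of_homFrom, homFrom_of_isMatrixCategory⟩

variable (C) in
theorem isMatrixCategory_op_iff : IsMatrixCategory Cᵒᵖ ↔ IsMatrixCategory C := by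
  refine ⟨fun h => ?_, IsMatrixCategory.op⟩
  obtain ⟨J, D, _, n, hn, φ, hφ⟩ := h.op
  exact ⟨J, D, inferInstance, fun j A => n j (op (op A)), fun A => hn (op (op A)),
    fun A B => ((unopAddEquiv (op (op A)) (op (op B))).trans (unopAddEquiv (op B) (op A))).symm.trans
      (φ (op (op A)) (op (op B))), fun A X B f g j => hφ _ _ _ f.op.op g.op.op j⟩

theorem isSemisimpleCategory_iff_isMatrixCategory :
    IsSemisimpleCategory C ↔ IsMatrixCategory C := by
  rw [isSemisimpleCategory_iff, homFrom_iff_isMatrixCategory, isMatrixCategory_op_iff]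

theorem additiveFunctor_iff_isMatrixCategory :
    (∀ F : C ⥤+ AddCommGrpCat.{u}, IsSemisimpleObject.{u} F) ↔ IsMatrixCategory C := by
  rw [← homFrom_iff_isMatrixCategory]
  exact ⟨fun h A => h _, isSemisimpleObject_of_homFrom⟩

end Matrices

/-! ### The ring of a category -/

section Ring

namespace CatRing

variable {C : Type u} [SmallCategory C] [Preadditive C]

open scoped Classical in
theorem of_id_mul_of (A B E : C) (f : B ⟶ A) :
    of E E (𝟙 E) * of A B f = if E = A then of A B f else 0 := by
  split_ifs with h
  · subst h
    rw [of_mul_of_same, Category.comp_id]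
  · exact of_mul_of_ne _ _ _ _ _ _ (Ne.symm h)

open scoped Classical in
theorem of_mul_of_id (A B E : C) (f : B ⟶ A) :
    of A B f * of E E (𝟙 E) = if E = B then of A B f else 0 := by
  split_ifs with h
  · subst h
    rw [of_mul_of_same, Category.id_comp]
  · exact of_mul_of_ne _ _ _ _ _ _ h

/-- The identities serve as local units of `R[C]`, which may have no unit: they cut an element into
its finitely many homogeneous components. -/
theorem exists_eq_sum (x : CatRing C) : ∃ s : Finset (C × C),
    x = ∑ p ∈ s, of p.1 p.1 (𝟙 p.1) * x * of p.2 p.2 (𝟙 p.2) := by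
  classical
  -- Allowing every larger finite set lets the sets belonging to two summands be merged in the
  -- induction.
  suffices ∃ s : Finset (C × C), ∀ t, s ⊆ t →
      x = ∑ p ∈ t, of p.1 p.1 (𝟙 p.1) * x * of p.2 p.2 (𝟙 p.2) by
    obtain ⟨s, hs⟩ := this
    exact ⟨s, hs s subset_rfl⟩
  induction x using induction_on with
  | h0 => exact ⟨∅, fun t _ => by simp⟩
  | h1 A B f =>
    refine ⟨{(A, B)}, fun t ht => ?_⟩
    rw [Finset.sum_eq_single_of_mem (A, B) (ht (by simp))]
    · simp [of_id_mul_of, of_mul_of_id]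
    · rintro ⟨A', B'⟩ - hne
      rw [of_id_mul_of]
      split_ifs with h
      · rw [of_mul_of_id, if_neg]
        rintro rfl
        exact hne (Prod.ext h rfl)
      · rw [zero_mul]
  | h2 x y hx hy =>
    obtain ⟨s, hs⟩ := hx
    obtain ⟨t, ht⟩ := hy
    refine ⟨s ∪ t, fun r hr => ?_⟩
    simp only [mul_add, add_mul, Finset.sum_add_distrib]
    rw [← hs r (Finset.union_subset_left hr), ← ht r (Finset.union_subset_right hr)]

theorem id_mul_mul_id_mem (x : CatRing C) (p : C × C) :
    of p.1 p.1 (𝟙 p.1) * x * of p.2 p.2 (𝟙 p.2) ∈ component C p := by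
  classical
  induction x using induction_on with
  | h0 => simp
  | h1 A B f =>
    rw [of_id_mul_of]
    split_ifs with h
    · rw [of_mul_of_id]
      split_ifs with h'
      · subst h h'
        exact ⟨f, rfl⟩
      · exact zero_mem _
    · rw [zero_mul]
      exact zero_mem _
  | h2 x y hx hy =>
    rw [mul_add, add_mul]
    exact add_mem hx hy

/-- The left multiplications by arrows and the right multiplications by identities. -/
def leftAct : Arrows C ⊕ C → AddMonoid.End (CatRing C)
  | .inl s => AddMonoidHom.mulLeft (of s.2.1 s.1 s.2.2)
  | .inr E => AddMonoidHom.mulRight (of E E (𝟙 E))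

theorem leftAct_inl (X Y : C) (f : X ⟶ Y) (x : CatRing C) :
    leftAct (.inl ⟨X, Y, f⟩) x = of Y X f * x := rfl

theorem leftAct_inr (E : C) (x : CatRing C) : leftAct (.inr E) x = x * of E E (𝟙 E) := rfl

/-- A left ideal is already stable under left multiplication by identities, so homogeneity only adds
stability under right multiplication by them. Graded left ideals thereby become submodules over a
free ring. -/
theorem isGradedLeftIdeal_iff (N : AddSubgroup (CatRing C)) :
    IsGradedLeftIdeal (component C) N ↔ ∀ s, ∀ x ∈ N, leftAct s x ∈ N := by
  classical
  constructor
  · rintro ⟨h1, h2⟩ (⟨X, Y, f⟩ | E) x hx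
    · exact h1 x hx _
    · rw [leftAct_inr]
      rw [h2] at hx
      refine AddSubgroup.iSup_induction (C := fun x => x * of E E (𝟙 E) ∈ N) _ hx ?_ ?_ ?_
      · rintro ⟨A, B⟩ _ ⟨hx, f, rfl⟩
        dsimp only at f hx ⊢
        rw [of_mul_of_id]
        split_ifs
        · exact hx
        · exact zero_mem _
      · rw [zero_mul]
        exact zero_mem _
      · intro x y hx hy
        rw [add_mul]
        exact add_mem hx hy
  · intro h
    have hmul : ∀ x ∈ N, ∀ r : CatRing C, r * x ∈ N := fun x hx r => by
      induction r using induction_on with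
      | h0 => rw [zero_mul]; exact zero_mem _
      | h1 A B f => exact h (.inl ⟨B, A, f⟩) x hx
      | h2 r r' hr hr' => rw [add_mul]; exact add_mem hr hr'
    refine ⟨hmul, le_antisymm (fun x hx => ?_) (iSup_le fun _ => inf_le_left)⟩
    obtain ⟨s, hs⟩ := exists_eq_sum x
    rw [hs]
    refine sum_mem fun p _ => AddSubgroup.mem_iSup_of_mem p ⟨?_, id_mul_mul_id_mem x p⟩
    exact h (.inr p.2) _ (hmul x hx _)

/-- Graded left ideals as submodules. -/
def leftIdealSubmodule (N : AddSubgroup (CatRing C)) (h : IsGradedLeftIdeal (component C) N) :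
    Submodule (FreeAlgebra ℤ (Arrows C ⊕ C)) (FreeMod (leftAct (C := C))) :=
  FreeMod.submodule _ N ((isGradedLeftIdeal_iff N).1 h)

/-- The graded left ideal of a submodule. -/
def submoduleLeftIdeal
    (N : Submodule (FreeAlgebra ℤ (Arrows C ⊕ C)) (FreeMod (leftAct (C := C)))) :
    AddSubgroup (CatRing C) := N.toAddSubgroup

theorem isGradedLeftIdeal_submoduleLeftIdeal
    (N : Submodule (FreeAlgebra ℤ (Arrows C ⊕ C)) (FreeMod (leftAct (C := C)))) :
    IsGradedLeftIdeal (component C) (submoduleLeftIdeal N) :=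
  (isGradedLeftIdeal_iff _).2 fun s _ hx => FreeMod.rho_mem N s hx

theorem isSimpleModule_of_isGrSimple {N : AddSubgroup (CatRing C)}
    (h : IsGrSimpleLeftIdeal (component C) N) :
    IsSimpleModule (FreeAlgebra ℤ (Arrows C ⊕ C)) (leftIdealSubmodule N h.graded) := by
  rw [isSimpleModule_iff_isAtom]
  refine ⟨fun h0 => h.ne_bot ?_, fun M hM => ?_⟩
  · exact (AddSubgroup.eq_bot_iff_forall _).2 fun x hx =>
      (Submodule.eq_bot_iff _).1 h0 x hx
  · rcases h.eq_bot_or_eq _ (isGradedLeftIdeal_submoduleLeftIdeal M) hM.le with h1 | h1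
    · exact (Submodule.eq_bot_iff _).2 fun x hx => (AddSubgroup.eq_bot_iff_forall _).1 h1 x hx
    · exact absurd (show leftIdealSubmodule N h.graded ≤ M from h1.ge) hM.not_ge

theorem isGrSimple_of_isSimpleModule
    {M : Submodule (FreeAlgebra ℤ (Arrows C ⊕ C)) (FreeMod (leftAct (C := C)))}
    (h : IsSimpleModule (FreeAlgebra ℤ (Arrows C ⊕ C)) M) :
    IsGrSimpleLeftIdeal (component C) (submoduleLeftIdeal M) := by
  rw [isSimpleModule_iff_isAtom] at h
  refine ⟨isGradedLeftIdeal_submoduleLeftIdeal M, fun h0 => h.1 ?_, fun N hN hNM => ?_⟩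
  · exact (Submodule.eq_bot_iff _).2 fun x hx => (AddSubgroup.eq_bot_iff_forall _).1 h0 x hx
  · rcases h.le_iff.1 (show leftIdealSubmodule N hN ≤ M from hNM) with h1 | h1
    · exact Or.inl ((AddSubgroup.eq_bot_iff_forall _).2 fun x hx =>
        (Submodule.eq_bot_iff _).1 h1 x hx)
    · exact Or.inr (le_antisymm hNM (show M ≤ leftIdealSubmodule N hN from h1.ge))

theorem isLeftGrSemisimple_iff_isSemisimpleModule : IsLeftGrSemisimple (component C) ↔
    IsSemisimpleModule (FreeAlgebra ℤ (Arrows C ⊕ C)) (FreeMod (leftAct (C := C))) := by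
  constructor
  · rintro ⟨𝒮, h𝒮, htop⟩
    refine isSemisimpleModule_of_isSemisimpleModule_submodule'
      (p := fun S : 𝒮 => leftIdealSubmodule S.1 (h𝒮 S.1 S.2).graded) (fun S => ?_) ?_
    · have := isSimpleModule_of_isGrSimple (h𝒮 S.1 S.2)
      infer_instance
    · rw [eq_top_iff]
      rintro x -
      let p : 𝒮 → Submodule (FreeAlgebra ℤ (Arrows C ⊕ C)) (FreeMod (leftAct (C := C))) :=
        fun S => leftIdealSubmodule S.1 (h𝒮 S.1 S.2).graded
      have h1 : sSup 𝒮 ≤ submoduleLeftIdeal (⨆ S, p S) := sSup_le fun S hS y hy =>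
        Submodule.mem_iSup_of_mem (p := p) ⟨S, hS⟩ (show y ∈ S from hy)
      exact h1 (htop ▸ AddSubgroup.mem_top _)
  · intro h
    let T : Set (Submodule (FreeAlgebra ℤ (Arrows C ⊕ C)) (FreeMod (leftAct (C := C)))) :=
      {m | IsSimpleModule (FreeAlgebra ℤ (Arrows C ⊕ C)) m}
    refine ⟨submoduleLeftIdeal '' T, ?_, ?_⟩
    · rintro _ ⟨m, hm, rfl⟩
      exact isGrSimple_of_isSimpleModule hm
    · rw [eq_top_iff]
      rintro x -
      have hx : FreeMod.equiv leftAct x ∈ ⨆ m : T, m.1 := by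
        rw [← sSup_eq_iSup', IsSemisimpleModule.sSup_simples_eq_top]
        trivial
      refine Submodule.iSup_induction (fun m : T => m.1)
        (motive := fun x => (FreeMod.equiv leftAct).symm x ∈ sSup (submoduleLeftIdeal '' T))
        hx ?_ ?_ ?_
      · rintro ⟨m, hm⟩ y hy
        exact le_sSup (Set.mem_image_of_mem submoduleLeftIdeal hm) hy
      · exact AddSubgroup.zero_mem _
      · exact fun y z hy hz => AddSubgroup.add_mem _ hy hz

theorem repMod_induction {A : C} {p : RepMod A → Prop} (m : RepMod A) (h0 : p 0)
    (h1 : ∀ X g, p (repIncl A X g)) (h2 : ∀ x y, p x → p y → p (x + y)) : p m :=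
  total_induction m h0 h1 h2

theorem repCoord_repIncl_of_ne {A X Y : C} (h : X ≠ Y) (g : A ⟶ X) :
    repCoord A Y (repIncl A X g) = 0 := by
  classical
  exact DirectSum.of_eq_of_ne (β := fun X : C => (A ⟶ X)) X Y g (Ne.symm h)

open scoped Classical in
/-- The action on the summand `C(D, -)` of the ring of the category. -/
def rowAct (D : C) : Arrows C ⊕ C → AddMonoid.End (RepMod D)
  | .inl s => arrowAct (homFrom C D) s
  | .inr E => if E = D then 1 else 0

/-- On `C(D, -)` right multiplication by the identity of `E` is `1` or `0`. The action thus factors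
through the surjection `σ` onto the free ring on the arrows, and the additional generators do not
change the submodules. -/
theorem rowAct_isSemisimpleModule_iff (D : C) :
    IsSemisimpleModule (FreeAlgebra ℤ (Arrows C ⊕ C)) (FreeMod (rowAct D)) ↔
      IsSemisimpleModule (FreeAlgebra ℤ (Arrows C)) (RepMod D) := by
  classical
  let σ : FreeAlgebra ℤ (Arrows C ⊕ C) →ₐ[ℤ] FreeAlgebra ℤ (Arrows C) :=
    FreeAlgebra.lift ℤ (Sum.elim (FreeAlgebra.ι ℤ) fun E => if E = D then 1 else 0)
  have hσ : Function.Surjective σ := by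
    rw [← AlgHom.range_eq_top, eq_top_iff, ← FreeAlgebra.adjoin_range_ι, Algebra.adjoin_le_iff]
    rintro _ ⟨s, rfl⟩
    exact ⟨FreeAlgebra.ι ℤ (.inl s), by simp [σ]⟩
  have : RingHomSurjective σ.toRingHom := ⟨hσ⟩
  refine LinearMap.isSemisimpleModule_iff_of_bijective
    (FreeMod.semilinear σ.toRingHom (AddMonoidHom.id (RepMod D)) ?_) Function.bijective_id
  rintro (s | E) m
  · have h1 : σ.toRingHom (FreeAlgebra.ι ℤ (.inl s)) = FreeAlgebra.ι ℤ s := by simp [σ]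
    rw [h1]
    exact (FreeMod.ι_smul' s m).symm
  · have h1 : σ.toRingHom (FreeAlgebra.ι ℤ (.inr E)) = if E = D then 1 else 0 := by simp [σ]
    rw [h1]
    change (if E = D then (1 : AddMonoid.End (RepMod D)) else 0) m = _
    split_ifs <;> simp

open scoped Classical in
/-- The inclusion of the summand `C(D, -)` of the ring of the category. -/
def rowHom (D : C) : RepMod D →+ CatRing C :=
  DirectSum.toAddMonoid (β := fun X : C => (D ⟶ X)) fun X => of X D

theorem rowHom_repIncl (D X : C) (g : D ⟶ X) : rowHom D (repIncl D X g) = of X D g := by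
  classical
  exact DirectSum.toAddMonoid_of (β := fun X : C => (D ⟶ X)) _ X g

open scoped Classical in
/-- The projection to the summand `C(D, -)` of the ring of the category. -/
def rowProj (D : C) : CatRing C →+ RepMod D :=
  DirectSum.toAddMonoid (β := fun p : C × C => (p.2 ⟶ p.1)) fun p =>
    if h : p.2 = D then (repIncl D p.1).comp (Preadditive.leftComp _ (eqToHom h.symm)) else 0

theorem rowProj_of (D X : C) (g : D ⟶ X) : rowProj D (of X D g) = repIncl D X g := by
  classical
  have h := DirectSum.toAddMonoid_of (β := fun p : C × C => (p.2 ⟶ p.1)) (fun p =>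
    if h : p.2 = D then (repIncl D p.1).comp (Preadditive.leftComp _ (eqToHom h.symm)) else 0)
    (X, D) g
  refine h.trans ?_
  simp [Preadditive.leftComp]

theorem rowProj_rowHom (D : C) (m : RepMod D) : rowProj D (rowHom D m) = m := by
  induction m using repMod_induction with
  | h0 => rw [map_zero, map_zero]
  | h1 X g => exact (congrArg _ (rowHom_repIncl D X g)).trans (rowProj_of D X g)
  | h2 x y hx hy => rw [map_add, map_add, hx, hy]

theorem rowHom_rowAct (D : C) (s : Arrows C ⊕ C) (m : RepMod D) :
    rowHom D (rowAct D s m) = leftAct s (rowHom D m) := by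
  classical
  rcases s with ⟨X, Y, f⟩ | E
  · have h0 : rowAct D (.inl ⟨X, Y, f⟩) m = repIncl D Y (repCoord D X m ≫ f) :=
      (FreeMod.ι_smul' (ρ := arrowAct (homFrom C D)) ⟨X, Y, f⟩ m).symm.trans
        (arrow_smul (F := homFrom C D) f m)
    rw [h0, rowHom_repIncl, leftAct_inl]
    clear h0
    induction m using repMod_induction with
    | h0 => simp
    | h1 Z g =>
      rw [rowHom_repIncl]
      by_cases h : Z = X
      · subst h
        rw [repCoord_repIncl, of_mul_of_same]
      · rw [of_mul_of_ne _ _ _ _ _ _ h]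
        rw [repCoord_repIncl_of_ne h, zero_comp, map_zero]
    | h2 x y hx hy => rw [map_add, Preadditive.add_comp, map_add, map_add, mul_add, hx, hy]
  · rw [leftAct_inr]
    change rowHom D ((if E = D then (1 : AddMonoid.End (RepMod D)) else 0) m) = _
    induction m using repMod_induction with
    | h0 => simp
    | h1 Z g =>
      rw [rowHom_repIncl, of_mul_of_id]
      split_ifs
      · exact rowHom_repIncl D Z g
      · exact map_zero _
    | h2 x y hx hy => rw [map_add, map_add, map_add, add_mul, hx, hy]

/-- The ring is spanned by the left ideals `C(D, -)`, one for each object `D`. Semisimplicity passes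
from the ring to these submodules and from them to their sum. -/
theorem isLeftGrSemisimple_iff : IsLeftGrSemisimple (component C) ↔
    ∀ A : C, IsSemisimpleObject.{u} (homFrom C A) := by
  simp only [isSemisimpleObject_iff_total, isLeftGrSemisimple_iff_isSemisimpleModule]
  let θ := fun D : C => FreeMod.linear (rowAct D) leftAct (rowHom D) (rowHom_rowAct D)
  constructor
  · intro h D
    refine (rowAct_isSemisimpleModule_iff D).1 (IsSemisimpleModule.of_injective (θ D) ?_)
    exact (show Function.LeftInverse (rowProj D) (rowHom D) from rowProj_rowHom D).injective
  · intro h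
    refine isSemisimpleModule_of_isSemisimpleModule_submodule'
      (p := fun D => LinearMap.range (θ D)) (fun D => ?_) ?_
    · have := (rowAct_isSemisimpleModule_iff D).2 (h D)
      exact IsSemisimpleModule.range _
    · rw [eq_top_iff]
      rintro x -
      induction x using induction_on with
      | h0 => exact Submodule.zero_mem _
      | h1 A B f =>
        exact Submodule.mem_iSup_of_mem B ⟨repIncl B A f, rowHom_repIncl B A f⟩
      | h2 x y hx hy => exact Submodule.add_mem _ hx hy

end CatRing

/-! ### Gr-semisimplicity along an anti-isomorphism of graded rings -/

section Anti

variable {R R' : Type*} [NonUnitalRing R] [NonUnitalRing R'] {Γ Γ' : Type*}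
  {𝒜 : Γ → AddSubgroup R} {ℬ : Γ' → AddSubgroup R'}
  (e : R ≃+ R') (he : ∀ x y, e (x * y) = e y * e x) (σ : Γ ≃ Γ')
  (hσ : ∀ γ, e.mapAddSubgroup (𝒜 γ) = ℬ (σ γ))

include he hσ

/-- An additive isomorphism induces an isomorphism of the lattices of subgroups, so homogeneity is
transported; reversal of products exchanges the two sides. -/
theorem isGradedLeftIdeal_map_iff (N : AddSubgroup R) :
    IsGradedLeftIdeal ℬ (e.mapAddSubgroup N) ↔ IsGradedRightIdeal 𝒜 N := by
  have h1 : (∀ x ∈ e.mapAddSubgroup N, ∀ r, r * x ∈ e.mapAddSubgroup N) ↔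
      ∀ x ∈ N, ∀ r, x * r ∈ N := by
    constructor
    · intro h x hx r
      obtain ⟨y, hy, hxy⟩ := h (e x) ⟨x, hx, rfl⟩ (e r)
      have : y = x * r := e.injective (hxy.trans (he x r).symm)
      exact this ▸ hy
    · rintro h _ ⟨x, hx, rfl⟩ r
      obtain ⟨r, rfl⟩ := e.surjective r
      exact ⟨x * r, h x hx r, he x r⟩
  have h2 : e.mapAddSubgroup N = ⨆ γ, e.mapAddSubgroup N ⊓ ℬ γ ↔ N = ⨆ γ, N ⊓ 𝒜 γ := by
    rw [← σ.iSup_comp]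
    simp only [← hσ, ← map_inf, ← OrderIso.map_iSup]
    exact e.mapAddSubgroup.injective.eq_iff
  exact ⟨fun h => ⟨h1.1 h.1, h2.1 h.2⟩, fun h => ⟨h1.2 h.1, h2.2 h.2⟩⟩

theorem isGrSimpleLeftIdeal_map_iff (N : AddSubgroup R) :
    IsGrSimpleLeftIdeal ℬ (e.mapAddSubgroup N) ↔ IsGrSimpleRightIdeal 𝒜 N := by
  constructor
  · rintro ⟨h1, h2, h3⟩
    refine ⟨(isGradedLeftIdeal_map_iff e he σ hσ N).1 h1, fun h => h2 (by rw [h, map_bot]),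
      fun N' hN' hle => ?_⟩
    refine (h3 _ ((isGradedLeftIdeal_map_iff e he σ hσ N').2 hN')
      (e.mapAddSubgroup.monotone hle)).imp (fun h => ?_) fun h => e.mapAddSubgroup.injective h
    rwa [map_eq_bot_iff] at h
  · rintro ⟨h1, h2, h3⟩
    refine ⟨(isGradedLeftIdeal_map_iff e he σ hσ N).2 h1, fun h => h2 (by
      rwa [map_eq_bot_iff] at h), fun N' hN' hle => ?_⟩
    obtain ⟨N', rfl⟩ := e.mapAddSubgroup.surjective N'
    refine (h3 _ ((isGradedLeftIdeal_map_iff e he σ hσ N').1 hN')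
      (e.mapAddSubgroup.le_iff_le.1 hle)).imp (fun h => ?_) fun h => by rw [h]
    rw [h, map_bot]

theorem isLeftGrSemisimple_iff_of_anti : IsLeftGrSemisimple ℬ ↔ IsRightGrSemisimple 𝒜 := by
  constructor
  · rintro ⟨𝒮, h1, h2⟩
    refine ⟨e.mapAddSubgroup ⁻¹' 𝒮, fun S hS =>
      (isGrSimpleLeftIdeal_map_iff e he σ hσ S).1 (h1 _ hS), ?_⟩
    apply e.mapAddSubgroup.injective
    rw [map_top, ← h2, OrderIso.map_sSup_eq_sSup_symm_preimage]
    congr 1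
    ext S
    rw [Set.mem_preimage, Set.mem_preimage, OrderIso.apply_symm_apply]
  · rintro ⟨𝒮, h1, h2⟩
    refine ⟨e.mapAddSubgroup '' 𝒮, ?_, ?_⟩
    · rintro _ ⟨S, hS, rfl⟩
      exact (isGrSimpleLeftIdeal_map_iff e he σ hσ S).2 (h1 _ hS)
    · rw [sSup_image, ← OrderIso.map_sSup, h2, map_top]

end Anti

/-! ### The ring of the opposite category and right gr-semisimplicity -/

namespace CatRing

variable {C : Type u} [SmallCategory C] [Preadditive C]

open scoped Classical in
/-- The canonical anti-homomorphism to the ring of the opposite category. -/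
def opHom : CatRing C →+ CatRing Cᵒᵖ :=
  DirectSum.toAddMonoid (β := fun p : C × C => (p.2 ⟶ p.1)) fun p =>
    (of (op p.2) (op p.1)).comp (unopAddEquiv (op p.1) (op p.2)).symm.toAddMonoidHom

theorem opHom_of (A B : C) (f : B ⟶ A) : opHom (of A B f) = of (op B) (op A) f.op := by
  classical
  exact DirectSum.toAddMonoid_of (β := fun p : C × C => (p.2 ⟶ p.1)) _ (A, B) f

open scoped Classical in
/-- The canonical anti-homomorphism from the ring of the opposite category. -/
def unopHom : CatRing Cᵒᵖ →+ CatRing C :=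
  DirectSum.toAddMonoid (β := fun p : Cᵒᵖ × Cᵒᵖ => (p.2 ⟶ p.1)) fun p =>
    (of p.2.unop p.1.unop).comp (unopAddEquiv p.2 p.1).toAddMonoidHom

theorem unopHom_of (A B : Cᵒᵖ) (f : B ⟶ A) :
    unopHom (of A B f) = of B.unop A.unop f.unop := by
  classical
  exact DirectSum.toAddMonoid_of (β := fun p : Cᵒᵖ × Cᵒᵖ => (p.2 ⟶ p.1)) _ (A, B) f

variable (C) in
/-- The ring of the opposite category is the opposite ring. -/
def opEquiv : CatRing C ≃+ CatRing Cᵒᵖ where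
  toFun := opHom
  invFun := unopHom
  left_inv x := by
    induction x using induction_on with
    | h0 => rw [map_zero, map_zero]
    | h1 A B f => rw [opHom_of, unopHom_of]; rfl
    | h2 x y hx hy => rw [map_add, map_add, hx, hy]
  right_inv x := by
    induction x using induction_on with
    | h0 => rw [map_zero, map_zero]
    | h1 A B f => rw [unopHom_of, opHom_of]; rfl
    | h2 x y hx hy => rw [map_add, map_add, hx, hy]
  map_add' x y := map_add _ x y

theorem opEquiv_of (A B : C) (f : B ⟶ A) : opEquiv C (of A B f) = of (op B) (op A) f.op :=
  opHom_of A B f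

theorem opEquiv_mul (x y : CatRing C) : opEquiv C (x * y) = opEquiv C y * opEquiv C x := by
  induction x using induction_on with
  | h0 => simp
  | h2 x x' hx hx' => rw [add_mul, map_add, map_add, mul_add, hx, hx']
  | h1 A B f =>
    induction y using induction_on with
    | h0 => simp
    | h2 y y' hy hy' => rw [mul_add, map_add, map_add, add_mul, hy, hy']
    | h1 B' D g =>
      rw [opEquiv_of, opEquiv_of]
      by_cases h : B' = B
      · subst h
        rw [of_mul_of_same, of_mul_of_same, opEquiv_of, op_comp]
      · rw [of_mul_of_ne _ _ _ _ _ _ h, of_mul_of_ne, map_zero]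
        exact fun h' => h (op_injective h').symm

theorem mapAddSubgroup_component (p : C × C) :
    (opEquiv C).mapAddSubgroup (component C p) =
      component Cᵒᵖ (((Equiv.prodComm C C).trans (Equiv.prodCongr equivToOpposite
        equivToOpposite)) p) := by
  ext x
  constructor
  · rintro ⟨_, ⟨f, rfl⟩, rfl⟩
    exact ⟨f.op, (opEquiv_of _ _ f).symm⟩
  · rintro ⟨f, rfl⟩
    exact ⟨_, ⟨f.unop, rfl⟩, opEquiv_of _ _ f.unop⟩

theorem isRightGrSemisimple_iff :
    IsRightGrSemisimple (component C) ↔ IsSemisimpleCategory C := by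
  rw [← isLeftGrSemisimple_iff_of_anti (opEquiv C) opEquiv_mul _ mapAddSubgroup_component,
    isLeftGrSemisimple_iff, isSemisimpleCategory_iff]

end CatRing

end Ring

/-! ### Families of semisimple objects -/

section FamMod

variable {I : Type u} {Λ : Type*} [Ring Λ] (M : I → Type u) [∀ A, AddCommGroup (M A)]
  [∀ A, Module Λ (M A)]

/-- The direct sum of a family of `Λ`-modules, as a module over `I → Λ`. -/
def FamMod : Type u := ⨁ A, M A

namespace FamMod

instance : AddCommGroup (FamMod M) := inferInstanceAs (AddCommGroup (⨁ A, M A))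

/-- A coordinate of an element of the direct sum. -/
def proj (A : I) : FamMod M →+ M A := DFinsupp.evalAddMonoidHom (β := M) A

open scoped Classical in
/-- The inclusion of a summand. -/
def inj (A : I) : M A →+ FamMod M := DirectSum.of M A

variable {M}

theorem ext {x y : FamMod M} (h : ∀ A, proj M A x = proj M A y) : x = y := DFinsupp.ext h

@[simp]
theorem proj_inj (A : I) (x : M A) : proj M A (inj M A x) = x := by
  classical
  exact DirectSum.of_eq_same (β := M) A x

theorem proj_inj_of_ne {A B : I} (h : A ≠ B) (x : M A) : proj M B (inj M A x) = 0 := by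
  classical
  exact DirectSum.of_eq_of_ne (β := M) A B x h.symm

theorem exists_eq_sum (x : FamMod M) : ∃ s : Finset I, x = ∑ A ∈ s, inj M A (proj M A x) := by
  classical
  exact ⟨_, (DirectSum.sum_support_of (show ⨁ A, M A from x)).symm⟩

instance : SMul (I → Λ) (FamMod M) where
  smul r x := DFinsupp.mapRange (β₁ := M) (β₂ := M) (fun A m => r A • m) (fun _ => smul_zero _) x

@[simp]
theorem proj_smul (r : I → Λ) (x : FamMod M) (A : I) : proj M A (r • x) = r A • proj M A x :=
  DFinsupp.mapRange_apply (β₁ := M) (β₂ := M) (fun A m => r A • m) (fun _ => smul_zero _) x A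

instance : Module (I → Λ) (FamMod M) where
  one_smul x := ext fun A => by simp
  mul_smul r s x := ext fun A => by simp [mul_smul]
  smul_zero r := ext fun A => by simp
  smul_add r x y := ext fun A => by simp
  add_smul r s x := ext fun A => by simp [add_smul]
  zero_smul x := ext fun A => by simp

open scoped Classical in
theorem smul_inj (r : I → Λ) (A : I) (x : M A) : r • inj M A x = inj M A (r A • x) := by
  refine ext fun B => ?_
  rw [proj_smul]
  by_cases h : A = B
  · subst h
    simp
  · simp [proj_inj_of_ne h]

open scoped Classical in
theorem single_smul (A : I) (x : FamMod M) :
    (Pi.single A 1 : I → Λ) • x = inj M A (proj M A x) := by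
  refine ext fun B => ?_
  rw [proj_smul]
  by_cases h : A = B
  · subst h
    simp
  · simp [proj_inj_of_ne h, Pi.single_eq_of_ne (Ne.symm h)]

/-- The idempotents of `I → Λ` project onto the summands, so a submodule is the sum of its
components. -/
theorem mem_iff (N : Submodule (I → Λ) (FamMod M)) (x : FamMod M) :
    x ∈ N ↔ ∀ A, inj M A (proj M A x) ∈ N := by
  classical
  constructor
  · intro h A
    rw [← single_smul (Λ := Λ)]
    exact N.smul_mem _ h
  · intro h
    obtain ⟨s, hs⟩ := exists_eq_sum x
    rw [hs]
    exact N.sum_mem fun A _ => h A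

/-- The component of a submodule. -/
def component (N : Submodule (I → Λ) (FamMod M)) (A : I) : Submodule Λ (M A) where
  carrier := {x | inj M A x ∈ N}
  add_mem' hx hy := by
    rw [Set.mem_ofPred_eq, map_add]
    exact N.add_mem hx hy
  zero_mem' := by
    rw [Set.mem_ofPred_eq, map_zero]
    exact N.zero_mem
  smul_mem' a x hx := by
    have := N.smul_mem (fun _ => a) hx
    rwa [smul_inj] at this

theorem mem_component {N : Submodule (I → Λ) (FamMod M)} {A : I} {x : M A} :
    x ∈ component N A ↔ inj M A x ∈ N := Iff.rfl

variable {M' : I → Type u} [∀ A, AddCommGroup (M' A)] [∀ A, Module Λ (M' A)]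

/-- A family of linear maps induces a linear map on the direct sums. -/
def map (f : ∀ A, M A →ₗ[Λ] M' A) : FamMod M →ₗ[I → Λ] FamMod M' where
  toFun x := DFinsupp.mapRange (β₁ := M) (β₂ := M') (fun A m => f A m) (fun _ => map_zero _) x
  map_add' x y := DFinsupp.mapRange_add (β₁ := M) (β₂ := M') _ _ (fun _ => map_add _) x y
  map_smul' r x := ext fun A => map_smul (f A) (r A) (proj M A x)

@[simp]
theorem proj_map (f : ∀ A, M A →ₗ[Λ] M' A) (x : FamMod M) (A : I) :
    proj M' A (map f x) = f A (proj M A x) :=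
  DFinsupp.mapRange_apply (β₁ := M) (β₂ := M') (fun A m => f A m) (fun _ => map_zero _) x A

@[simp]
theorem map_inj (f : ∀ A, M A →ₗ[Λ] M' A) (A : I) (x : M A) :
    map f (inj M A x) = inj M' A (f A x) := by
  classical
  exact DFinsupp.mapRange_single (β₁ := M) (β₂ := M') (hf := fun _ => map_zero _)

/-- A linear map commutes with the idempotents of `I → Λ`, hence is diagonal. -/
theorem exists_eq_map (g : FamMod M →ₗ[I → Λ] FamMod M') : ∃ f : ∀ A, M A →ₗ[Λ] M' A,
    g = map f := by
  classical
  refine ⟨fun A =>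
    { toFun := fun x => proj M' A (g (inj M A x))
      map_add' := fun x y => by simp
      map_smul' := fun a x => by
        have h : inj M A (a • x) = (fun _ => a : I → Λ) • inj M A x :=
          (smul_inj (fun _ => a) A x).symm
        rw [h, map_smul, proj_smul]
        rfl }, ?_⟩
  ext x
  refine ext fun A => ?_
  rw [proj_map]
  change _ = proj M' A (g (inj M A (proj M A x)))
  rw [← single_smul (Λ := Λ), map_smul, proj_smul, Pi.single_eq_same, one_smul]

theorem map_injective {f : ∀ A, M A →ₗ[Λ] M' A} (hf : ∀ A, Function.Injective (f A)) :
    Function.Injective (map f) := fun x y h => ext fun A => hf A <| by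
  rw [← proj_map, ← proj_map, h]

theorem range_map {f : ∀ A, M A →ₗ[Λ] M' A} {N : Submodule (I → Λ) (FamMod M')}
    (hf : ∀ A, LinearMap.range (f A) = component N A) : LinearMap.range (map f) = N := by
  ext x
  rw [mem_iff, mem_iff N]
  refine forall_congr' fun A => ?_
  rw [← mem_component (N := N), ← hf]
  constructor
  · rintro ⟨y, hy⟩
    exact ⟨proj _ A y, by rw [← proj_map, hy, proj_inj]⟩
  · rintro ⟨y, hy⟩
    exact ⟨inj _ A y, by rw [map_inj, hy]⟩

theorem ker_map {f : ∀ A, M A →ₗ[Λ] M' A} {N : Submodule (I → Λ) (FamMod M)}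
    (hf : ∀ A, LinearMap.ker (f A) = component N A) : LinearMap.ker (map f) = N := by
  ext x
  rw [mem_iff N]
  simp only [← mem_component, ← hf, LinearMap.mem_ker, ← proj_map]
  exact ⟨fun h A => by rw [h, map_zero], fun h => ext fun A => by rw [h, map_zero]⟩

/-- Evaluation at `A` is a surjection from `I → Λ` to `Λ`, so `M A` has the same submodules over
both rings. Over `I → Λ` it is a quotient of the direct sum and also one of the submodules that span
it. -/
theorem isSemisimpleModule_iff :
    IsSemisimpleModule (I → Λ) (FamMod M) ↔ ∀ A, IsSemisimpleModule Λ (M A) := by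
  classical
  let _ : ∀ A, Module (I → Λ) (M A) := fun A =>
    Module.compHom (M A) (Pi.evalRingHom (fun _ => Λ) A)
  have h0 : ∀ A, IsSemisimpleModule (I → Λ) (M A) ↔ IsSemisimpleModule Λ (M A) := fun A => by
    have : RingHomSurjective (Pi.evalRingHom (fun _ : I => Λ) A) := ⟨Function.surjective_eval A⟩
    let l : M A →ₛₗ[Pi.evalRingHom (fun _ : I => Λ) A] M A :=
      { toFun := fun x => x
        map_add' := fun _ _ => rfl
        map_smul' := fun _ _ => rfl }
    exact LinearMap.isSemisimpleModule_iff_of_bijective l Function.bijective_id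
  simp only [← h0]
  constructor
  · intro h A
    let p : FamMod M →ₗ[I → Λ] M A :=
      { toFun := proj M A
        map_add' := map_add _
        map_smul' := fun r x => proj_smul r x A }
    exact IsSemisimpleModule.of_surjective p fun x => ⟨inj M A x, proj_inj A x⟩
  · intro h
    let i : ∀ A, M A →ₗ[I → Λ] FamMod M := fun A =>
      { toFun := inj M A
        map_add' := map_add _
        map_smul' := fun r x => (smul_inj r A x).symm }
    refine isSemisimpleModule_of_isSemisimpleModule_submodule'
      (p := fun A => LinearMap.range (i A)) (fun A => IsSemisimpleModule.range _) ?_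
    rw [eq_top_iff]
    rintro x -
    refine (mem_iff _ x).2 fun A => Submodule.mem_iSup_of_mem A ⟨proj M A x, rfl⟩

end FamMod

end FamMod

/-! ### Categories whose objects are families of objects of another category -/

section Families

variable {𝒢 𝒜 : Type*} [Category* 𝒢] [HasZeroMorphisms 𝒢] [Category* 𝒜] [HasZeroMorphisms 𝒜]
  {Λ : Type*} [Ring Λ] (U : 𝒜 ⥤ ModuleCat.{u} Λ) {I : Type u} (K : I → 𝒢 ⥤ 𝒜)

/-- The direct sum of the modules of the components. -/
def famTotal : 𝒢 ⥤ ModuleCat.{u} (I → Λ) where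
  obj G := ModuleCat.of _ (FamMod fun A => U.obj ((K A).obj G))
  map f := ModuleCat.ofHom (FamMod.map fun A => (U.map ((K A).map f)).hom)
  map_id G := by
    ext x
    refine FamMod.ext fun A => ?_
    refine (FamMod.proj_map (fun A => (U.map ((K A).map (𝟙 G))).hom) x A).trans ?_
    simp
  map_comp f g := by
    ext x
    refine FamMod.ext fun A => ?_
    refine (FamMod.proj_map (fun A => (U.map ((K A).map (f ≫ g))).hom) x A).trans ?_
    refine Eq.trans ?_ (FamMod.proj_map (fun A => (U.map ((K A).map g)).hom) _ A).symm
    refine Eq.trans ?_ (congrArg _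
      (FamMod.proj_map (fun A => (U.map ((K A).map f)).hom) x A).symm)
    simp

variable {U K}

/-- If the objects of `𝒢` are the same thing as families of objects of `𝒜`, then an object of `𝒢`
is semisimple if and only if its components are. -/
theorem isSemisimpleObject_iff_forall [U.Full] [U.Faithful] [U.PreservesZeroMorphisms]
    (hs : LiftsSubmodules U) (hq : LiftsQuotients U) [∀ A, (K A).PreservesZeroMorphisms]
    (hff : ∀ G H : 𝒢, Function.Bijective fun (f : G ⟶ H) A => (K A).map f)
    (hes : ∀ F : I → 𝒜, ∃ G : 𝒢, ∀ A, Nonempty ((K A).obj G ≅ F A)) (G : 𝒢) :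
    IsSemisimpleObject.{u} G ↔ ∀ A, IsSemisimpleObject.{u} ((K A).obj G) := by
  have : (famTotal U K).PreservesZeroMorphisms := ⟨fun G H => by
    ext x
    refine FamMod.ext fun A => ?_
    refine (FamMod.proj_map (fun A => (U.map ((K A).map (0 : G ⟶ H))).hom) x A).trans ?_
    simp only [Functor.map_zero]
    exact (map_zero _).symm⟩
  have : (famTotal U K).Faithful := ⟨fun {G H} f g h => (hff G H).1 <| by
    funext A
    apply U.map_injective
    ext x
    have h1 := congrArg (fun l => FamMod.proj (fun A => U.obj ((K A).obj H)) A
      (l.hom (FamMod.inj (fun A => U.obj ((K A).obj G)) A x))) h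
    refine Eq.trans ?_ (h1.trans ?_)
    · refine Eq.trans ?_ (FamMod.proj_map (fun A => (U.map ((K A).map f)).hom) _ A).symm
      rw [FamMod.proj_inj]
    · refine (FamMod.proj_map (fun A => (U.map ((K A).map g)).hom) _ A).trans ?_
      rw [FamMod.proj_inj]⟩
  have : (famTotal U K).Full := ⟨fun {G H} l => by
    obtain ⟨f, hf⟩ := FamMod.exists_eq_map l.hom
    obtain ⟨g, hg⟩ := (hff G H).2 fun A => U.preimage (ModuleCat.ofHom (f A))
    refine ⟨g, ModuleCat.hom_ext ?_⟩
    rw [hf]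
    change FamMod.map _ = _
    congr 1
    funext A
    have := congrFun hg A
    dsimp only at this
    rw [this, U.map_preimage]
    rfl⟩
  -- The components of `N` are lifted separately and assembled; the isomorphisms `e A` intervene
  -- because the components of `Y'` are prescribed only up to isomorphism.
  have hs' : LiftsSubmodules (famTotal U K) := by
    intro G N
    choose Y i hi hr using fun A => hs ((K A).obj G) (FamMod.component N A)
    obtain ⟨Y', e⟩ := hes Y
    replace e := fun A => (e A).some
    obtain ⟨j, hj⟩ := (hff Y' G).2 fun A => (e A).hom ≫ i A
    replace hj : ∀ A, (K A).map j = (e A).hom ≫ i A := congrFun hj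
    have hinj : ∀ A, Function.Injective (U.map ((K A).map j)).hom := fun A => by
      rw [hj, U.map_comp, ModuleCat.hom_comp, LinearMap.coe_comp]
      exact (hi A).comp (ConcreteCategory.bijective_of_isIso (U.map (e A).hom)).1
    have hran : ∀ A, LinearMap.range (U.map ((K A).map j)).hom = FamMod.component N A :=
      fun A => by
        rw [hj, U.map_comp, ModuleCat.hom_comp, LinearMap.range_comp, ← hr A,
          LinearMap.range_eq_top.2 (ConcreteCategory.bijective_of_isIso (U.map (e A).hom)).2,
          LinearMap.range_eq_map]
    exact ⟨Y', j, FamMod.map_injective hinj, FamMod.range_map hran⟩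
  have hq' : LiftsQuotients (famTotal U K) := by
    intro G N
    choose Y q hker using fun A => hq ((K A).obj G) (FamMod.component N A)
    obtain ⟨Y', e⟩ := hes Y
    replace e := fun A => (e A).some
    obtain ⟨j, hj⟩ := (hff G Y').2 fun A => q A ≫ (e A).inv
    replace hj : ∀ A, (K A).map j = q A ≫ (e A).inv := congrFun hj
    have hk : ∀ A, LinearMap.ker (U.map ((K A).map j)).hom = FamMod.component N A := fun A => by
      rw [hj, U.map_comp, ModuleCat.hom_comp, LinearMap.ker_comp, ← hker A,
        LinearMap.ker_eq_bot.2 (ConcreteCategory.bijective_of_isIso (U.map (e A).inv)).1]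
      rfl
    exact ⟨Y', j, FamMod.ker_map hk⟩
  rw [isSemisimpleObject_iff hs' hq' G]
  simp only [isSemisimpleObject_iff hs hq]
  exact FamMod.isSemisimpleModule_iff

/-- An object of `𝒜` is recovered as a component of a constant family, which requires an index. -/
theorem forall_isSemisimpleObject_iff [U.Full] [U.Faithful] [U.PreservesZeroMorphisms]
    (hs : LiftsSubmodules U) (hq : LiftsQuotients U) [∀ A, (K A).PreservesZeroMorphisms]
    (hff : ∀ G H : 𝒢, Function.Bijective fun (f : G ⟶ H) A => (K A).map f)
    (hes : ∀ F : I → 𝒜, ∃ G : 𝒢, ∀ A, Nonempty ((K A).obj G ≅ F A)) [Nonempty I] :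
    (∀ G : 𝒢, IsSemisimpleObject.{u} G) ↔ ∀ F : 𝒜, IsSemisimpleObject.{u} F := by
  constructor
  · intro h F
    obtain ⟨G, hG⟩ := hes fun _ => F
    obtain ⟨A⟩ := ‹Nonempty I›
    exact ((isSemisimpleObject_iff_forall hs hq hff hes G).1 (h G) A).of_iso (hG A).some
  · intro h G
    exact (isSemisimpleObject_iff_forall hs hq hff hes G).2 fun A => h _

end Families

/-! ### Graded functors -/

namespace GradedAb

variable {X : Type u}

/-- Degrees outside the image of `t` are sent to zero; injectivity of `t` makes the choice in the
other degrees unambiguous. -/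
theorem exists_hom (M : GradedAb X) {N : Type*} [AddCommGroup N] {t : X → X × X}
    (ht : Function.Injective t) (β : ∀ A, M.comp (t A) →+ N) :
    ∃ f : M.carrier →+ N, ∀ A (m : M.comp (t A)), f m = β A m := by
  classical
  have hγ : ∀ σ, ∃ γ : M.comp σ →+ N, ∀ A (h : t A = σ) (m : M.comp σ),
      γ m = β A ⟨m.1, h ▸ m.2⟩ := fun σ => by
    by_cases hσ : ∃ A, t A = σ
    · obtain ⟨A, rfl⟩ := hσ
      refine ⟨β A, fun B h m => ?_⟩
      obtain rfl := ht h
      rfl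
    · exact ⟨0, fun A h => absurd ⟨A, h⟩ hσ⟩
  choose γ hγ using hγ
  let e := AddEquiv.ofBijective _ M.isInternal
  refine ⟨(DirectSum.toAddMonoid γ).comp e.symm.toAddMonoidHom, fun A m => ?_⟩
  have h1 : e.symm m = DirectSum.of (fun σ => M.comp σ) (t A) m := by
    rw [AddEquiv.symm_apply_eq]
    exact (DirectSum.coeAddMonoidHom_of M.comp (t A) m).symm
  change DirectSum.toAddMonoid γ (e.symm m) = _
  rw [h1, DirectSum.toAddMonoid_of, hγ _ A rfl]

/-- The component of degree `σ` of the graded group whose component of degree `t A` is `M A`. -/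
def famComp (t : X → X × X) (M : X → Type u) [∀ A, AddCommGroup (M A)] (σ : X × X) :
    AddSubgroup (⨁ A, M A) where
  carrier := {m | ∀ B, t B ≠ σ → m B = 0}
  zero_mem' := fun _ _ => rfl
  add_mem' := fun {x y} hx hy B hB => by rw [DirectSum.add_apply, hx B hB, hy B hB, add_zero]
  neg_mem' := fun {x} hx B hB =>
    (map_neg (DFinsupp.evalAddMonoidHom (β := M) B) x).trans
      ((congrArg Neg.neg (hx B hB)).trans neg_zero)

open scoped Classical in
theorem famComp_isInternal {t : X → X × X} (M : X → Type u)
    [∀ A, AddCommGroup (M A)] : DirectSum.IsInternal (famComp t M) := by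
  constructor
  · rw [injective_iff_map_eq_zero]
    intro x hx
    -- The coordinate at `B` sees only the component of degree `t B`, so the components can be read
    -- off from their sum.
    have h1 : ∀ (y : ⨁ σ, famComp t M σ) (B : X),
        DirectSum.coeAddMonoidHom (famComp t M) y B = (y (t B)).1 B := fun y B => by
      induction y using DirectSum.induction_on with
      | zero => simp
      | of σ z =>
        rw [DirectSum.coeAddMonoidHom_of]
        by_cases h : t B = σ
        · subst h
          rw [DirectSum.of_eq_same]
        · rw [DirectSum.of_eq_of_ne _ _ _ h, z.2 B h]
          rfl
      | add y z hy hz =>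
        rw [map_add, DirectSum.add_apply, DirectSum.add_apply, hy, hz]
        rfl
    refine DFinsupp.ext fun σ => Subtype.ext (DFinsupp.ext fun B => ?_)
    by_cases h : t B = σ
    · subst h
      rw [← h1, hx]
      rfl
    · exact (x σ).2 B h
  · intro m
    induction m using DirectSum.induction_on with
    | zero => exact ⟨0, map_zero _⟩
    | of A m =>
      refine ⟨DirectSum.of (fun σ => famComp t M σ) (t A)
        ⟨DirectSum.of M A m, fun B hB => ?_⟩, ?_⟩
      · exact DirectSum.of_eq_of_ne _ _ _ fun h => hB (h ▸ rfl)
      · exact DirectSum.coeAddMonoidHom_of _ _ _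
    | add x y hx hy =>
      obtain ⟨x, rfl⟩ := hx
      obtain ⟨y, rfl⟩ := hy
      exact ⟨x + y, map_add _ _ _⟩

/-- The graded group whose component of degree `t A` is `M A`. -/
def ofFamily (t : X → X × X) (M : X → Type u) [∀ A, AddCommGroup (M A)] : GradedAb X where
  carrier := ⨁ A, M A
  comp := famComp t M
  isInternal := famComp_isInternal M

section OfFamily

variable {t : X → X × X} {M N : X → Type u}
  [∀ A, AddCommGroup (M A)] [∀ A, AddCommGroup (N A)]

/-- A coordinate of an element of the graded group of a family. -/
def famProj (A : X) : (ofFamily t M).carrier →+ M A := DFinsupp.evalAddMonoidHom (β := M) A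

theorem famProj_ext {x y : (ofFamily t M).carrier}
    (h : ∀ A, famProj A x = famProj A y) : x = y := DFinsupp.ext h

theorem comp_ofFamily_eq_bot {σ : X × X} (h : ∀ A, t A ≠ σ) : (ofFamily t M).comp σ = ⊥ :=
  (AddSubgroup.eq_bot_iff_forall _).2 fun _ hm =>
    famProj_ext fun A => (hm A (h A)).trans (map_zero (famProj A)).symm

/-- The component of degree `t A` of the graded group of a family. -/
def compEquiv (ht : Function.Injective t) (A : X) : (ofFamily t M).comp (t A) ≃+ M A :=
  AddEquiv.ofBijective ((famProj A).comp ((ofFamily t M).comp (t A)).subtype) <| by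
    classical
    constructor
    · rw [injective_iff_map_eq_zero]
      intro x hx
      refine Subtype.ext (famProj_ext fun B => ?_)
      refine Eq.trans ?_ (map_zero _).symm
      by_cases h : B = A
      · subst h
        exact hx
      · exact x.2 B fun h' => h (ht h')
    · intro m
      refine ⟨⟨DirectSum.of M A m, fun B hB => ?_⟩, ?_⟩
      · exact DirectSum.of_eq_of_ne (β := M) A B m fun h => hB (h ▸ rfl)
      · exact DirectSum.of_eq_same (β := M) A m

/-- A family of homomorphisms induces a homomorphism of the graded groups. -/
def famMap {t' : X → X × X} (f : ∀ A, M A →+ N A) :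
    (ofFamily t M).carrier →+ (ofFamily t' N).carrier :=
  DirectSum.map f

@[simp]
theorem famProj_famMap {t' : X → X × X} (f : ∀ A, M A →+ N A)
    (m : (ofFamily t M).carrier) (A : X) :
    famProj A (famMap (t' := t') f m) = f A (famProj A m) :=
  DirectSum.map_apply f A m

end OfFamily

end GradedAb

/-! ### Covariant graded functors as families of additive functors -/

namespace GrFun

variable {C : Type u} [SmallCategory C] [Preadditive C]

theorem map_mem (G : GrFun C) {X Y : C} (f : X ⟶ Y) {A : C} {m : (G.F.obj X).carrier}
    (hm : m ∈ (G.F.obj X).comp (X, A)) :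
    GrRight.toHom (G.F.map f) m ∈ (G.F.obj Y).comp (Y, A) :=
  (G.degree f (X, A) m hm).1 rfl

/-- The identity of `X` acts with degree `(X, X)`, hence kills all degrees whose first coordinate is
not `X`; but it acts as the identity. So the support of the value at `X` is forced into the degrees
`(X, A)`. -/
theorem comp_eq_bot (G : GrFun C) (X : C) {σ : C × C} (h : σ.1 ≠ X) :
    (G.F.obj X).comp σ = ⊥ := by
  rw [AddSubgroup.eq_bot_iff_forall]
  intro m hm
  have h1 := (G.degree (𝟙 X) σ m hm).2 (Ne.symm h)
  rw [G.F.map_id] at h1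
  exact h1

theorem toHom_map_id (G : GrFun C) (X : C) (m : (G.F.obj X).carrier) :
    GrRight.toHom (G.F.map (𝟙 X)) m = m := by
  rw [G.F.map_id]
  rfl

theorem toHom_map_comp (G : GrFun C) {X Y Z : C} (f : X ⟶ Y) (g : Y ⟶ Z)
    (m : (G.F.obj X).carrier) : GrRight.toHom (G.F.map (f ≫ g)) m =
      GrRight.toHom (G.F.map g) (GrRight.toHom (G.F.map f) m) := by
  rw [G.F.map_comp]
  rfl

theorem toHom_map_add (G : GrFun C) {X Y : C} (f g : X ⟶ Y)
    (m : (G.F.obj X).carrier) : GrRight.toHom (G.F.map (f + g)) m =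
      GrRight.toHom (G.F.map f) m + GrRight.toHom (G.F.map g) m := by
  have := G.additive
  rw [G.F.map_add]
  rfl

theorem toHom_naturality {G H : GrFun C} (α : G ⟶ H) {X Y : C} (f : X ⟶ Y)
    (m : (G.F.obj X).carrier) :
    GrRight.toHom (α.nat.app Y) (GrRight.toHom (G.F.map f) m) =
      GrRight.toHom (H.F.map f) (GrRight.toHom (α.nat.app X) m) :=
  DFunLike.congr_fun (congrArg GrRight.toHom (α.nat.naturality f)) m

/-- The values of the component of a graded functor. -/
def degreeFunctor (G : GrFun C) (A : C) : C ⥤ AddCommGrpCat.{u} where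
  obj X := AddCommGrpCat.of ((G.F.obj X).comp (X, A))
  map {X Y} f := AddCommGrpCat.ofHom
    (((GrRight.toHom (G.F.map f)).comp ((G.F.obj X).comp (X, A)).subtype).codRestrict
      ((G.F.obj Y).comp (Y, A)) fun m => G.map_mem f m.2)
  map_id X := by
    ext m
    exact toHom_map_id G X m.1
  map_comp f g := by
    ext m
    exact toHom_map_comp G f g m.1

instance (G : GrFun C) (A : C) : (G.degreeFunctor A).Additive :=
  ⟨fun {_ _ f g} => by
    ext m
    exact Subtype.ext (toHom_map_add G f g m.1)⟩

variable (C) in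
/-- The components of a graded functor. -/
def degreePart (A : C) : GrFun C ⥤ (C ⥤+ AddCommGrpCat.{u}) where
  obj G := AdditiveFunctor.of (G.degreeFunctor A)
  map {G H} α := ObjectProperty.homMk
    { app := fun X => AddCommGrpCat.ofHom
        (((GrRight.toHom (α.nat.app X)).comp ((G.F.obj X).comp (X, A)).subtype).codRestrict
          ((H.F.obj X).comp (X, A)) fun m => α.gr X _ _ m.2)
      naturality := fun X Y f => by
        ext m
        exact Subtype.ext (toHom_naturality α f m.1) }
  map_id _ := rfl
  map_comp _ _ := rfl

instance (A : C) : (degreePart C A).PreservesZeroMorphisms := ⟨fun _ _ => rfl⟩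

theorem prodMk_injective {C : Type*} (X : C) : Function.Injective fun A : C => (X, A) :=
  fun _ _ h => (Prod.ext_iff.1 h).2

theorem ext_of_comp {G : GrFun C} {X : C} {N : Type*} [AddCommGroup N]
    (f g : (G.F.obj X).carrier →+ N)
    (h : ∀ A, ∀ m ∈ (G.F.obj X).comp (X, A), f m = g m) : f = g := by
  refine GradedAb.ext_hom _ _ _ ?_
  rintro ⟨Y, A⟩ m hm
  by_cases hY : Y = X
  · subst hY
    exact h A m hm
  · rw [G.comp_eq_bot X hY] at hm
    obtain rfl := hm
    rw [map_zero, map_zero]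

/-- As the value at `X` lives in the degrees `(X, A)`, a transformation preserving degrees is a
family of transformations indexed by `A`. -/
theorem degreePart_bijective (G H : GrFun C) :
    Function.Bijective fun (f : G ⟶ H) A => (degreePart C A).map f := by
  constructor
  · intro f g h
    refine GrFun.Hom.ext (NatTrans.ext (funext fun X => Subtype.ext ?_))
    refine ext_of_comp _ _ fun A m hm => ?_
    have h1 := congrFun h A
    have h2 := ConcreteCategory.congr_hom (congrArg (fun l => l.hom.app X) h1) ⟨m, hm⟩
    exact congrArg Subtype.val h2
  · intro α
    choose β hβ using fun X => (G.F.obj X).exists_hom (prodMk_injective X)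
      fun A => ((H.F.obj X).comp (X, A)).subtype.comp ((α A).hom.app X).hom
    have hgr : ∀ X, GradedAb.IsGrHom (G.F.obj X).toGradedAb (H.F.obj X).toGradedAb (β X) := by
      rintro X ⟨Y, A⟩ m hm
      by_cases hY : Y = X
      · subst hY
        rw [hβ Y A ⟨m, hm⟩]
        exact (show (H.F.obj Y).comp (Y, A) from (α A).hom.app Y ⟨m, hm⟩).2
      · rw [G.comp_eq_bot X hY] at hm
        obtain rfl := hm
        rw [map_zero]
        exact zero_mem _
    -- Preservation of degrees together with the support condition makes `β X` homogeneous of degree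
    -- `(X, X)`, hence a morphism of `GrRight C`.
    have hmem : ∀ X, β X ∈ GradedAb.rightHOM (G.F.obj X).toGradedAb (H.F.obj X).toGradedAb := by
      intro X
      refine AddSubgroup.mem_iSup_of_mem (X, X) ?_
      rintro ⟨Y, A⟩ m hm
      refine ⟨?_, fun h => ?_⟩
      · rintro rfl
        exact hgr _ _ _ hm
      · rw [G.comp_eq_bot X (Ne.symm h)] at hm
        obtain rfl := hm
        exact map_zero _
    refine ⟨⟨{ app := fun X => ⟨β X, hmem X⟩, naturality := fun X Y f => Subtype.ext ?_ },
      hgr⟩, ?_⟩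
    · refine ext_of_comp _ _ fun A m hm => ?_
      change β Y (GrRight.toHom (G.F.map f) m) = GrRight.toHom (H.F.map f) (β X m)
      rw [hβ X A ⟨m, hm⟩, hβ Y A ⟨_, G.map_mem f hm⟩]
      exact congrArg Subtype.val (ConcreteCategory.congr_hom ((α A).hom.naturality f) ⟨m, hm⟩)
    · funext A
      ext X m
      exact Subtype.ext (hβ X A m)

/-- The value of the graded functor with given components. -/
def ofFamilyObj (F : C → C ⥤+ AddCommGrpCat.{u}) (X : C) : GrRight C :=
  { GradedAb.ofFamily (fun A => (X, A)) (fun A => (F A).obj.obj X) with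
    supp := ⟨X, fun _ h => GradedAb.comp_ofFamily_eq_bot fun _ h' => h (h' ▸ rfl)⟩ }

/-- The components of the values of the graded functor with given components. -/
def objProj (F : C → C ⥤+ AddCommGrpCat.{u}) (X A : C) :
    (ofFamilyObj F X).carrier →+ (F A).obj.obj X :=
  GradedAb.famProj (t := fun A => (X, A)) (M := fun A => (F A).obj.obj X) A

theorem objProj_ext {F : C → C ⥤+ AddCommGrpCat.{u}} {X : C} {x y : (ofFamilyObj F X).carrier}
    (h : ∀ A, objProj F X A x = objProj F X A y) : x = y :=
  GradedAb.famProj_ext h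

theorem mem_comp_ofFamilyObj {F : C → C ⥤+ AddCommGrpCat.{u}} {X : C} {σ : C × C}
    {m : (ofFamilyObj F X).carrier} :
    m ∈ (ofFamilyObj F X).comp σ ↔ ∀ B, (X, B) ≠ σ → objProj F X B m = 0 := Iff.rfl

/-- The action of a morphism on the graded functor with given components. -/
def ofFamilyMap (F : C → C ⥤+ AddCommGrpCat.{u}) {X Y : C} (f : X ⟶ Y) :
    (ofFamilyObj F X).carrier →+ (ofFamilyObj F Y).carrier :=
  GradedAb.famMap (t := fun A => (X, A)) (t' := fun A => (Y, A))
    fun A => ((F A).obj.map f).hom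

@[simp]
theorem objProj_ofFamilyMap (F : C → C ⥤+ AddCommGrpCat.{u}) {X Y : C} (f : X ⟶ Y) (A : C)
    (m : (ofFamilyObj F X).carrier) :
    objProj F Y A (ofFamilyMap F f m) = (F A).obj.map f (objProj F X A m) :=
  GradedAb.famProj_famMap (t := fun A => (X, A)) (t' := fun A => (Y, A))
    (fun A => ((F A).obj.map f).hom) m A

theorem ofFamilyMap_mem (F : C → C ⥤+ AddCommGrpCat.{u}) {X Y : C} (f : X ⟶ Y) :
    ofFamilyMap F f ∈ GradedAb.rightHom (ofFamilyObj F X).toGradedAb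
      (ofFamilyObj F Y).toGradedAb (Y, X) := by
  rintro ⟨X', A⟩ m hm
  rw [mem_comp_ofFamilyObj] at hm
  refine ⟨?_, fun h => objProj_ext fun B => ?_⟩
  · rintro rfl
    refine mem_comp_ofFamilyObj.2 fun B hB => ?_
    rw [objProj_ofFamilyMap, hm B fun h => hB (Prod.ext rfl (Prod.ext_iff.1 h).2), map_zero]
  · rw [objProj_ofFamilyMap, hm B fun h' => h (Prod.ext_iff.1 h').1, map_zero, map_zero]

/-- The graded functor with given components. -/
def ofFamily (F : C → C ⥤+ AddCommGrpCat.{u}) : GrFun C where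
  F :=
    { obj := ofFamilyObj F
      map := fun {X Y} f => ⟨ofFamilyMap F f, AddSubgroup.mem_iSup_of_mem _ (ofFamilyMap_mem F f)⟩
      map_id := fun X => Subtype.ext <| AddMonoidHom.ext fun m => objProj_ext fun A => by
        refine (objProj_ofFamilyMap F _ A m).trans ?_
        rw [(F A).obj.map_id]
        rfl
      map_comp := fun f g => Subtype.ext <| AddMonoidHom.ext fun m =>
        objProj_ext fun A => by
          refine (objProj_ofFamilyMap F _ A m).trans ?_
          rw [(F A).obj.map_comp]
          refine Eq.trans ?_ (objProj_ofFamilyMap F g A (ofFamilyMap F f m)).symm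
          exact congrArg ((F A).obj.map g) (objProj_ofFamilyMap F f A m).symm }
  additive := ⟨fun {X Y f g} => Subtype.ext <| AddMonoidHom.ext fun m =>
    objProj_ext fun A => by
      refine (objProj_ofFamilyMap F _ A m).trans ?_
      rw [(F A).obj.map_add]
      refine Eq.trans ?_ (map_add (objProj F Y A) (ofFamilyMap F f m) (ofFamilyMap F g m)).symm
      rw [objProj_ofFamilyMap, objProj_ofFamilyMap]
      rfl⟩
  degree f := ofFamilyMap_mem F f

theorem exists_degreePart_iso (F : C → C ⥤+ AddCommGrpCat.{u}) :
    ∃ G : GrFun C, ∀ A, Nonempty ((degreePart C A).obj G ≅ F A) := by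
  refine ⟨ofFamily F, fun A => ⟨ObjectProperty.isoMk _ (NatIso.ofComponents
    (fun X => AddEquiv.toAddCommGrpIso (X := AddCommGrpCat.of ((ofFamilyObj F X).comp (X, A)))
      (GradedAb.compEquiv (M := fun A => (F A).obj.obj X) (prodMk_injective X) A))
    fun {X Y} f => ?_)⟩⟩
  ext m
  exact objProj_ofFamilyMap F f A m.1

theorem forall_isSemisimpleObject_iff_additiveFunctor :
    (∀ F : GrFun C, IsSemisimpleObject.{u} F) ↔
      ∀ F : C ⥤+ AddCommGrpCat.{u}, IsSemisimpleObject.{u} F := by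
  -- Without objects there is no component from which to recover a functor; both sides then hold,
  -- there being no representable functor and no component to test.
  rcases isEmpty_or_nonempty C with h | h
  · refine iff_of_true (fun G => ?_) (isSemisimpleObject_of_homFrom fun A => isEmptyElim A)
    exact (isSemisimpleObject_iff_forall (K := degreePart C) total_liftsSubmodules
      total_liftsQuotients degreePart_bijective exists_degreePart_iso G).2 fun A => isEmptyElim A
  · exact forall_isSemisimpleObject_iff (K := degreePart C) total_liftsSubmodules
      total_liftsQuotients degreePart_bijective exists_degreePart_iso

end GrFun

/-! ### Contravariant graded functors as families of additive functors -/

namespace GrFunOp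

variable {C : Type u} [SmallCategory C] [Preadditive C]

theorem map_mem (G : GrFunOp C) {X Y : Cᵒᵖ} (f : X ⟶ Y) {A : C} {m : (G.F.obj X).carrier}
    (hm : m ∈ (G.F.obj X).comp (A, X.unop)) :
    GrLeft.toHom (G.F.map f) m ∈ (G.F.obj Y).comp (A, Y.unop) :=
  (G.degree f.unop (A, X.unop) m hm).1 rfl

theorem comp_eq_bot (G : GrFunOp C) (X : Cᵒᵖ) {σ : C × C} (h : σ.2 ≠ X.unop) :
    (G.F.obj X).comp σ = ⊥ := by
  rw [AddSubgroup.eq_bot_iff_forall]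
  intro m hm
  have h1 := (G.degree (𝟙 X.unop) σ m hm).2 h
  rw [op_id, G.F.map_id] at h1
  exact h1

theorem toHom_map_id (G : GrFunOp C) (X : Cᵒᵖ) (m : (G.F.obj X).carrier) :
    GrLeft.toHom (G.F.map (𝟙 X)) m = m := by
  rw [G.F.map_id]
  rfl

theorem toHom_map_comp (G : GrFunOp C) {X Y Z : Cᵒᵖ} (f : X ⟶ Y) (g : Y ⟶ Z)
    (m : (G.F.obj X).carrier) : GrLeft.toHom (G.F.map (f ≫ g)) m =
      GrLeft.toHom (G.F.map g) (GrLeft.toHom (G.F.map f) m) := by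
  rw [G.F.map_comp]
  rfl

theorem toHom_map_add (G : GrFunOp C) {X Y : Cᵒᵖ} (f g : X ⟶ Y)
    (m : (G.F.obj X).carrier) : GrLeft.toHom (G.F.map (f + g)) m =
      GrLeft.toHom (G.F.map f) m + GrLeft.toHom (G.F.map g) m := by
  have := G.additive
  rw [G.F.map_add]
  rfl

theorem toHom_naturality {G H : GrFunOp C} (α : G ⟶ H) {X Y : Cᵒᵖ} (f : X ⟶ Y)
    (m : (G.F.obj X).carrier) :
    GrLeft.toHom (α.nat.app Y) (GrLeft.toHom (G.F.map f) m) =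
      GrLeft.toHom (H.F.map f) (GrLeft.toHom (α.nat.app X) m) :=
  DFunLike.congr_fun (congrArg GrLeft.toHom (α.nat.naturality f)) m

/-- The values of the component of a graded functor. -/
def degreeFunctor (G : GrFunOp C) (A : C) : Cᵒᵖ ⥤ AddCommGrpCat.{u} where
  obj X := AddCommGrpCat.of ((G.F.obj X).comp (A, X.unop))
  map {X Y} f := AddCommGrpCat.ofHom
    (((GrLeft.toHom (G.F.map f)).comp ((G.F.obj X).comp (A, X.unop)).subtype).codRestrict
      ((G.F.obj Y).comp (A, Y.unop)) fun m => G.map_mem f m.2)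
  map_id X := by
    ext m
    exact toHom_map_id G X m.1
  map_comp f g := by
    ext m
    exact toHom_map_comp G f g m.1

instance (G : GrFunOp C) (A : C) : (G.degreeFunctor A).Additive :=
  ⟨fun {_ _ f g} => by
    ext m
    exact Subtype.ext (toHom_map_add G f g m.1)⟩

variable (C) in
/-- The components of a graded functor. -/
def degreePart (A : C) : GrFunOp C ⥤ (Cᵒᵖ ⥤+ AddCommGrpCat.{u}) where
  obj G := AdditiveFunctor.of (G.degreeFunctor A)
  map {G H} α := ObjectProperty.homMk
    { app := fun X => AddCommGrpCat.ofHom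
        (((GrLeft.toHom (α.nat.app X)).comp ((G.F.obj X).comp (A, X.unop)).subtype).codRestrict
          ((H.F.obj X).comp (A, X.unop)) fun m => α.gr X _ _ m.2)
      naturality := fun X Y f => by
        ext m
        exact Subtype.ext (toHom_naturality α f m.1) }
  map_id _ := rfl
  map_comp _ _ := rfl

instance (A : C) : (degreePart C A).PreservesZeroMorphisms := ⟨fun _ _ => rfl⟩

theorem mkProd_injective {C : Type*} (X : C) : Function.Injective fun A : C => (A, X) :=
  fun _ _ h => (Prod.ext_iff.1 h).1

theorem ext_of_comp {G : GrFunOp C} {X : Cᵒᵖ} {N : Type*} [AddCommGroup N]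
    (f g : (G.F.obj X).carrier →+ N)
    (h : ∀ A, ∀ m ∈ (G.F.obj X).comp (A, X.unop), f m = g m) : f = g := by
  refine GradedAb.ext_hom _ _ _ ?_
  rintro ⟨A, Y⟩ m hm
  by_cases hY : Y = X.unop
  · subst hY
    exact h A m hm
  · rw [G.comp_eq_bot X hY] at hm
    obtain rfl := hm
    rw [map_zero, map_zero]

/-- The fixed coordinate of the degree is now the second one: the value at `X` lives in the degrees
`(A, X.unop)`, and the first coordinate indexes the family. -/
theorem degreePart_bijective (G H : GrFunOp C) :
    Function.Bijective fun (f : G ⟶ H) A => (degreePart C A).map f := by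
  constructor
  · intro f g h
    refine GrFunOp.Hom.ext (NatTrans.ext (funext fun X => Subtype.ext ?_))
    refine ext_of_comp _ _ fun A m hm => ?_
    have h1 := congrFun h A
    have h2 := ConcreteCategory.congr_hom (congrArg (fun l => l.hom.app X) h1) ⟨m, hm⟩
    exact congrArg Subtype.val h2
  · intro α
    choose β hβ using fun X => (G.F.obj X).exists_hom (mkProd_injective X.unop)
      fun A => ((H.F.obj X).comp (A, X.unop)).subtype.comp ((α A).hom.app X).hom
    have hgr : ∀ X, GradedAb.IsGrHom (G.F.obj X).toGradedAb (H.F.obj X).toGradedAb (β X) := by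
      rintro X ⟨A, Y⟩ m hm
      by_cases hY : Y = X.unop
      · subst hY
        rw [hβ X A ⟨m, hm⟩]
        exact (show (H.F.obj X).comp (A, X.unop) from (α A).hom.app X ⟨m, hm⟩).2
      · rw [G.comp_eq_bot X hY] at hm
        obtain rfl := hm
        rw [map_zero]
        exact zero_mem _
    have hmem : ∀ X, β X ∈ GradedAb.leftHOM (G.F.obj X).toGradedAb (H.F.obj X).toGradedAb := by
      intro X
      refine AddSubgroup.mem_iSup_of_mem (X.unop, X.unop) ?_
      rintro ⟨A, Y⟩ m hm
      refine ⟨?_, fun h => ?_⟩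
      · rintro rfl
        exact hgr _ _ _ hm
      · rw [G.comp_eq_bot X h] at hm
        obtain rfl := hm
        exact map_zero _
    refine ⟨⟨{ app := fun X => ⟨β X, hmem X⟩, naturality := fun X Y f => Subtype.ext ?_ },
      hgr⟩, ?_⟩
    · refine ext_of_comp _ _ fun A m hm => ?_
      change β Y (GrLeft.toHom (G.F.map f) m) = GrLeft.toHom (H.F.map f) (β X m)
      rw [hβ X A ⟨m, hm⟩, hβ Y A ⟨_, G.map_mem f hm⟩]
      exact congrArg Subtype.val (ConcreteCategory.congr_hom ((α A).hom.naturality f) ⟨m, hm⟩)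
    · funext A
      ext X m
      exact Subtype.ext (hβ X A m)

/-- The value of the graded functor with given components. -/
def ofFamilyObj (F : C → Cᵒᵖ ⥤+ AddCommGrpCat.{u}) (X : Cᵒᵖ) : GrLeft C :=
  { GradedAb.ofFamily (fun A => (A, X.unop)) (fun A => (F A).obj.obj X) with
    supp := ⟨X.unop, fun _ h => GradedAb.comp_ofFamily_eq_bot fun _ h' => h (h' ▸ rfl)⟩ }

/-- The components of the values of the graded functor with given components. -/
def objProj (F : C → Cᵒᵖ ⥤+ AddCommGrpCat.{u}) (X : Cᵒᵖ) (A : C) :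
    (ofFamilyObj F X).carrier →+ (F A).obj.obj X :=
  GradedAb.famProj (t := fun A => (A, X.unop)) (M := fun A => (F A).obj.obj X) A

theorem objProj_ext {F : C → Cᵒᵖ ⥤+ AddCommGrpCat.{u}} {X : Cᵒᵖ} {x y : (ofFamilyObj F X).carrier}
    (h : ∀ A, objProj F X A x = objProj F X A y) : x = y :=
  GradedAb.famProj_ext h

theorem mem_comp_ofFamilyObj {F : C → Cᵒᵖ ⥤+ AddCommGrpCat.{u}} {X : Cᵒᵖ} {σ : C × C}
    {m : (ofFamilyObj F X).carrier} :
    m ∈ (ofFamilyObj F X).comp σ ↔ ∀ B, (B, X.unop) ≠ σ → objProj F X B m = 0 := Iff.rfl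

/-- The action of a morphism on the graded functor with given components. -/
def ofFamilyMap (F : C → Cᵒᵖ ⥤+ AddCommGrpCat.{u}) {X Y : Cᵒᵖ} (f : X ⟶ Y) :
    (ofFamilyObj F X).carrier →+ (ofFamilyObj F Y).carrier :=
  GradedAb.famMap (t := fun A => (A, X.unop)) (t' := fun A => (A, Y.unop))
    fun A => ((F A).obj.map f).hom

@[simp]
theorem objProj_ofFamilyMap (F : C → Cᵒᵖ ⥤+ AddCommGrpCat.{u}) {X Y : Cᵒᵖ} (f : X ⟶ Y) (A : C)
    (m : (ofFamilyObj F X).carrier) :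
    objProj F Y A (ofFamilyMap F f m) = (F A).obj.map f (objProj F X A m) :=
  GradedAb.famProj_famMap (t := fun A => (A, X.unop)) (t' := fun A => (A, Y.unop))
    (fun A => ((F A).obj.map f).hom) m A

theorem ofFamilyMap_mem (F : C → Cᵒᵖ ⥤+ AddCommGrpCat.{u}) {X Y : Cᵒᵖ} (f : X ⟶ Y) :
    ofFamilyMap F f ∈ GradedAb.leftHom (ofFamilyObj F X).toGradedAb
      (ofFamilyObj F Y).toGradedAb (X.unop, Y.unop) := by
  rintro ⟨A, X'⟩ m hm
  rw [mem_comp_ofFamilyObj] at hm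
  refine ⟨?_, fun h => objProj_ext fun B => ?_⟩
  · rintro rfl
    refine mem_comp_ofFamilyObj.2 fun B hB => ?_
    rw [objProj_ofFamilyMap, hm B fun h => hB (Prod.ext (Prod.ext_iff.1 h).1 rfl), map_zero]
  · rw [objProj_ofFamilyMap, hm B fun h' => h (Prod.ext_iff.1 h').2.symm, map_zero, map_zero]

/-- The graded functor with given components. -/
def ofFamily (F : C → Cᵒᵖ ⥤+ AddCommGrpCat.{u}) : GrFunOp C where
  F :=
    { obj := ofFamilyObj F
      map := fun {X Y} f => ⟨ofFamilyMap F f, AddSubgroup.mem_iSup_of_mem _ (ofFamilyMap_mem F f)⟩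
      map_id := fun X => Subtype.ext <| AddMonoidHom.ext fun m => objProj_ext fun A => by
        refine (objProj_ofFamilyMap F _ A m).trans ?_
        rw [(F A).obj.map_id]
        rfl
      map_comp := fun f g => Subtype.ext <| AddMonoidHom.ext fun m =>
        objProj_ext fun A => by
          refine (objProj_ofFamilyMap F _ A m).trans ?_
          rw [(F A).obj.map_comp]
          refine Eq.trans ?_ (objProj_ofFamilyMap F g A (ofFamilyMap F f m)).symm
          exact congrArg ((F A).obj.map g) (objProj_ofFamilyMap F f A m).symm }
  additive := ⟨fun {X Y f g} => Subtype.ext <| AddMonoidHom.ext fun m =>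
    objProj_ext fun A => by
      refine (objProj_ofFamilyMap F _ A m).trans ?_
      rw [(F A).obj.map_add]
      refine Eq.trans ?_ (map_add (objProj F Y A) (ofFamilyMap F f m) (ofFamilyMap F g m)).symm
      rw [objProj_ofFamilyMap, objProj_ofFamilyMap]
      rfl⟩
  degree f := ofFamilyMap_mem F f.op

theorem exists_degreePart_iso (F : C → Cᵒᵖ ⥤+ AddCommGrpCat.{u}) :
    ∃ G : GrFunOp C, ∀ A, Nonempty ((degreePart C A).obj G ≅ F A) := by
  refine ⟨ofFamily F, fun A => ⟨ObjectProperty.isoMk _ (NatIso.ofComponents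
    (fun X => AddEquiv.toAddCommGrpIso (X := AddCommGrpCat.of ((ofFamilyObj F X).comp (A, X.unop)))
      (GradedAb.compEquiv (M := fun A => (F A).obj.obj X) (mkProd_injective X.unop) A))
    fun {X Y} f => ?_)⟩⟩
  ext m
  exact objProj_ofFamilyMap F f A m.1

theorem forall_isSemisimpleObject_iff_additiveFunctor :
    (∀ F : GrFunOp C, IsSemisimpleObject.{u} F) ↔
      ∀ F : Cᵒᵖ ⥤+ AddCommGrpCat.{u}, IsSemisimpleObject.{u} F := by
  rcases isEmpty_or_nonempty C with h | h
  · refine iff_of_true (fun G => ?_) (isSemisimpleObject_of_homFrom fun A => isEmptyElim A.unop)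
    exact (isSemisimpleObject_iff_forall (K := degreePart C) total_liftsSubmodules
      total_liftsQuotients degreePart_bijective exists_degreePart_iso G).2 fun A => isEmptyElim A
  · exact forall_isSemisimpleObject_iff (K := degreePart C) total_liftsSubmodules
      total_liftsQuotients degreePart_bijective exists_degreePart_iso

end GrFunOp

/-! ### Matrices and linear maps over a division ring -/

section LinearCategories

open MulOpposite (op unop)

/-- The matrix of a linear map of right vector spaces. -/
def matHom {D V W : Type*} [DivisionRing D] [AddCommGroup V] [AddCommGroup W] [Module Dᵐᵒᵖ V]
    [Module Dᵐᵒᵖ W] {n m : ℕ} (b : Module.Basis (Fin n) Dᵐᵒᵖ V) (c : Module.Basis (Fin m) Dᵐᵒᵖ W) :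
    (V →ₗ[Dᵐᵒᵖ] W) →+ Matrix (Fin m) (Fin n) D where
  toFun f := Matrix.of fun l k => unop (c.repr (f (b k)) l)
  map_zero' := by ext; simp
  map_add' f g := by ext; simp

theorem matHom_apply {D V W : Type*} [DivisionRing D] [AddCommGroup V] [AddCommGroup W]
    [Module Dᵐᵒᵖ V] [Module Dᵐᵒᵖ W] {n m : ℕ} (b : Module.Basis (Fin n) Dᵐᵒᵖ V)
    (c : Module.Basis (Fin m) Dᵐᵒᵖ W) (f : V →ₗ[Dᵐᵒᵖ] W) (l : Fin m) (k : Fin n) :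
    matHom b c f l k = unop (c.repr (f (b k)) l) := rfl

/-- Linear maps of right vector spaces correspond to matrices. -/
def matEquiv {D V W : Type*} [DivisionRing D] [AddCommGroup V] [AddCommGroup W] [Module Dᵐᵒᵖ V]
    [Module Dᵐᵒᵖ W] {n m : ℕ} (b : Module.Basis (Fin n) Dᵐᵒᵖ V) (c : Module.Basis (Fin m) Dᵐᵒᵖ W) :
    (V →ₗ[Dᵐᵒᵖ] W) ≃+ Matrix (Fin m) (Fin n) D :=
  AddEquiv.ofBijective (matHom b c) ⟨fun f g h => by
    refine b.ext fun k => c.repr.injective (Finsupp.ext fun l => MulOpposite.unop_injective ?_)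
    rw [← matHom_apply, ← matHom_apply, h], fun M => by
    refine ⟨b.constr ℕ fun k => c.equivFun.symm fun l => op (M l k), ?_⟩
    ext l k
    rw [matHom_apply, b.constr_basis, ← c.equivFun_apply, LinearEquiv.apply_symm_apply]
    rfl⟩

/-- Right vector spaces are modules over `Dᵐᵒᵖ`; after `unop` the entries multiply in the order of
`D`, which gives the product of matrices without reversal. -/
theorem matEquiv_comp {D V W X : Type*} [DivisionRing D] [AddCommGroup V] [AddCommGroup W]
    [AddCommGroup X] [Module Dᵐᵒᵖ V] [Module Dᵐᵒᵖ W] [Module Dᵐᵒᵖ X] {n m p : ℕ}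
    (b : Module.Basis (Fin n) Dᵐᵒᵖ V) (c : Module.Basis (Fin m) Dᵐᵒᵖ W)
    (d : Module.Basis (Fin p) Dᵐᵒᵖ X) (g : W →ₗ[Dᵐᵒᵖ] X) (f : V →ₗ[Dᵐᵒᵖ] W) :
    matEquiv b d (g ∘ₗ f) = matEquiv c d g * matEquiv b c f := by
  ext l k
  change unop (d.repr (g (f (b k))) l) =
    ∑ i, unop (d.repr (g (c i)) l) * unop (c.repr (f (b k)) i)
  conv_lhs => rw [← c.sum_repr (f (b k))]
  rw [map_sum, map_sum, Finsupp.finsetSum_apply, Finset.unop_sum]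
  refine Finset.sum_congr rfl fun i _ => ?_
  rw [map_smul, map_smul]
  rfl

/-- The morphism groups of `C` are products of groups of linear maps of finite dimensional right
vector spaces over division rings. -/
def IsLinearCategory (C : Type u) [SmallCategory C] [Preadditive C] : Prop :=
  ∃ (J : Type u) (D : J → Type u) (_ : ∀ j, DivisionRing (D j)) (V : C → J → Type u)
    (_ : ∀ A j, AddCommGroup (V A j)) (_ : ∀ A j, Module (D j)ᵐᵒᵖ (V A j)),
    (∀ A j, Module.Finite (D j)ᵐᵒᵖ (V A j)) ∧ (∀ A : C, {j | Nontrivial (V A j)}.Finite) ∧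
    ∃ φ : ∀ A B : C, (A ⟶ B) ≃+ (∀ j, V A j →ₗ[(D j)ᵐᵒᵖ] V B j),
      ∀ (A X B : C) (f : X ⟶ B) (g : A ⟶ X) (j : J), φ A B (g ≫ f) j = φ X B f j ∘ₗ φ A X g j

variable {C : Type u} [SmallCategory C] [Preadditive C]

theorem IsLinearCategory.isMatrixCategory (h : IsLinearCategory C) : IsMatrixCategory C := by
  obtain ⟨J, D, _, V, _, _, hfin, hn, φ, hφ⟩ := h
  let b := fun A j => Module.finBasis (D j)ᵐᵒᵖ (V A j)
  refine ⟨J, D, inferInstance, fun j A => Module.finrank (D j)ᵐᵒᵖ (V A j),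
    fun A => (hn A).subset fun j hj => Module.nontrivial_of_finrank_pos (Nat.pos_of_ne_zero hj),
    fun A B => (φ A B).trans (AddEquiv.piCongrRight fun j => matEquiv (b A j) (b B j)),
    fun A X B f g j => ?_⟩
  change matEquiv (b A j) (b B j) (φ A B (g ≫ f) j) = _
  rw [hφ, matEquiv_comp (b A j) (b X j) (b B j)]
  rfl

theorem IsMatrixCategory.isLinearCategory (h : IsMatrixCategory C) : IsLinearCategory C := by
  obtain ⟨J, D, _, n, hn, φ, hφ⟩ := h
  let b : ∀ A j, Module.Basis (Fin (n j A)) (D j)ᵐᵒᵖ (Fin (n j A) → (D j)ᵐᵒᵖ) :=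
    fun A j => Pi.basisFun _ _
  refine ⟨J, D, inferInstance, fun A j => Fin (n j A) → (D j)ᵐᵒᵖ, inferInstance, inferInstance,
    inferInstance, fun A => (hn A).subset fun j hj => ?_,
    fun A B => (φ A B).trans (AddEquiv.piCongrRight fun j => (matEquiv (b A j) (b B j)).symm),
    fun A X B f g j => ?_⟩
  · intro h0
    obtain ⟨x, y, hxy⟩ := hj
    exact hxy (funext fun k => (Fin.cast h0 k).elim0)
  · change (matEquiv (b A j) (b B j)).symm (φ A B (g ≫ f) j) =
      (matEquiv (b X j) (b B j)).symm (φ X B f j) ∘ₗ (matEquiv (b A j) (b X j)).symm (φ A X g j)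
    rw [AddEquiv.symm_apply_eq, matEquiv_comp (b A j) (b X j) (b B j), hφ,
      AddEquiv.apply_symm_apply, AddEquiv.apply_symm_apply]

end LinearCategories

/-! ### Realization of categories of linear maps by modules -/

section Realization

/-- A finitely generated right module over a possibly nonunital ring, without ambient set, in which
every element is fixed by an element of the ring. -/
structure RMod (R : Type u) [NonUnitalRing R] where
  V : Type u
  [grp : AddCommGroup V]
  /-- the right action -/
  act : V →+ R →+ V
  act_mul : ∀ m r s, act m (r * s) = act (act m r) s
  unital : ∀ m, ∃ r, act m r = m
  fg : ∃ s : Finset V, ∀ N : AddSubgroup V, (∀ m ∈ s, m ∈ N) →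
    (∀ m ∈ N, ∀ r, act m r ∈ N) → N = ⊤

attribute [instance] RMod.grp

namespace RMod

variable {R : Type u} [NonUnitalRing R] {U : Type u}

/-- The group structure transported to the image of an injection. -/
abbrev rangeGroup (M : RMod R) (i : M.V → U) (hi : Function.Injective i) :
    AddCommGroup (Set.range i) := (Equiv.ofInjective i hi).symm.addCommGroup

/-- The bijection onto the image of an injection as an isomorphism of groups. -/
def rangeEquiv (M : RMod R) (i : M.V → U) (hi : Function.Injective i) :
    letI := M.rangeGroup i hi
    Set.range i ≃+ M.V :=
  letI := M.rangeGroup i hi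
  (Equiv.ofInjective i hi).symm.addEquiv

/-- The module whose underlying set is the image of an injection. -/
def embed (M : RMod R) (i : M.V → U) (hi : Function.Injective i) : FGMod R U :=
  letI := M.rangeGroup i hi
  { carrier := Set.range i
    grp := M.rangeGroup i hi
    act := ((AddMonoidHom.compHom (M.rangeEquiv i hi).symm.toAddMonoidHom).comp M.act).comp
      (M.rangeEquiv i hi).toAddMonoidHom
    act_mul := fun m r s => by
      change (M.rangeEquiv i hi).symm (M.act (M.rangeEquiv i hi m) (r * s)) =
        (M.rangeEquiv i hi).symm (M.act (M.rangeEquiv i hi ((M.rangeEquiv i hi).symm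
          (M.act (M.rangeEquiv i hi m) r))) s)
      rw [AddEquiv.apply_symm_apply, M.act_mul]
    unital := by
      rw [eq_top_iff]
      rintro m -
      obtain ⟨r, hr⟩ := M.unital (M.rangeEquiv i hi m)
      refine AddSubgroup.subset_closure ⟨m, r, ?_⟩
      change (M.rangeEquiv i hi).symm (M.act (M.rangeEquiv i hi m) r) = m
      rw [hr, AddEquiv.symm_apply_apply]
    fg := by
      obtain ⟨s, hs⟩ := M.fg
      refine ⟨s.map (M.rangeEquiv i hi).symm.toEquiv.toEmbedding, fun N h1 h2 => ?_⟩
      have := hs (N.comap (M.rangeEquiv i hi).symm.toAddMonoidHom)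
        (fun m hm => h1 _ (Finset.mem_map_of_mem _ hm)) fun m hm r => by
          have := h2 _ hm r
          change (M.rangeEquiv i hi).symm (M.act (M.rangeEquiv i hi ((M.rangeEquiv i hi).symm m)) r)
            ∈ N at this
          rwa [AddEquiv.apply_symm_apply] at this
      rw [eq_top_iff]
      rintro m -
      have hm : M.rangeEquiv i hi m ∈ N.comap (M.rangeEquiv i hi).symm.toAddMonoidHom :=
        this ▸ AddSubgroup.mem_top _
      change (M.rangeEquiv i hi).symm (M.rangeEquiv i hi m) ∈ N at hm
      rwa [AddEquiv.symm_apply_apply] at hm }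

/-- The isomorphism of an embedded module with the original one. -/
def embedEquiv (M : RMod R) (i : M.V → U) (hi : Function.Injective i) :
    (M.embed i hi).carrier ≃+ M.V :=
  letI := M.rangeGroup i hi
  M.rangeEquiv i hi

theorem embed_act (M : RMod R) (i : M.V → U) (hi : Function.Injective i)
    (m : (M.embed i hi).carrier) (r : R) :
    M.embedEquiv i hi ((M.embed i hi).act m r) = M.act (M.embedEquiv i hi m) r :=
  letI := M.rangeGroup i hi
  (M.rangeEquiv i hi).apply_symm_apply _

/-- The group of homomorphisms of right modules. -/
def homs (M N : RMod R) : AddSubgroup (M.V →+ N.V) where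
  carrier := {f | ∀ m r, f (M.act m r) = N.act (f m) r}
  zero_mem' m r := by simp
  add_mem' hf hg m r := by
    rw [AddMonoidHom.add_apply, hf m r, hg m r, AddMonoidHom.add_apply, map_add,
      AddMonoidHom.add_apply]
  neg_mem' hf m r := by
    rw [AddMonoidHom.neg_apply, hf m r, AddMonoidHom.neg_apply, map_neg, AddMonoidHom.neg_apply]

/-- The homomorphisms of embedded modules are those of the original ones. -/
def embedHom (M N : RMod R) (i : M.V → U) (hi : Function.Injective i) (k : N.V → U)
    (hk : Function.Injective k) : M.homs N ≃+ (M.embed i hi ⟶ N.embed k hk) where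
  toFun f := ⟨((N.embedEquiv k hk).symm.toAddMonoidHom.comp f.1).comp
    (M.embedEquiv i hi).toAddMonoidHom, fun m r => by
      change (N.embedEquiv k hk).symm (f.1 (M.embedEquiv i hi ((M.embed i hi).act m r))) =
        (N.embed k hk).act ((N.embedEquiv k hk).symm (f.1 (M.embedEquiv i hi m))) r
      rw [AddEquiv.symm_apply_eq, embed_act, embed_act, AddEquiv.apply_symm_apply, f.2]⟩
  invFun g := ⟨((N.embedEquiv k hk).toAddMonoidHom.comp g.1).comp
    (M.embedEquiv i hi).symm.toAddMonoidHom, fun m r => by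
      change N.embedEquiv k hk (g.1 ((M.embedEquiv i hi).symm (M.act m r))) =
        N.act (N.embedEquiv k hk (g.1 ((M.embedEquiv i hi).symm m))) r
      rw [← embed_act, ← g.2]
      congr 2
      rw [AddEquiv.symm_apply_eq, embed_act, AddEquiv.apply_symm_apply]⟩
  left_inv f := Subtype.ext <| AddMonoidHom.ext fun m => by
    change N.embedEquiv k hk ((N.embedEquiv k hk).symm (f.1 (M.embedEquiv i hi
      ((M.embedEquiv i hi).symm m)))) = f.1 m
    rw [AddEquiv.apply_symm_apply, AddEquiv.apply_symm_apply]
  right_inv g := Subtype.ext <| AddMonoidHom.ext fun m => by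
    change (N.embedEquiv k hk).symm (N.embedEquiv k hk (g.1 ((M.embedEquiv i hi).symm
      (M.embedEquiv i hi m)))) = g.1 m
    rw [AddEquiv.symm_apply_apply, AddEquiv.symm_apply_apply]
  map_add' f g := Subtype.ext <| AddMonoidHom.ext fun m =>
    map_add (N.embedEquiv k hk).symm (f.1 (M.embedEquiv i hi m)) (g.1 (M.embedEquiv i hi m))

theorem embedHom_id (M : RMod R) (i : M.V → U) (hi : Function.Injective i)
    (h : AddMonoidHom.id M.V ∈ M.homs M) : M.embedHom M i hi i hi ⟨_, h⟩ = 𝟙 _ :=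
  Subtype.ext <| AddMonoidHom.ext fun m => (M.embedEquiv i hi).symm_apply_apply m

theorem embedHom_comp (M N P : RMod R) (i : M.V → U) (hi : Function.Injective i) (k : N.V → U)
    (hk : Function.Injective k) (l : P.V → U) (hl : Function.Injective l) (f : M.homs N)
    (g : N.homs P) (h : g.1.comp f.1 ∈ M.homs P) :
    M.embedHom P i hi l hl ⟨g.1.comp f.1, h⟩ =
      M.embedHom N i hi k hk f ≫ N.embedHom P k hk l hl g :=
  Subtype.ext <| AddMonoidHom.ext fun m => by
    change (P.embedEquiv l hl).symm (g.1 (f.1 (M.embedEquiv i hi m))) =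
      (P.embedEquiv l hl).symm (g.1 (N.embedEquiv k hk ((N.embedEquiv k hk).symm
        (f.1 (M.embedEquiv i hi m)))))
    rw [AddEquiv.apply_symm_apply]

end RMod

/-- A finite dimensional right vector space as a module. -/
def vecMod (D : Type u) [DivisionRing D] (V : Type u) [AddCommGroup V] [Module Dᵐᵒᵖ V]
    [Module.Finite Dᵐᵒᵖ V] : RMod D where
  V := V
  act := AddMonoidHom.mk' (fun m => AddMonoidHom.mk' (fun r => MulOpposite.op r • m) fun r s => by
    rw [MulOpposite.op_add, add_smul]) fun m m' => by ext r; exact smul_add _ _ _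
  act_mul m r s := by
    change MulOpposite.op (r * s) • m = MulOpposite.op s • MulOpposite.op r • m
    rw [MulOpposite.op_mul, mul_smul]
  unital m := ⟨1, one_smul _ m⟩
  fg := by
    obtain ⟨s, hs⟩ := Module.Finite.fg_top (R := Dᵐᵒᵖ) (M := V)
    refine ⟨s, fun N h1 h2 => ?_⟩
    have : Submodule.span Dᵐᵒᵖ (s : Set V) ≤ { N with smul_mem' := fun d m hm => h2 m hm d.unop } :=
      Submodule.span_le.2 h1
    rw [hs] at this
    exact eq_top_iff.2 fun m _ => this (Submodule.mem_top (x := m))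

/-- Homomorphisms of right vector spaces are linear maps. -/
def vecHom (D : Type u) [DivisionRing D] (V W : Type u) [AddCommGroup V] [Module Dᵐᵒᵖ V]
    [Module.Finite Dᵐᵒᵖ V] [AddCommGroup W] [Module Dᵐᵒᵖ W] [Module.Finite Dᵐᵒᵖ W] :
    (V →ₗ[Dᵐᵒᵖ] W) ≃+ (vecMod D V).homs (vecMod D W) where
  toFun f := ⟨(f.toAddMonoidHom : V →+ W), fun (m : V) r => f.map_smul (MulOpposite.op r) m⟩
  invFun g := { (g.1 : V →+ W) with map_smul' := fun d (m : V) => g.2 m d.unop }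
  left_inv _ := rfl
  right_inv _ := rfl
  map_add' _ _ := rfl

/-! ### Finite families of vector spaces as modules over a direct sum of division rings -/

section Sums

variable {J : Type u} {D : J → Type u} [∀ j, DivisionRing (D j)]

open scoped Classical in
/-- A homogeneous element of a sum of rings. -/
def sumSingle (j : J) (d : D j) : directSumRing D :=
  ⟨Pi.single j d, (Set.finite_singleton j).subset fun k hk => by
    by_contra h
    exact hk (Pi.single_eq_of_ne h d)⟩

variable (D) (V : J → Type u) [∀ j, AddCommGroup (V j)] [∀ j, Module (D j)ᵐᵒᵖ (V j)]

/-- The action of a sum of division rings on a product of vector spaces. -/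
def sumAct : (∀ j, V j) →+ directSumRing D →+ (∀ j, V j) :=
  AddMonoidHom.mk' (fun m => AddMonoidHom.mk' (fun r j => MulOpposite.op (r.1 j) • m j) fun r s =>
    funext fun j => add_smul (MulOpposite.op (r.1 j)) (MulOpposite.op (s.1 j)) (m j))
    fun m m' => by ext r j; exact smul_add _ _ _

@[simp]
theorem sumAct_apply (m : ∀ j, V j) (r : directSumRing D) (j : J) :
    sumAct D V m r j = MulOpposite.op (r.1 j) • m j := rfl

open scoped Classical in
theorem sumAct_single (m : ∀ j, V j) (j : J) (d : D j) :
    sumAct D V m (sumSingle j d) = Pi.single j (MulOpposite.op d • m j) := by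
  ext k
  rw [sumAct_apply]
  by_cases h : k = j
  · subst h
    simp [sumSingle]
  · simp [sumSingle, h]

variable [∀ j, Module.Finite (D j)ᵐᵒᵖ (V j)]

open scoped Classical in
/-- A finite family of finite dimensional vector spaces as a module over the sum of the rings. -/
def sumMod (hV : {j | Nontrivial (V j)}.Finite) : RMod (directSumRing D) where
  V := ∀ j, V j
  act := sumAct D V
  act_mul m r s := funext fun j => by
    change MulOpposite.op (r.1 j * s.1 j) • m j = MulOpposite.op (s.1 j) • MulOpposite.op (r.1 j) • m j
    rw [MulOpposite.op_mul, mul_smul]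
  unital m := by
    -- The direct sum may have no unit, but the idempotent supported on the finitely many nontrivial
    -- spaces fixes every element.
    refine ⟨⟨fun j => if Nontrivial (V j) then 1 else 0, hV.subset fun j hj => ?_⟩,
      funext fun j => ?_⟩
    · by_contra h
      exact hj (if_neg h)
    · rw [sumAct_apply]
      by_cases h : Nontrivial (V j)
      · simp [h]
      · rw [not_nontrivial_iff_subsingleton] at h
        exact Subsingleton.elim _ _
  fg := by
    choose s hs using fun j => Module.Finite.fg_top (R := (D j)ᵐᵒᵖ) (M := V j)
    -- Generators of each nontrivial space, placed in its coordinate.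
    refine ⟨hV.toFinset.biUnion fun j => (s j).image (Pi.single j), fun N h1 h2 => ?_⟩
    have key : ∀ j (v : V j), Pi.single j v ∈ N := fun j v => by
      by_cases h : Nontrivial (V j)
      · have h3 : Submodule.span (D j)ᵐᵒᵖ (s j : Set (V j)) ≤
            { N.comap (AddMonoidHom.single V j) with
              smul_mem' := fun d m hm => by
                have h4 := h2 _ hm (sumSingle j d.unop)
                rw [sumAct_single] at h4
                simpa using h4 } :=
          Submodule.span_le.2 fun v hv => h1 _ (Finset.mem_biUnion.2
            ⟨j, hV.mem_toFinset.2 h, Finset.mem_image_of_mem _ hv⟩)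
        rw [hs] at h3
        exact h3 (Submodule.mem_top (x := v))
      · rw [not_nontrivial_iff_subsingleton] at h
        rw [Subsingleton.elim v 0, Pi.single_zero]
        exact zero_mem _
    refine eq_top_iff.2 fun m _ => ?_
    have hm : m = ∑ j ∈ hV.toFinset, Pi.single j (m j) := by
      ext j
      rw [Finset.sum_apply]
      by_cases h : Nontrivial (V j)
      · rw [Finset.sum_pi_single, if_pos (hV.mem_toFinset.2 h)]
      · rw [not_nontrivial_iff_subsingleton] at h
        exact Subsingleton.elim _ _
    rw [hm]
    exact sum_mem fun j _ => key j _

end Sums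

/-! ### Homomorphisms over a direct sum of division rings -/

section Sums

variable {J : Type u} (D : J → Type u) [∀ j, DivisionRing (D j)]
  (V W : J → Type u) [∀ j, AddCommGroup (V j)] [∀ j, Module (D j)ᵐᵒᵖ (V j)]
  [∀ j, AddCommGroup (W j)] [∀ j, Module (D j)ᵐᵒᵖ (W j)]

variable {V W} in
open scoped Classical in
theorem map_single_smul {g : (∀ j, V j) →+ ∀ j, W j}
    (hg : ∀ m r, g (sumAct D V m r) = sumAct D W (g m) r) (j : J) (d : (D j)ᵐᵒᵖ) (v : V j) :
    g (Pi.single j (d • v)) j = d • g (Pi.single j v) j := by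
  have h := hg (Pi.single j v) (sumSingle j d.unop)
  rw [sumAct_single, sumAct_single, Pi.single_eq_same, MulOpposite.op_unop] at h
  rw [h, Pi.single_eq_same]

-- The idempotent `sumSingle j 1` cuts out coordinate `j` in both source and target, so a
-- homomorphism is diagonal.
variable {V W} in
open scoped Classical in
theorem map_single_apply {g : (∀ j, V j) →+ ∀ j, W j}
    (hg : ∀ m r, g (sumAct D V m r) = sumAct D W (g m) r) (j : J) (m : ∀ j, V j) :
    g (Pi.single j (m j)) j = g m j := by
  have h := hg m (sumSingle j 1)
  rw [sumAct_single, sumAct_single, MulOpposite.op_one, one_smul, one_smul] at h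
  rw [h, Pi.single_eq_same]

variable [∀ j, Module.Finite (D j)ᵐᵒᵖ (V j)] [∀ j, Module.Finite (D j)ᵐᵒᵖ (W j)]

open scoped Classical in
/-- Homomorphisms over a sum of rings are families of linear maps. -/
def sumHom (hV : {j | Nontrivial (V j)}.Finite) (hW : {j | Nontrivial (W j)}.Finite) :
    (∀ j, V j →ₗ[(D j)ᵐᵒᵖ] W j) ≃+ (sumMod D V hV).homs (sumMod D W hW) where
  toFun f := ⟨AddMonoidHom.mk' (fun m j => f j (m j)) fun m m' => funext fun j =>
    (f j).map_add (m j) (m' j), fun m r => funext fun j =>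
    (f j).map_smul (MulOpposite.op (r.1 j)) (m j)⟩
  invFun g j :=
    { toFun := fun v => g.1 (Pi.single j v) j
      map_add' := fun v w => by
        rw [Pi.single_add]
        exact congrFun (map_add g.1 (Pi.single j v) (Pi.single j w)) j
      map_smul' := fun d v => map_single_smul D g.2 j d v }
  left_inv f := funext fun j => LinearMap.ext fun v => congrArg (f j) (Pi.single_eq_same j v)
  right_inv g := Subtype.ext <| AddMonoidHom.ext fun m => funext fun j =>
    map_single_apply D g.2 j m
  map_add' _ _ := rfl

end Sums

variable {C : Type u} [SmallCategory C] [Preadditive C]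

/-- Linear algebra gives a fully faithful functor; injectivity on objects is arranged by the choice
of underlying sets. -/
theorem IsLinearCategory.isIsoToFullSubcategory_fgMod (h : IsLinearCategory C) :
    ∃ (J : Type u) (D : J → Type u) (_ : ∀ j, DivisionRing (D j)) (U : Type u),
      IsIsoToFullSubcategory C (FGMod (directSumRing D) U) := by
  obtain ⟨J, D, _, V, _, _, _, hV, φ, hφ⟩ := h
  have hid : ∀ A j, φ A A (𝟙 A) j = LinearMap.id := fun A j => by
    have h1 := hφ A A A ((φ A A).symm fun _ => LinearMap.id) (𝟙 A) j
    rw [Category.id_comp, AddEquiv.apply_symm_apply, LinearMap.id_comp] at h1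
    exact h1.symm
  -- Labelling elements with `A` makes the carriers of distinct objects disjoint, even when the
  -- modules are isomorphic or zero.
  let i : ∀ A, (∀ j, V A j) → Σ A, ∀ j, V A j := fun A v => ⟨A, v⟩
  have hi : ∀ A, Function.Injective (i A) := fun A =>
    sigma_mk_injective (β := fun A => ∀ j, V A j)
  let M : C → RMod (directSumRing D) := fun A => sumMod D (V A) (hV A)
  let σ : ∀ A B, (∀ j, V A j →ₗ[(D j)ᵐᵒᵖ] V B j) ≃+ (M A).homs (M B) := fun A B =>
    sumHom D (V A) (V B) (hV A) (hV B)
  let ψ : ∀ A B, (∀ j, V A j →ₗ[(D j)ᵐᵒᵖ] V B j) ≃+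
      ((M A).embed (i A) (hi A) ⟶ (M B).embed (i B) (hi B)) := fun A B =>
    (σ A B).trans ((M A).embedHom (M B) (i A) (hi A) (i B) (hi B))
  have hψid : ∀ A, ψ A A (fun _ => LinearMap.id) = 𝟙 _ := fun A =>
    (M A).embedHom_id (i A) (hi A) fun _ _ => rfl
  have hψ : ∀ A X B f g, ψ A B (fun j => f j ∘ₗ g j) = ψ A X g ≫ ψ X B f := fun A X B f g =>
    (M A).embedHom_comp (M X) (M B) (i A) (hi A) (i X) (hi X) (i B) (hi B)
      (σ A X g) (σ X B f) (σ A B fun j => f j ∘ₗ g j).2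
  refine ⟨J, D, inferInstance, Σ A, ∀ j, V A j,
    { obj := fun A => (M A).embed (i A) (hi A)
      map := fun {A B} f => ψ A B (φ A B f)
      map_id := fun A => by
        rw [show φ A A (𝟙 A) = fun _ => LinearMap.id from funext (hid A), hψid]
      map_comp := fun {A X B} g f => by
        rw [show φ A B (g ≫ f) = fun j => φ X B f j ∘ₗ φ A X g j from funext (hφ A X B f g),
          hψ] }, ⟨fun {A B f g} => map_add ((φ A B).trans (ψ A B)) f g⟩,
    ⟨fun {A B} => ((φ A B).trans (ψ A B)).surjective⟩,
    ⟨fun {A B} => ((φ A B).trans (ψ A B)).injective⟩, fun A B h => ?_⟩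
  have h' : (M A).embed (i A) (hi A) = (M B).embed (i B) (hi B) := h
  have h0 : i A 0 ∈ ((M B).embed (i B) (hi B)).carrier := by
    rw [← h']
    exact ⟨0, rfl⟩
  obtain ⟨v, hv⟩ := h0
  exact (congrArg Sigma.fst hv).symm

/-- A product of categories over an empty index set has a single object, too few for injectivity on
objects. All groups of morphisms are trivial in that case, so zero spaces over an arbitrary division
ring can be used instead. -/
theorem IsLinearCategory.exists_nonempty (h : IsLinearCategory C) :
    ∃ (J : Type u) (_ : Nonempty J) (D : J → Type u) (_ : ∀ j, DivisionRing (D j))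
      (V : C → J → Type u)
      (_ : ∀ A j, AddCommGroup (V A j)) (_ : ∀ A j, Module (D j)ᵐᵒᵖ (V A j)),
      (∀ A j, Module.Finite (D j)ᵐᵒᵖ (V A j)) ∧ (∀ A : C, {j | Nontrivial (V A j)}.Finite) ∧
      ∃ φ : ∀ A B : C, (A ⟶ B) ≃+ (∀ j, V A j →ₗ[(D j)ᵐᵒᵖ] V B j),
        ∀ (A X B : C) (f : X ⟶ B) (g : A ⟶ X) (j : J),
          φ A B (g ≫ f) j = φ X B f j ∘ₗ φ A X g j := by
  obtain ⟨J, D, i1, V, i2, i3, hfin, hV, φ, hφ⟩ := h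
  rcases isEmpty_or_nonempty J with hJ | hJ
  · have hs : ∀ A B : C, Subsingleton (A ⟶ B) := fun A B => (φ A B).injective.subsingleton
    refine ⟨PUnit, inferInstance, fun _ => ULift ℚ, inferInstance, fun _ _ => PUnit, inferInstance,
      inferInstance, inferInstance, fun A => Set.toFinite _, fun A B =>
        { toFun := 0
          invFun := 0
          left_inv := fun _ => Subsingleton.elim _ _
          right_inv := fun _ => Subsingleton.elim _ _
          map_add' := fun _ _ => Subsingleton.elim _ _ }, fun _ _ _ _ _ _ => Subsingleton.elim _ _⟩
  · exact ⟨J, hJ, D, i1, V, i2, i3, hfin, hV, φ, hφ⟩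

theorem IsLinearCategory.isIsoToFullSubcategory_finProd (h : IsLinearCategory C) :
    ∃ (J : Type u) (D : J → Type u) (_ : ∀ j, DivisionRing (D j)) (U : Type u),
      IsIsoToFullSubcategory C (FinProd fun j => FGMod (D j) U) := by
  obtain ⟨J, hJ, D, _, V, _, _, _, hV, φ, hφ⟩ := h.exists_nonempty
  have hid : ∀ A j, φ A A (𝟙 A) j = LinearMap.id := fun A j => by
    have h1 := hφ A A A ((φ A A).symm fun _ => LinearMap.id) (𝟙 A) j
    rw [Category.id_comp, AddEquiv.apply_symm_apply, LinearMap.id_comp] at h1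
    exact h1.symm
  -- One ambient set must serve all factors, so elements are labelled with `j` as well as `A`.
  let i : ∀ A j, V A j → Σ A, Σ j, V A j := fun A j v => ⟨A, j, v⟩
  have hi : ∀ A j, Function.Injective (i A j) := fun A j =>
    sigma_mk_injective.comp sigma_mk_injective
  let M : C → ∀ j, RMod (D j) := fun A j => vecMod (D j) (V A j)
  let ψ : ∀ A B j, (V A j →ₗ[(D j)ᵐᵒᵖ] V B j) ≃+
      ((M A j).embed (i A j) (hi A j) ⟶ (M B j).embed (i B j) (hi B j)) := fun A B j =>
    (vecHom (D j) (V A j) (V B j)).trans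
      ((M A j).embedHom (M B j) (i A j) (hi A j) (i B j) (hi B j))
  have hψid : ∀ A j, ψ A A j LinearMap.id = 𝟙 _ := fun A j =>
    (M A j).embedHom_id (i A j) (hi A j) fun _ _ => rfl
  have hψ : ∀ A X B j f g, ψ A B j (f ∘ₗ g) = ψ A X j g ≫ ψ X B j f := fun A X B j f g =>
    (M A j).embedHom_comp (M X j) (M B j) (i A j) (hi A j) (i X j) (hi X j) (i B j) (hi B j)
      (vecHom (D j) _ _ g) (vecHom (D j) _ _ f) (vecHom (D j) _ _ (f ∘ₗ g)).2
  have hzero : ∀ A, finiteSupport (fun j => FGMod (D j) (Σ A, Σ j, V A j))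
      fun j => (M A j).embed (i A j) (hi A j) := fun A => (hV A).subset fun j hj => by
    by_contra h
    have : Subsingleton (V A j) := not_nontrivial_iff_subsingleton.1 h
    refine hj ((IsZero.iff_id_eq_zero _).2 ?_)
    rw [← hψid, Subsingleton.elim LinearMap.id (0 : V A j →ₗ[(D j)ᵐᵒᵖ] V A j), map_zero]
  let F : C ⥤ FinProd fun j => FGMod (D j) (Σ A, Σ j, V A j) :=
    { obj := fun A => ⟨fun j => (M A j).embed (i A j) (hi A j), hzero A⟩
      map := fun {A B} f => ObjectProperty.homMk fun j => ψ A B j (φ A B f j)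
      map_id := fun A => by
        ext j
        change ψ A A j (φ A A (𝟙 A) j) = 𝟙 _
        rw [hid, hψid]
      map_comp := fun {A X B} g f => by
        ext j
        change ψ A B j (φ A B (g ≫ f) j) = ψ A X j (φ A X g j) ≫ ψ X B j (φ X B f j)
        rw [hφ, hψ] }
  refine ⟨J, D, inferInstance, _, F, ⟨fun {A B f g} => ?_⟩, ⟨fun {A B} f => ?_⟩,
    ⟨fun {A B} f g h => ?_⟩, fun A B h => ?_⟩
  · ext j
    change ψ A B j (φ A B (f + g) j) = ψ A B j (φ A B f j) + ψ A B j (φ A B g j)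
    rw [map_add, Pi.add_apply, map_add]
  · refine ⟨(φ A B).symm fun j => (ψ A B j).symm (f.hom j), ?_⟩
    ext j
    change ψ A B j (φ A B ((φ A B).symm _) j) = f.hom j
    rw [AddEquiv.apply_symm_apply, AddEquiv.apply_symm_apply]
  · refine (φ A B).injective (funext fun j => (ψ A B j).injective ?_)
    exact congrFun (congrArg (fun f => f.hom) h) j
  -- Any single factor separates the objects, since the label `A` is visible in its carrier; this is
  -- where an index is needed.
  · obtain ⟨j⟩ := hJ
    have h' : (M A j).embed (i A j) (hi A j) = (M B j).embed (i B j) (hi B j) :=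
      congrFun (congrArg (fun X => X.obj) h) j
    have h0 : i A j 0 ∈ ((M B j).embed (i B j) (hi B j)).carrier := by
      rw [← h']
      exact ⟨0, rfl⟩
    obtain ⟨v, hv⟩ := h0
    exact (congrArg Sigma.fst hv).symm

end Realization

/-! ### Full subcategories of categories of modules -/

section Subcategories

variable {C : Type u} [SmallCategory C] [Preadditive C]

/-- The isomorphism of groups of morphisms given by a fully faithful additive functor. -/
def homAddEquiv {𝒟 : Type*} [Category* 𝒟] [Preadditive 𝒟] (F : C ⥤ 𝒟) [F.Additive] [F.Full]
    [F.Faithful] (A B : C) : (A ⟶ B) ≃+ (F.obj A ⟶ F.obj B) :=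
  AddEquiv.ofBijective (F.mapAddHom) ⟨F.map_injective, F.map_surjective⟩

namespace FGMod

/-! ### Modules over one division ring as right vector spaces -/

section Vec

variable {D : Type u} [DivisionRing D] {U : Type u}

/-- The unit fixes every product `m r`, and these generate the module by unitality. -/
theorem act_one (M : FGMod D U) (m : M.carrier) : M.act m 1 = m := by
  have h : AddSubgroup.closure {x | ∃ m r, M.act m r = x} ≤
      AddMonoidHom.eqLocus (M.act.flip 1) (AddMonoidHom.id _) := by
    rw [AddSubgroup.closure_le]
    rintro x ⟨m, r, rfl⟩
    change M.act (M.act m r) 1 = M.act m r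
    rw [← M.act_mul, mul_one]
  rw [M.unital] at h
  exact h (AddSubgroup.mem_top m)

/-- A module over a division ring as a right vector space. -/
instance (M : FGMod D U) : Module Dᵐᵒᵖ M.carrier where
  smul d m := M.act m d.unop
  one_smul m := M.act_one m
  mul_smul d e m := M.act_mul m e.unop d.unop
  smul_zero d := by
    change M.act 0 d.unop = 0
    rw [map_zero, AddMonoidHom.zero_apply]
  smul_add d m m' := by
    change M.act (m + m') d.unop = M.act m d.unop + M.act m' d.unop
    rw [map_add, AddMonoidHom.add_apply]
  add_smul d e m := map_add (M.act m) d.unop e.unop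
  zero_smul m := map_zero (M.act m)

instance (M : FGMod D U) : Module.Finite Dᵐᵒᵖ M.carrier := by
  obtain ⟨s, hs⟩ := M.fg
  refine ⟨⟨s, ?_⟩⟩
  have h := hs (Submodule.span Dᵐᵒᵖ (s : Set M.carrier)).toAddSubgroup
    (fun m hm => Submodule.subset_span hm)
    (fun m hm r => Submodule.smul_mem _ (MulOpposite.op r) hm)
  exact eq_top_iff.2 fun m _ => (Submodule.mem_toAddSubgroup _).1 (h ▸ AddSubgroup.mem_top m)

/-- Homomorphisms of modules over a division ring are linear maps. -/
def linEquiv (M N : FGMod D U) : (M ⟶ N) ≃+ (M.carrier →ₗ[Dᵐᵒᵖ] N.carrier) where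
  toFun f := { f.1 with map_smul' := fun d m => f.2 m d.unop }
  invFun f := ⟨f.toAddMonoidHom, fun m r => f.map_smul (MulOpposite.op r) m⟩
  left_inv _ := rfl
  right_inv _ := rfl
  map_add' _ _ := rfl

theorem subsingleton_of_isZero {M : FGMod D U} (h : IsZero M) : Subsingleton M.carrier := by
  have h0 := (IsZero.iff_id_eq_zero _).1 h
  have h1 : ∀ m : M.carrier, m = 0 := fun m =>
    DFunLike.congr_fun (congrArg Subtype.val h0) m
  exact ⟨fun a b => (h1 a).trans (h1 b).symm⟩

end Vec

end FGMod

theorem isLinearCategory_of_finProd (h : ∃ (J : Type u) (D : J → Type u)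
    (_ : ∀ j, DivisionRing (D j)) (U : Type u),
    IsIsoToFullSubcategory C (FinProd fun j => FGMod (D j) U)) : IsLinearCategory C := by
  obtain ⟨J, D, _, U, F, _, _, _, -⟩ := h
  let e : ∀ A B, (F.obj A ⟶ F.obj B) ≃+
      ∀ j, ((F.obj A).obj j).carrier →ₗ[(D j)ᵐᵒᵖ] ((F.obj B).obj j).carrier := fun A B =>
    { toFun := fun f j => FGMod.linEquiv _ _ (f.hom j)
      invFun := fun f => ObjectProperty.homMk fun j => (FGMod.linEquiv _ _).symm (f j)
      left_inv := fun _ => rfl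
      right_inv := fun _ => rfl
      map_add' := fun _ _ => rfl }
  refine ⟨J, D, inferInstance, fun A j => ((F.obj A).obj j).carrier, inferInstance, inferInstance,
    inferInstance, fun A => (F.obj A).property.subset fun j hj hz => ?_,
    fun A B => (homAddEquiv F A B).trans (e A B), fun A X B f g j => ?_⟩
  · have := FGMod.subsingleton_of_isZero hz
    exact not_nontrivial_iff_subsingleton.2 this hj
  · exact congrArg (fun k => e A B k j) (F.map_comp g f)

/-! ### Splitting modules over a direct sum by the idempotents of the ring -/

namespace FGMod

variable {J : Type u} {D : J → Type u} [∀ j, DivisionRing (D j)] {U : Type u}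

theorem mul_sumSingle (r : directSumRing D) (j : J) (d : D j) :
    r * sumSingle j d = sumSingle j (r.1 j * d) := by
  classical
  refine Subtype.ext (funext fun k => ?_)
  change r.1 k * Pi.single j d k = Pi.single j (r.1 j * d) k
  by_cases h : k = j
  · subst h
    simp
  · simp [h]

theorem sumSingle_mul (r : directSumRing D) (j : J) (d : D j) :
    sumSingle j d * r = sumSingle j (d * r.1 j) := by
  classical
  refine Subtype.ext (funext fun k => ?_)
  change Pi.single j d k * r.1 k = Pi.single j (d * r.1 j) k
  by_cases h : k = j
  · subst h
    simp
  · simp [h]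

open scoped Classical in
theorem sumSingle_zero (j : J) : sumSingle (D := D) j 0 = 0 :=
  Subtype.ext (Pi.single_zero j)

open scoped Classical in
theorem sumSingle_add (j : J) (d e : D j) : sumSingle j (d + e) = sumSingle j d + sumSingle j e :=
  Subtype.ext (Pi.single_add j d e)

theorem eq_sum_sumSingle (r : directSumRing D) (T : Finset J) (hT : ∀ j ∉ T, r.1 j = 0) :
    r = ∑ j ∈ T, sumSingle j (r.1 j) := by
  classical
  refine Subtype.ext (funext fun k => ?_)
  rw [AddSubmonoidClass.coe_finsetSum, Finset.sum_apply]
  change r.1 k = ∑ j ∈ T, Pi.single j (r.1 j) k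
  rw [Finset.sum_pi_single]
  split_ifs with h
  · rfl
  · exact hT k h

variable (M N P : FGMod (directSumRing D) U)

/-- The projection to the part of a module on which a summand of the ring acts. -/
def proj (j : J) : M.carrier →+ M.carrier := M.act.flip (sumSingle j 1)

theorem proj_apply (j : J) (m : M.carrier) : M.proj j m = M.act m (sumSingle j 1) := rfl

theorem act_proj (j : J) (m : M.carrier) (r : directSumRing D) :
    M.act (M.proj j m) r = M.act m (sumSingle j (r.1 j)) := by
  rw [proj_apply, ← M.act_mul, sumSingle_mul, one_mul]

theorem proj_act (j : J) (m : M.carrier) (r : directSumRing D) :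
    M.proj j (M.act m r) = M.act m (sumSingle j (r.1 j)) := by
  rw [proj_apply, ← M.act_mul, mul_sumSingle, mul_one]

theorem proj_proj (j : J) (m : M.carrier) : M.proj j (M.proj j m) = M.proj j m := by
  classical
  rw [M.proj_apply j m, proj_act]
  congr 2
  exact Pi.single_eq_same j _

theorem map_proj (f : M ⟶ N) (j : J) (m : M.carrier) : f.1 (M.proj j m) = N.proj j (f.1 m) :=
  f.2 m _

/-- The part of a module on which a summand of the ring acts. -/
def part (j : J) : AddSubgroup M.carrier := (M.proj j).range

theorem proj_mem (j : J) (m : M.carrier) : M.proj j m ∈ M.part j := ⟨m, rfl⟩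

theorem proj_of_mem {j : J} {m : M.carrier} (h : m ∈ M.part j) : M.proj j m = m := by
  obtain ⟨m, rfl⟩ := h
  exact M.proj_proj j m

theorem act_of_mem {j : J} {m : M.carrier} (h : m ∈ M.part j) (r : directSumRing D) :
    M.act m r = M.act m (sumSingle j (r.1 j)) := by
  obtain ⟨m, rfl⟩ := h
  classical
  rw [act_proj, act_proj]
  congr 2
  exact (Pi.single_eq_same j _).symm

theorem act_mem {j : J} {m : M.carrier} (h : m ∈ M.part j) (r : directSumRing D) :
    M.act m r ∈ M.part j := by
  obtain ⟨m, rfl⟩ := h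
  rw [act_proj, ← proj_act]
  exact M.proj_mem j _

/-- The part of a module as a right vector space. -/
instance (j : J) : Module (D j)ᵐᵒᵖ (M.part j) where
  smul d m := ⟨M.act m.1 (sumSingle j d.unop), M.act_mem m.2 _⟩
  one_smul m := Subtype.ext (M.proj_of_mem m.2)
  mul_smul d e m := Subtype.ext <| by
    classical
    change M.act m.1 (sumSingle j (e.unop * d.unop)) =
      M.act (M.act m.1 (sumSingle j e.unop)) (sumSingle j d.unop)
    rw [← M.act_mul, mul_sumSingle]
    congr 3
    exact (Pi.single_eq_same j _).symm
  smul_zero d := Subtype.ext <| by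
    change M.act 0 (sumSingle j d.unop) = 0
    rw [map_zero, AddMonoidHom.zero_apply]
  smul_add d m m' := Subtype.ext <| by
    change M.act (m.1 + m'.1) (sumSingle j d.unop) = _
    rw [map_add, AddMonoidHom.add_apply]
    rfl
  add_smul d e m := Subtype.ext <| by
    change M.act m.1 (sumSingle j (d.unop + e.unop)) = _
    rw [sumSingle_add, map_add]
    rfl
  zero_smul m := Subtype.ext <| by
    change M.act m.1 (sumSingle j 0) = 0
    rw [sumSingle_zero, map_zero]

theorem coe_smul_part (j : J) (d : (D j)ᵐᵒᵖ) (m : M.part j) :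
    ((d • m : M.part j) : M.carrier) = M.act m.1 (sumSingle j d.unop) := rfl

/-- The projection onto a part. -/
def toPart (j : J) : M.carrier →+ M.part j := (M.proj j).codRestrict _ (M.proj_mem j)

theorem toPart_act (j : J) (m : M.carrier) (r : directSumRing D) :
    M.toPart j (M.act m r) = MulOpposite.op (r.1 j) • M.toPart j m := by
  refine Subtype.ext ?_
  change M.proj j (M.act m r) = M.act (M.proj j m) (sumSingle j (r.1 j))
  classical
  rw [proj_act, act_proj]
  congr 2
  exact (Pi.single_eq_same j _).symm

theorem toPart_coe (j : J) (m : M.part j) : M.toPart j m = m := Subtype.ext (M.proj_of_mem m.2)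

instance (j : J) : Module.Finite (D j)ᵐᵒᵖ (M.part j) := by
  classical
  obtain ⟨s, hs⟩ := M.fg
  refine ⟨⟨s.image (M.toPart j), ?_⟩⟩
  set N := Submodule.span (D j)ᵐᵒᵖ (s.image (M.toPart j) : Set (M.part j))
  have h := hs (N.toAddSubgroup.comap (M.toPart j))
    (fun m hm => Submodule.subset_span (Finset.mem_coe.2 (Finset.mem_image_of_mem _ hm)))
    (fun m hm r => by
      change M.toPart j _ ∈ N
      rw [toPart_act]
      exact N.smul_mem _ hm)
  refine eq_top_iff.2 fun m _ => ?_
  have hm : m.1 ∈ N.toAddSubgroup.comap (M.toPart j) := h ▸ AddSubgroup.mem_top _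
  change M.toPart j m.1 ∈ N at hm
  rwa [toPart_coe] at hm

/-- By unitality `m` lies in the group generated by the products `m' r`, and each `r` has finite
support. -/
theorem finite_proj_ne_zero (m : M.carrier) : {j | M.proj j m ≠ 0}.Finite := by
  have h : m ∈ AddSubgroup.closure {x | ∃ m r, M.act m r = x} := M.unital ▸ AddSubgroup.mem_top _
  induction h using AddSubgroup.closure_induction with
  | mem x hx =>
    obtain ⟨m, r, rfl⟩ := hx
    refine Set.Finite.subset r.2 fun j hj h0 => hj ?_
    rw [proj_act, h0, sumSingle_zero, map_zero]
  | zero => simp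
  | add x y _ _ hx hy =>
    refine (hx.union hy).subset fun j hj => ?_
    by_contra h
    rw [Set.mem_union, not_or] at h
    exact hj (by rw [map_add, not_not.1 h.1, not_not.1 h.2, add_zero])
  | neg x _ hx => simpa using hx

/-- Kernels of the projections are submodules, so a finite set that works for the finitely many
generators works for the whole module. -/
theorem exists_proj_eq_zero : ∃ T : Finset J, ∀ j ∉ T, ∀ m, M.proj j m = 0 := by
  classical
  obtain ⟨s, hs⟩ := M.fg
  refine ⟨s.biUnion fun m => (M.finite_proj_ne_zero m).toFinset, fun j hj m => ?_⟩
  have h := hs (M.proj j).ker (fun m hm => by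
    by_contra h
    exact hj (Finset.mem_biUnion.2 ⟨m, hm, (Set.Finite.mem_toFinset _).2 h⟩)) fun m hm r => by
      rw [AddMonoidHom.mem_ker, proj_act, ← act_proj, AddMonoidHom.mem_ker.1 hm, map_zero,
        AddMonoidHom.zero_apply]
  exact AddMonoidHom.mem_ker.1 (h ▸ AddSubgroup.mem_top m)

/-- A finite set containing the indices of the nonzero parts. -/
def support : Finset J := M.exists_proj_eq_zero.choose

theorem proj_eq_zero {j : J} (hj : j ∉ M.support) (m : M.carrier) : M.proj j m = 0 :=
  M.exists_proj_eq_zero.choose_spec j hj m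

theorem sum_proj (m : M.carrier) : ∑ j ∈ M.support, M.proj j m = m := by
  classical
  have h : m ∈ AddSubgroup.closure {x | ∃ m r, M.act m r = x} := M.unital ▸ AddSubgroup.mem_top _
  induction h using AddSubgroup.closure_induction with
  | mem x hx =>
    obtain ⟨m, r, rfl⟩ := hx
    -- The index set is enlarged by the support of `r` so that `r` can be expanded; the added terms
    -- vanish because their projections do.
    have h1 := eq_sum_sumSingle r (M.support ∪ (Set.Finite.toFinset r.2)) fun j hj => by
      by_contra h
      exact hj (Finset.mem_union_right _ ((Set.Finite.mem_toFinset _).2 h))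
    conv_rhs => rw [h1, map_sum]
    rw [← Finset.sum_subset Finset.subset_union_left fun j _ hj => ?_]
    · exact Finset.sum_congr rfl fun j _ => M.proj_act j m r
    · rw [← act_proj, M.proj_eq_zero hj, map_zero, AddMonoidHom.zero_apply]
  | zero => simp
  | add x y _ _ hx hy => simp only [map_add, Finset.sum_add_distrib, hx, hy]
  | neg x _ hx => simp only [map_neg, Finset.sum_neg_distrib, hx]

/-- Homomorphisms over a sum of division rings are families of linear maps. -/
def partsEquiv : (M ⟶ N) ≃+ ∀ j, M.part j →ₗ[(D j)ᵐᵒᵖ] N.part j where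
  toFun f j :=
    { toFun := fun m => ⟨f.1 m.1, by
        rw [← M.proj_of_mem m.2, map_proj]
        exact N.proj_mem j _⟩
      map_add' := fun m m' => Subtype.ext (map_add f.1 m.1 m'.1)
      map_smul' := fun d m => Subtype.ext (f.2 m.1 (sumSingle j d.unop)) }
  invFun f := ⟨∑ j ∈ M.support, (N.part j).subtype.comp ((f j).toAddMonoidHom.comp (M.toPart j)),
    fun m r => by
      rw [AddMonoidHom.finsetSum_apply, AddMonoidHom.finsetSum_apply, map_sum,
        AddMonoidHom.finsetSum_apply]
      refine Finset.sum_congr rfl fun j _ => ?_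
      change ((f j (M.toPart j (M.act m r)) : N.part j) : N.carrier) =
        N.act (f j (M.toPart j m)).1 r
      rw [toPart_act, LinearMap.map_smul, coe_smul_part, N.act_of_mem (f j (M.toPart j m)).2 r]
      rfl⟩
  left_inv f := Subtype.ext <| AddMonoidHom.ext fun m => by
    change (∑ j ∈ M.support, _ : M.carrier →+ N.carrier) m = f.1 m
    rw [AddMonoidHom.finsetSum_apply]
    conv_rhs => rw [← M.sum_proj m, map_sum]
    rfl
  right_inv f := funext fun j => LinearMap.ext fun m => Subtype.ext <| by
    classical
    change (∑ i ∈ M.support, (N.part i).subtype.comp ((f i).toAddMonoidHom.comp (M.toPart i)))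
      m.1 = (f j m).1
    -- The idempotents of different summands are orthogonal.
    have h1 : ∀ i ≠ j, M.toPart i m.1 = 0 := fun i hi => Subtype.ext <| by
      change M.proj i m.1 = 0
      rw [← M.proj_of_mem m.2, M.proj_apply j, proj_act]
      rw [show (sumSingle j (1 : D j)).1 i = 0 from Pi.single_eq_of_ne hi _, sumSingle_zero,
        map_zero]
    rw [AddMonoidHom.finsetSum_apply, Finset.sum_eq_single j]
    · change (f j (M.toPart j m.1)).1 = _
      rw [toPart_coe]
    · intro i _ hi
      change (f i (M.toPart i m.1)).1 = 0
      rw [h1 i hi, map_zero]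
      rfl
    · intro hj
      change (f j (M.toPart j m.1)).1 = 0
      rw [show M.toPart j m.1 = 0 from Subtype.ext (M.proj_eq_zero hj m.1), map_zero]
      rfl
  map_add' _ _ := rfl

theorem finite_nontrivial_part : {j | Nontrivial (M.part j)}.Finite := by
  refine M.support.finite_toSet.subset fun j hj => ?_
  by_contra h
  have h0 : ∀ m : M.part j, m = 0 := fun m => by
    rw [← M.toPart_coe j m]
    exact Subtype.ext (M.proj_eq_zero h m.1)
  obtain ⟨x, y, hxy⟩ := hj
  exact hxy ((h0 x).trans (h0 y).symm)

end FGMod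

theorem isLinearCategory_of_fgMod (h : ∃ (J : Type u) (D : J → Type u)
    (_ : ∀ j, DivisionRing (D j)) (U : Type u),
    IsIsoToFullSubcategory C (FGMod (directSumRing D) U)) : IsLinearCategory C := by
  obtain ⟨J, D, _, U, F, _, _, _, -⟩ := h
  refine ⟨J, D, inferInstance, fun A j => (F.obj A).part j, inferInstance, inferInstance,
    inferInstance, fun A => (F.obj A).finite_nontrivial_part,
    fun A B => (homAddEquiv F A B).trans (FGMod.partsEquiv _ _), fun A X B f g j => ?_⟩
  exact congrArg (fun k => FGMod.partsEquiv (F.obj A) (F.obj B) k j) (F.map_comp g f)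

theorem isIsoToFullSubcategory_fgMod_iff : (∃ (J : Type u) (D : J → Type u)
    (_ : ∀ j, DivisionRing (D j)) (U : Type u),
    IsIsoToFullSubcategory C (FGMod (directSumRing D) U)) ↔ IsMatrixCategory C :=
  ⟨fun h => (isLinearCategory_of_fgMod h).isMatrixCategory,
    fun h => h.isLinearCategory.isIsoToFullSubcategory_fgMod⟩

theorem isIsoToFullSubcategory_finProd_iff : (∃ (J : Type u) (D : J → Type u)
    (_ : ∀ j, DivisionRing (D j)) (U : Type u),
    IsIsoToFullSubcategory C (FinProd fun j => FGMod (D j) U)) ↔ IsMatrixCategory C :=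
  ⟨fun h => (isLinearCategory_of_finProd h).isMatrixCategory,
    fun h => h.isLinearCategory.isIsoToFullSubcategory_finProd⟩

end Subcategories

end GrCat

end

/-! ### The equivalence of all the conditions -/

open GrCat in
theorem mainTheorem10 (C : Type u) [SmallCategory C] [Preadditive C] :
    List.TFAE [
      IsSemisimpleCategory C,
      IsRightGrSemisimple (CatRing.component C),
      IsLeftGrSemisimple (CatRing.component C),
      ∀ F : GrFunOp C, IsSemisimpleObject.{u} F,
      ∀ F : Cᵒᵖ ⥤+ AddCommGrpCat.{u}, IsSemisimpleObject.{u} F,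
      ∀ F : GrFun C, IsSemisimpleObject.{u} F,
      ∀ F : C ⥤+ AddCommGrpCat.{u}, IsSemisimpleObject.{u} F,
      ∀ A : C, IsSemisimpleObject.{u} (homFrom C A),
      ∃ (J : Type u) (D : J → Type u) (_ : ∀ j, DivisionRing (D j)) (n : J → C → ℕ),
        (∀ A : C, {j | n j A ≠ 0}.Finite) ∧
        ∃ φ : ∀ A B : C, (A ⟶ B) ≃+ (∀ j, Matrix (Fin (n j B)) (Fin (n j A)) (D j)),
          ∀ (A X B : C) (f : X ⟶ B) (g : A ⟶ X) (j : J),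
            φ A B (g ≫ f) j = φ X B f j * φ A X g j,
      ∃ (J : Type u) (D : J → Type u) (_ : ∀ j, DivisionRing (D j)) (U : Type u),
        IsIsoToFullSubcategory C (FGMod (directSumRing D) U),
      ∃ (J : Type u) (D : J → Type u) (_ : ∀ j, DivisionRing (D j)) (U : Type u),
        IsIsoToFullSubcategory C (FinProd fun j => FGMod (D j) U)] := by
  -- The matrix description in the list is `IsMatrixCategory C` unfolded; the other conditions reach
  -- it directly or through one neighbour.
  tfae_have 1 ↔ 9 := isSemisimpleCategory_iff_isMatrixCategory
  tfae_have 2 ↔ 1 := CatRing.isRightGrSemisimple_iff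
  tfae_have 3 ↔ 8 := CatRing.isLeftGrSemisimple_iff
  tfae_have 4 ↔ 5 := GrFunOp.forall_isSemisimpleObject_iff_additiveFunctor
  -- Contravariant functors are covariant functors on the opposite category, whose matrix
  -- description is that of `C` transposed.
  tfae_have 5 ↔ 9 := additiveFunctor_iff_isMatrixCategory.trans (isMatrixCategory_op_iff C)
  tfae_have 6 ↔ 7 := GrFun.forall_isSemisimpleObject_iff_additiveFunctor
  tfae_have 7 ↔ 9 := additiveFunctor_iff_isMatrixCategory
  tfae_have 8 ↔ 9 := homFrom_iff_isMatrixCategory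
  tfae_have 10 ↔ 9 := isIsoToFullSubcategory_fgMod_iff
  tfae_have 11 ↔ 9 := isIsoToFullSubcategory_finProd_iff
  tfae_finish
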